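/- For $n\ge 2$ let $C_n=[-\tfrac12,\tfrac12]^n\subset\mathbb{R}^n$ be the unit cube. For a unit vector $u=(x_1,\dots,x_n)$ let $P_u$ be the orthogonal projection of $C_n$ onto the hyperplane $u^\perp\cong\mathbb{R}^{n-1}$, and let $ar(u)$ be the surface area of $P_u$, i.e. the $(n-2)$-dimensional measure of the boundary of $P_u$ in $u^\perp$. Let $\mathbb{E}$ denote expectation when $u$ is uniformly distributed on the unit sphere of $\mathbb{R}^n$. Write $$K(\xi)=\int_0^{\pi/2}\frac{d\theta}{\sqrt{1-\xi^2\sin^2\theta}},\qquad E(\xi)=\int_0^{\pi/2}\sqrt{1-\xi^2\sin^2\theta}\,d\theta$$ for the complete elliptic integrals, let $$\zeta_4=256\cdot\frac{4}{3\pi^2}\int_0^\infty\frac{(8t^4+8t^2-1)E(it)^2-2(4t^4+3t^2-1)E(it)K(it)+(2t^4+t^2-1)K(it)^2}{(2t^2+1)^5}\,t\,dt ,$$ where the integral converges absolutely, and for $n\ge 3$, $n\neq 4$, let $$\zeta_n=4n\,\mathbb{E}\Big(\sqrt{x_1^2+x_2^2}\,\sqrt{x_1^2+x_3^2}\Big).$$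 1. For every $n\ge2$ and every unit vector $u=(x_1,\dots,x_n)$, $$ar(u)=2\sum_{1\le i<j\le n}\sqrt{x_i^2+x_j^2}.$$ 2. For $n=4$: $\mathbb{E}(ar)=8$ and $\mathbb{E}(ar^2)=12+6\zeta_4+3\pi$; moreover $\max(ar)=6\sqrt2$ and $\min(ar)=6$ over all unit vectors. 3. The following triple integrals have the stated values: $$\int_0^{\pi/2}\!\!\int_0^{\pi/2}\!\!\int_0^{\pi/2}\sin\varphi\sin\psi\sqrt{\cos^2\varphi\sin^2\psi+\cos^2\psi}\;\frac{1}{2\pi^2}\sin\varphi\sin^2\psi\,d\psi\,d\varphi\,d\theta=\frac{\pi}{128},$$ $$\int_0^{\pi/2}\!\!\int_0^{\pi/2}\!\!\int_0^{\pi/2}\sin\varphi\sin\psi\sqrt{\sin^2\theta\sin^2\varphi\sin^2\psi+\cos^2\psi}\;\frac{1}{2\pi^2}\sin\varphi\sin^2\psi\,d\psi\,d\varphi\,d\theta=\frac{\zeta_4}{256}.$$ 4. For every $n\ge2$, $$\mathbb{E}(ar)=\frac{\sqrt{\pi}\,(n-1)n}{2}\,\frac{\Gamma(n/2)}{\Gamma((n+1)/2)},$$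 and for every $n\ge3$, $$\mathbb{E}(ar^2)=4(n-1)+(n-2)(n-1)\zeta_n+\frac{(n-3)(n-2)(n-1)}{2}\pi .$$ The formula defining $\zeta_n$ for $n\ne4$ is also valid for $n=4$: $\zeta_4=16\,\mathbb{E}\big(\sqrt{x_1^2+x_2^2}\sqrt{x_1^2+x_3^2}\big)$. -/

import Mathlib

open MeasureTheory

noncomputable section

namespace CubeShadow

/-- The cube with edges of unit length centred at the origin of `ℝⁿ`. -/
def cube (n : ℕ) : Set (EuclideanSpace ℝ (Fin n)) :=
  {x | ∀ i, |x i| ≤ 1 / 2}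

/-- The hyperplane of all vectors orthogonal to `u`. -/
abbrev hyperplane {n : ℕ} (u : EuclideanSpace ℝ (Fin n)) :
    Submodule ℝ (EuclideanSpace ℝ (Fin n)) :=
  (Submodule.span ℝ {u})ᗮ

/-- The orthogonal projection of the cube onto the hyperplane `uᗮ`, as a subset of that
hyperplane. -/
def shadow {n : ℕ} (u : EuclideanSpace ℝ (Fin n)) : Set (hyperplane u) :=
  (hyperplane u).orthogonalProjectionOnto '' cube n

/-- The surface area of the projected polyhedron: the `(n - 2)`-dimensional Euclidean Hausdorff
measure (normalized to agree with Lebesgue measure on `ℝⁿ⁻²`) of its boundary relative to the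
`(n - 1)`-dimensional hyperplane `uᗮ`. Used for `2 ≤ n` and `u` of unit length. -/
def surfaceArea {n : ℕ} (u : EuclideanSpace ℝ (Fin n)) : ENNReal :=
  Measure.euclideanHausdorffMeasure (n - 2) (frontier (shadow u))

/-- The surface area as a real number. -/
def ar {n : ℕ} (u : EuclideanSpace ℝ (Fin n)) : ℝ :=
  (surfaceArea u).toReal

/-- The uniform probability distribution on the unit sphere of `ℝⁿ`, `1 ≤ n`. -/
def uniformSphere (n : ℕ) : Measure (Metric.sphere (0 : EuclideanSpace ℝ (Fin n)) 1) :=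
  ((volume : Measure (EuclideanSpace ℝ (Fin n))).toSphere Set.univ)⁻¹ •
    (volume : Measure (EuclideanSpace ℝ (Fin n))).toSphere

/-- The expectation `𝔼 f(U)` for `U` uniform on the unit sphere of `ℝⁿ`. -/
def sphereMean (n : ℕ) (f : EuclideanSpace ℝ (Fin n) → ℝ) : ℝ :=
  ∫ u, f (u : EuclideanSpace ℝ (Fin n)) ∂(uniformSphere n)

/-- The complete elliptic integral of the first kind as a function of the parameter `m = ξ²`,
`ξ` being the modulus; so `K(i t)` is `ellipticK (-t ^ 2)`. -/
def ellipticK (m : ℝ) : ℝ :=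
  ∫ θ in (0 : ℝ)..Real.pi / 2, 1 / √(1 - m * Real.sin θ ^ 2)

/-- The complete elliptic integral of the second kind as a function of the parameter `m = ξ²`,
`ξ` being the modulus; so `E(i t)` is `ellipticE (-t ^ 2)`. -/
def ellipticE (m : ℝ) : ℝ :=
  ∫ θ in (0 : ℝ)..Real.pi / 2, √(1 - m * Real.sin θ ^ 2)

/-- The integrand of the expression for `ζ₄ / 256` in terms of `E(i t)` and `K(i t)`. -/
def zetaFourIntegrand (t : ℝ) : ℝ :=
  ((8 * t ^ 4 + 8 * t ^ 2 - 1) * ellipticE (-t ^ 2) ^ 2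
      - 2 * (4 * t ^ 4 + 3 * t ^ 2 - 1) * ellipticE (-t ^ 2) * ellipticK (-t ^ 2)
      + (2 * t ^ 4 + t ^ 2 - 1) * ellipticK (-t ^ 2) ^ 2) / (2 * t ^ 2 + 1) ^ 5 * t

/-- The explicit constant `ζ₄ = 7.1185587167...`. -/
def zetaFour : ℝ :=
  256 * (4 / (3 * Real.pi ^ 2) * ∫ t in Set.Ioi (0 : ℝ), zetaFourIntegrand t)

/-- The constant `ζₙ = 4 n 𝔼(√(x₁² + x₂²) √(x₁² + x₃²))` for `n ≥ 3`. -/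
def zeta (n : ℕ) (hn : 3 ≤ n) : ℝ :=
  4 * n * sphereMean n fun x =>
    √(x ⟨0, by omega⟩ ^ 2 + x ⟨1, by omega⟩ ^ 2) * √(x ⟨0, by omega⟩ ^ 2 + x ⟨2, by omega⟩ ^ 2)

end CubeShadow

end

/-!
A face of codimension two of the cube projects into the boundary of the shadow when it lies in a
supporting hyperplane parallel to `u`. These are the faces on which, for some `i ≠ j`, the `i`-th
coordinate has the sign of `u i` and the `j`-th coordinate the sign opposite to `u j`, and the Gram
determinant of the projection of such a face is `u i ^ 2 + u j ^ 2`. The extreme values of the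
surface area then follow from the bound `s ≤ √s` on `[0, 1]` and from the Cauchy–Schwarz inequality.

The direction of a Gaussian vector is uniform and independent of its norm, so the moments of the
surface area reduce to Gaussian means of products of `√(x i ^ 2 + x j ^ 2)`. Factors of disjoint
pairs of indices are independent, equal pairs give a second moment, and pairs with one common index
give `sharedPairMean`, of which `ζₙ` is the same multiple for all `n`.

In spherical coordinates of `ℝ⁴`, `sharedPairMean` becomes `angleIntegral`, and integration by parts
reduces that to the integrals of `(1 - sin ξ ^ 2) ^ j / √(1 - sin ξ ^ 2 * sin θ ^ 2)`, `j = 1, 2`.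
The product formula `ellipticK_sq` expresses `ellipticK m ^ 2` as an integral of values of
`ellipticK`, and integrating it against powers of `1 / (1 - 2 * m)` gives multiples of the same two
integrals. The integrand of `ζ₄` differs from a combination of those multiples of
`ellipticK (-t ^ 2) ^ 2` by the derivative of a quadratic form in the two elliptic integrals that
vanishes at `0` and at infinity.
-/

noncomputable section

namespace CubeShadow

open Set Filter Topology

section Box

variable {ι : Type*} [Fintype ι]

/-- The unit cube centred at the origin of a Euclidean space with an arbitrary finite set of
coordinates; `box (Fin n)` is `cube n`. It also parametrizes the lower-dimensional faces. -/
def box (ι : Type*) [Fintype ι] : Set (EuclideanSpace ℝ ι) :=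
  {x | ∀ i, |x i| ≤ 1 / 2}

lemma ofLp_preimage_Icc_eq_box :
    WithLp.ofLp ⁻¹' Icc (fun _ : ι => (-(1 / 2) : ℝ)) (fun _ => 1 / 2) = box ι := by
  ext x
  simp only [box, mem_preimage, mem_Icc, Pi.le_def, mem_ofPred_eq, abs_le, forall_and]

lemma isCompact_box : IsCompact (box ι) := by
  rw [← ofLp_preimage_Icc_eq_box]
  exact (PiLp.homeomorph 2 fun _ : ι => ℝ).isCompact_preimage.2 isCompact_Icc

lemma convex_box : Convex ℝ (box ι) := by
  rw [← ofLp_preimage_Icc_eq_box]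
  exact (convex_Icc _ _).linear_preimage (WithLp.linearEquiv 2 ℝ (ι → ℝ)).toLinearMap

lemma box_mem_nhds_zero : box ι ∈ 𝓝 (0 : EuclideanSpace ℝ ι) := by
  rw [← ofLp_preimage_Icc_eq_box]
  refine (PiLp.continuous_ofLp 2 fun _ : ι => ℝ).continuousAt.preimage_mem_nhds ?_
  rw [← pi_univ_Icc]
  exact set_pi_mem_nhds finite_univ fun i _ => Icc_mem_nhds (by norm_num) (by norm_num)

lemma volume_box : volume (box ι) = 1 := by
  rw [← ofLp_preimage_Icc_eq_box,
    (PiLp.volume_preserving_ofLp ι).measure_preimage measurableSet_Icc.nullMeasurableSet,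
    Real.volume_Icc_pi]
  norm_num

lemma ae_forall_abs_ne (a : ℝ) : ∀ᵐ x : EuclideanSpace ℝ ι, ∀ i, |x i| ≠ a := by
  have hpi : ∀ᵐ y : ι → ℝ, ∀ i, |y i| ≠ a := by
    refine ae_all_iff.2 fun i => ?_
    filter_upwards [Measure.ae_eval_ne (μ := fun _ : ι => volume) i a,
      Measure.ae_eval_ne (μ := fun _ : ι => volume) i (-a)] with y ha hna h
    exact (eq_or_eq_neg_of_abs_eq h).elim ha hna
  exact (PiLp.volume_preserving_ofLp ι).quasiMeasurePreserving.ae hpi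

lemma forall_inner_le_box_iff {w c : EuclideanSpace ℝ ι} (hc : c ∈ box ι) :
    (∀ x ∈ box ι, inner ℝ w x ≤ inner ℝ w c) ↔ ∀ k, w k * c k = |w k| / 2 := by
  classical
  have mul_le : ∀ x ∈ box ι, ∀ k, w k * x k ≤ |w k| / 2 := fun x hx k =>
    calc w k * x k ≤ |w k * x k| := le_abs_self _
      _ = |w k| * |x k| := abs_mul _ _
      _ ≤ |w k| * (1 / 2) := mul_le_mul_of_nonneg_left (hx k) (abs_nonneg _)
      _ = |w k| / 2 := by ring
  refine ⟨fun h k => (mul_le c hc k).antisymm ?_, fun h x hx => ?_⟩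
  · obtain ⟨s, hs, hws⟩ : ∃ s : ℝ, |s| ≤ 1 / 2 ∧ w k * s = |w k| / 2 := by
      rcases le_total 0 (w k) with hk | hk
      · exact ⟨1 / 2, by norm_num, by rw [abs_of_nonneg hk]; ring⟩
      · exact ⟨-(1 / 2), by norm_num, by rw [abs_of_nonpos hk]; ring⟩
    have hx : c + EuclideanSpace.single k (s - c k) ∈ box ι := fun m => by
      rcases eq_or_ne m k with rfl | hm
      · simpa using hs
      · simpa [hm] using hc m
    have hle := h _ hx
    rw [inner_add_right, EuclideanSpace.inner_single_right, conj_trivial] at hle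
    linarith
  · simp only [PiLp.inner_apply, RCLike.inner_apply, conj_trivial, mul_comm _ (w _)]
    exact Finset.sum_le_sum fun k _ => (mul_le x hx k).trans_eq (h k).symm

end Box

section Support

variable {E : Type*} [NormedAddCommGroup E] [InnerProductSpace ℝ E]

lemma exists_forall_inner_le_of_notMem_interior [CompleteSpace E] {s : Set E} (hs : Convex ℝ s)
    (hne : (interior s).Nonempty) {p : E} (hp : p ∉ interior s) :
    ∃ w ≠ 0, ∀ x ∈ s, inner ℝ w x ≤ inner ℝ w p := by
  obtain ⟨f, hf, hle⟩ := geometric_hahn_banach_of_nonempty_interior_point hs hp hne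
  refine ⟨(InnerProductSpace.toDual ℝ E).symm f, by simpa using hf, fun x hx => ?_⟩
  simpa only [InnerProductSpace.toDual_symm_apply] using hle x hx

lemma notMem_interior_of_forall_inner_le {s : Set E} {w p : E} (hw : w ≠ 0)
    (h : ∀ x ∈ s, inner ℝ w x ≤ inner ℝ w p) : p ∉ interior s := fun hp => by
  have hmax : IsLocalMax (innerSL ℝ w) p :=
    Filter.mem_of_superset (mem_interior_iff_mem_nhds.1 hp) h
  have hzero := congr($(hmax.hasFDerivAt_eq_zero (innerSL ℝ w).hasFDerivAt) w)
  exact hw (by simpa using hzero)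

end Support

section Shadow

variable {n : ℕ} {u : EuclideanSpace ℝ (Fin n)}

/-- The orthogonal projection onto the hyperplane `uᗮ`. -/
abbrev proj {n : ℕ} (u : EuclideanSpace ℝ (Fin n)) :
    EuclideanSpace ℝ (Fin n) →L[ℝ] hyperplane u :=
  (hyperplane u).orthogonalProjectionOnto

lemma proj_eq_proj_iff {a b : EuclideanSpace ℝ (Fin n)} :
    proj u a = proj u b ↔ ∃ t : ℝ, b = a + t • u := by
  rw [eq_comm, ← sub_eq_zero, ← map_sub, Submodule.orthogonalProjectionOnto_eq_zero_iff,
    Submodule.orthogonal_orthogonal, Submodule.mem_span_singleton]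
  simp only [eq_sub_iff_add_eq', eq_comm]

lemma proj_surjective : Function.Surjective (proj u) := fun v =>
  ⟨v, Submodule.orthogonalProjectionOnto_mem_subspace_eq_self v⟩

lemma interior_shadow_nonempty : (interior (shadow u)).Nonempty :=
  ⟨proj u 0, mem_interior_iff_mem_nhds.2
    (((proj u).isOpenMap proj_surjective).image_mem_nhds box_mem_nhds_zero)⟩

lemma proj_mem_frontier_shadow_iff {c : EuclideanSpace ℝ (Fin n)} (hc : c ∈ cube n) :
    proj u c ∈ frontier (shadow u) ↔
      ∃ w ∈ hyperplane u, w ≠ 0 ∧ ∀ k, w k * c k = |w k| / 2 := by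
  have hsupport (w : hyperplane u) :
      (∀ x ∈ shadow u, inner ℝ w x ≤ inner ℝ w (proj u c)) ↔
        ∀ k, (w : EuclideanSpace ℝ (Fin n)) k * c k =
          |(w : EuclideanSpace ℝ (Fin n)) k| / 2 := by
    rw [← forall_inner_le_box_iff hc]
    simp only [shadow, forall_mem_image, Submodule.inner_orthogonalProjectionOnto_eq_of_mem_left]
    rfl
  have hmem : proj u c ∈ closure (shadow u) := subset_closure ⟨c, hc, rfl⟩
  rw [frontier, Set.mem_sdiff, and_iff_right hmem]
  constructor
  · intro h
    obtain ⟨w, hw, hle⟩ := exists_forall_inner_le_of_notMem_interior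
      (convex_box.linear_image (proj u).toLinearMap) interior_shadow_nonempty h
    exact ⟨w, w.2, by simpa using hw, (hsupport w).1 hle⟩
  · rintro ⟨w, hwu, hw, hmax⟩
    exact notMem_interior_of_forall_inner_le (w := (⟨w, hwu⟩ : hyperplane u)) (by simpa using hw)
      ((hsupport ⟨w, hwu⟩).2 hmax)

end Shadow

section Faces

variable {n : ℕ} {u : EuclideanSpace ℝ (Fin n)}

/-- The `i`-th coordinate of the vertex of the cube extremal in direction `u`, that is, half the
sign of `u i`. The sign of `0` is taken to be `1`, so that each pair of coordinates has exactly
two faces `face u i j` and `face u j i` in every case. -/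
def side {n : ℕ} (u : EuclideanSpace ℝ (Fin n)) (i : Fin n) : ℝ :=
  if 0 ≤ u i then 1 / 2 else -(1 / 2)

/-- The face of codimension two of the cube on which the `i`-th coordinate has the sign of `u i`
and the `j`-th coordinate has the opposite of the sign of `u j`. -/
def face {n : ℕ} (u : EuclideanSpace ℝ (Fin n)) (i j : Fin n) : Set (EuclideanSpace ℝ (Fin n)) :=
  {c | c ∈ cube n ∧ c i = side u i ∧ c j = -side u j}

lemma side_of_nonneg {i : Fin n} (h : 0 ≤ u i) : side u i = 1 / 2 := if_pos h

lemma side_of_neg {i : Fin n} (h : u i < 0) : side u i = -(1 / 2) := if_neg h.not_ge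

lemma abs_side (u : EuclideanSpace ℝ (Fin n)) (i : Fin n) : |side u i| = 1 / 2 := by
  unfold side; split_ifs <;> norm_num [abs_of_pos]

lemma side_mul_self (u : EuclideanSpace ℝ (Fin n)) (i : Fin n) : side u i * side u i = 1 / 4 := by
  rw [← abs_mul_abs_self, abs_side]; norm_num

lemma side_ne_neg_side (u : EuclideanSpace ℝ (Fin n)) (i : Fin n) : side u i ≠ -side u i :=
  fun h => by nlinarith [side_mul_self u i]

lemma two_mul_side_mul_abs (u : EuclideanSpace ℝ (Fin n)) (i : Fin n) :
    2 * side u i * |u i| = u i := by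
  rcases le_or_gt 0 (u i) with h | h
  · rw [side_of_nonneg h, abs_of_nonneg h]; ring
  · rw [side_of_neg h, abs_of_neg h]; ring

lemma side_neg {i : Fin n} (hi : u i ≠ 0) : side (-u) i = -side u i := by
  rcases hi.lt_or_gt with h | h
  · rw [side_of_neg h, side_of_nonneg (by simpa using h.le), neg_neg]
  · rw [side_of_nonneg h.le, side_of_neg (by simpa using h)]

lemma eq_zero_of_abs_side_add_mul_le {i : Fin n} {t : ℝ} (ht : 0 < t)
    (h : |side u i + t * u i| ≤ 1 / 2) : u i = 0 := by
  rcases lt_trichotomy (u i) 0 with hneg | hzero | hpos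
  · rw [side_of_neg hneg] at h
    nlinarith [(abs_le.1 h).1]
  · exact hzero
  · rw [side_of_nonneg hpos.le] at h
    nlinarith [(abs_le.1 h).2]

lemma isCompact_face (u : EuclideanSpace ℝ (Fin n)) (i j : Fin n) : IsCompact (face u i j) := by
  have hface : face u i j = box (Fin n) ∩ ({c | c i = side u i} ∩ {c | c j = -side u j}) := rfl
  rw [hface]
  exact isCompact_box.inter_right ((isClosed_eq (by fun_prop) continuous_const).inter
    (isClosed_eq (by fun_prop) continuous_const))

/-- The line through `c` in direction `u` leaves the cube at the least of the times at which a
coordinate `k` reaches the value `side u k`. -/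
lemma exists_exit (hu : u ≠ 0) {c : EuclideanSpace ℝ (Fin n)} (hc : c ∈ cube n) :
    ∃ t : ℝ, c + t • u ∈ cube n ∧ ∃ j, u j ≠ 0 ∧ (c + t • u) j = side u j := by
  obtain ⟨k₀, hk₀⟩ : ∃ k, u k ≠ 0 := by
    by_contra! h
    exact hu (PiLp.ext h)
  obtain ⟨j, hj, hmin⟩ := ({k | u k ≠ 0} : Finset (Fin n)).exists_min_image
    (fun k => (side u k - c k) / u k) ⟨k₀, by simpa using hk₀⟩
  simp only [Finset.mem_filter_univ] at hj hmin
  refine ⟨(side u j - c j) / u j, fun k => ?_, j, hj, ?_⟩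
  · have hck := abs_le.1 (hc k)
    have hcj := abs_le.1 (hc j)
    have htime : 0 ≤ (side u j - c j) / u j := by
      rcases hj.lt_or_gt with h | h
      · exact div_nonneg_of_nonpos (by rw [side_of_neg h]; linarith) h.le
      · exact div_nonneg (by rw [side_of_nonneg h.le]; linarith) h.le
    simp only [PiLp.add_apply, PiLp.smul_apply, smul_eq_mul]
    rcases lt_trichotomy (u k) 0 with hk | hk | hk
    · have hreach := (le_div_iff_of_neg hk).1 (hmin k hk.ne)
      rw [side_of_neg hk] at hreach
      exact abs_le.2 ⟨by linarith, by nlinarith⟩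
    · simpa [hk] using hc k
    · have hreach := (le_div_iff₀ hk).1 (hmin k hk.ne')
      rw [side_of_nonneg hk.le] at hreach
      exact abs_le.2 ⟨by nlinarith, by linarith⟩
  · simp [div_mul_cancel₀ _ hj]

lemma exists_entry (hu : u ≠ 0) {c : EuclideanSpace ℝ (Fin n)} (hc : c ∈ cube n) :
    ∃ t : ℝ, c + t • u ∈ cube n ∧ ∃ j, u j ≠ 0 ∧ (c + t • u) j = -side u j := by
  obtain ⟨t, ht, j, hj, hside⟩ := exists_exit (neg_ne_zero.2 hu) hc
  have hj' : u j ≠ 0 := by simpa using hj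
  rw [smul_neg, ← neg_smul] at ht hside
  exact ⟨-t, ht, j, hj', hside.trans (side_neg hj')⟩

lemma eq_side_of_mul_pos {i : Fin n} {a b : ℝ} (h : 0 < a * u i) (hab : a * b = |a| / 2) :
    b = side u i := by
  rcases pos_and_pos_or_neg_and_neg_of_mul_pos h with ⟨ha, hi⟩ | ⟨ha, hi⟩
  · rw [side_of_nonneg hi.le]
    rw [abs_of_pos ha] at hab
    exact mul_left_cancel₀ ha.ne' (by linarith)
  · rw [side_of_neg hi]
    rw [abs_of_neg ha] at hab
    exact mul_left_cancel₀ ha.ne (by linarith)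

lemma mem_hyperplane_iff_sum {w : EuclideanSpace ℝ (Fin n)} :
    w ∈ hyperplane u ↔ ∑ k, w k * u k = 0 := by
  rw [Submodule.mem_orthogonal_singleton_iff_inner_right]
  simp only [PiLp.inner_apply, RCLike.inner_apply, conj_trivial]

lemma exists_add_smul_mem_face (hu : u ≠ 0) {c w : EuclideanSpace ℝ (Fin n)} (hc : c ∈ cube n)
    (hw : w ∈ hyperplane u) (hw0 : w ≠ 0) (hmax : ∀ k, w k * c k = |w k| / 2) :
    ∃ i j, i ≠ j ∧ ∃ t : ℝ, c + t • u ∈ face u i j := by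
  by_cases hwu : ∃ k, w k * u k ≠ 0
  · have hsum := mem_hyperplane_iff_sum.1 hw
    obtain ⟨k, hk⟩ := hwu
    obtain ⟨i, -, hi⟩ := Finset.exists_pos_of_sum_zero_of_exists_nonzero _ hsum
      ⟨k, Finset.mem_univ k, hk⟩
    obtain ⟨j, -, hj⟩ := Finset.exists_pos_of_sum_zero_of_exists_nonzero (fun k => -(w k * u k))
      (by rw [Finset.sum_neg_distrib, hsum, neg_zero]) ⟨k, Finset.mem_univ k, neg_ne_zero.2 hk⟩
    refine ⟨i, j, fun hij => ?_, 0, ?_⟩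
    · subst hij; linarith
    · have hcj : -c j = side u j :=
        eq_side_of_mul_pos (a := -w j) (by linarith) (by rw [abs_neg, ← hmax j]; ring)
      rw [zero_smul, add_zero]
      exact ⟨hc, eq_side_of_mul_pos hi (hmax i), by rw [← hcj, neg_neg]⟩
  · push Not at hwu
    obtain ⟨k, hk⟩ : ∃ k, w k ≠ 0 := by
      by_contra! h
      exact hw0 (PiLp.ext h)
    have huk : u k = 0 := (mul_eq_zero.1 (hwu k)).resolve_left hk
    have hside : side u k = 1 / 2 := side_of_nonneg huk.ge
    have hline : ∀ t : ℝ, (c + t • u) k = c k := fun t => by simp [huk]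
    rcases hk.lt_or_gt with hneg | hpos
    · have hck : c k = -side u k := mul_left_cancel₀ hk (by
        rw [hmax k, abs_of_neg hneg, hside]; ring)
      obtain ⟨t, ht, j, hj, htj⟩ := exists_exit hu hc
      exact ⟨j, k, by rintro rfl; exact hj huk, t, ht, htj, (hline t).trans hck⟩
    · have hck : c k = side u k := mul_left_cancel₀ hk (by
        rw [hmax k, abs_of_pos hpos, hside]; ring)
      obtain ⟨t, ht, j, hj, htj⟩ := exists_entry hu hc
      exact ⟨k, j, by rintro rfl; exact hj huk, t, ht, (hline t).trans hck, htj⟩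

lemma exists_normal_of_mem_face {i j : Fin n} (hij : i ≠ j) {c : EuclideanSpace ℝ (Fin n)}
    (hc : c ∈ face u i j) :
    ∃ w ∈ hyperplane u, w ≠ 0 ∧ ∀ k, w k * c k = |w k| / 2 := by
  obtain ⟨-, hi, hj⟩ := hc
  have side_ne : ∀ k, side u k ≠ 0 := fun k h => by simpa [h] using side_mul_self u k
  by_cases hzero : u i = 0 ∧ u j = 0
  · refine ⟨EuclideanSpace.single i 1, mem_hyperplane_iff_sum.2 ?_,
      by simp, fun k => ?_⟩
    · simp [hzero.1]
    · rcases eq_or_ne k i with rfl | hk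
      · simp [hi, side_of_nonneg hzero.1.ge]
      · simp [hk]
  · refine ⟨EuclideanSpace.single i (|u j| * side u i) - EuclideanSpace.single j (|u i| * side u j),
      mem_hyperplane_iff_sum.2 ?_, fun h => hzero ?_, fun k => ?_⟩
    · simp only [PiLp.sub_apply, PiLp.single_apply, sub_mul, ite_mul, zero_mul,
        Finset.sum_sub_distrib, Finset.sum_ite_eq', Finset.mem_univ, if_true]
      linear_combination |u i| * |u j| * 2 * (side_mul_self u i - side_mul_self u j) -
        |u j| * side u i * two_mul_side_mul_abs u i + |u i| * side u j * two_mul_side_mul_abs u j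
    · have hwi := congr($h i)
      have hwj := congr($h j)
      exact ⟨by simpa [hij.symm, side_ne] using hwj, by simpa [hij, side_ne] using hwi⟩
    · rcases eq_or_ne k i with rfl | hki
      · simp only [PiLp.sub_apply, PiLp.single_apply, if_neg hij, if_true, sub_zero, hi, abs_mul,
          abs_abs, abs_side]
        linear_combination |u j| * side_mul_self u k
      · rcases eq_or_ne k j with rfl | hkj
        · simp only [PiLp.sub_apply, PiLp.single_apply, if_neg hki, if_true, zero_sub, hj, abs_neg,
            abs_mul, abs_abs, abs_side]
          linear_combination |u i| * side_mul_self u k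
        · simp [hki, hkj]

lemma frontier_shadow (hu : u ≠ 0) : frontier (shadow u) =
    ⋃ p ∈ (Finset.univ : Finset (Fin n)).offDiag, proj u '' face u p.1 p.2 := by
  have hclosed : IsClosed (shadow u) := (isCompact_box.image (proj u).continuous).isClosed
  ext x
  simp only [mem_iUnion, Finset.mem_offDiag, Finset.mem_univ, true_and, exists_prop, Prod.exists]
  constructor
  · intro hx
    obtain ⟨c, hc, rfl⟩ : x ∈ shadow u := hclosed.frontier_subset hx
    obtain ⟨w, hw, hw0, hmax⟩ := (proj_mem_frontier_shadow_iff hc).1 hx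
    obtain ⟨i, j, hij, t, ht⟩ := exists_add_smul_mem_face hu hc hw hw0 hmax
    exact ⟨i, j, hij, _, ht, (proj_eq_proj_iff.2 ⟨t, rfl⟩).symm⟩
  · rintro ⟨i, j, hij, c, hc, rfl⟩
    exact (proj_mem_frontier_shadow_iff hc.1).2 (exists_normal_of_mem_face hij hc)

lemma eq_of_add_smul_mem_face {i j k l : Fin n} (hzero : ¬(u i = 0 ∧ u j = 0))
    {c : EuclideanSpace ℝ (Fin n)} {t : ℝ} (hc : c ∈ face u i j) (ht : c + t • u ∈ face u k l)
    (hrel : ∀ m, |c m| = 1 / 2 → m = i ∨ m = j) : (i, j) = (k, l) := by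
  obtain ⟨hcube, hi, hj⟩ := hc
  obtain ⟨hcube', hk, hl⟩ := ht
  have coord : ∀ m, (c + t • u) m = c m + t * u m := fun m => by simp
  have hk_mem (hck : c k = side u k) : k = i := by
    refine (hrel k (by rw [hck, abs_side])).resolve_right fun hkj => ?_
    subst hkj
    exact side_ne_neg_side u k (hck.symm.trans hj)
  have hl_mem (hcl : c l = -side u l) : l = j := by
    refine (hrel l (by rw [hcl, abs_neg, abs_side])).resolve_left fun hli => ?_
    subst hli
    exact side_ne_neg_side u l (hi.symm.trans hcl)
  rw [coord] at hk hl
  rcases lt_trichotomy t 0 with ht | rfl | ht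
  · have huk : u k = 0 := eq_zero_of_abs_side_add_mul_le (neg_pos.2 ht) (by
      rw [show side u k + -t * u k = c k by linarith]; exact hcube k)
    have huj : u j = 0 := eq_zero_of_abs_side_add_mul_le (neg_pos.2 ht) (by
      rw [show side u j + -t * u j = -(c + t • u) j by rw [coord, hj]; ring, abs_neg]
      exact hcube' j)
    exact absurd ⟨hk_mem (by simpa [huk] using hk) ▸ huk, huj⟩ hzero
  · rw [hk_mem (by simpa using hk), hl_mem (by simpa using hl)]
  · have hul : u l = 0 := eq_zero_of_abs_side_add_mul_le ht (by
      rw [show side u l + t * u l = -c l by linarith, abs_neg]; exact hcube l)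
    have hui : u i = 0 := eq_zero_of_abs_side_add_mul_le ht (by
      rw [show side u i + t * u i = (c + t • u) i by rw [coord, hi]]; exact hcube' i)
    exact absurd ⟨hui, hl_mem (by simpa [hul] using hl) ▸ hul⟩ hzero

end Faces

section SurfaceArea

variable {n : ℕ} {u : EuclideanSpace ℝ (Fin n)}

/-- The embedding of the space of the coordinates in `s` as a coordinate subspace. -/
def extendByZero {ι : Type*} [DecidableEq ι] (s : Finset ι) :
    EuclideanSpace ℝ s →ₗ[ℝ] EuclideanSpace ℝ ι where
  toFun y := WithLp.toLp 2 fun k => if h : k ∈ s then y ⟨k, h⟩ else 0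
  map_add' x y := by ext k; by_cases h : k ∈ s <;> simp [h]
  map_smul' a y := by ext k; by_cases h : k ∈ s <;> simp [h]

section extendByZero

variable {ι : Type*} [DecidableEq ι] {s : Finset ι}

lemma extendByZero_apply_of_mem (y : EuclideanSpace ℝ s) {k : ι} (hk : k ∈ s) :
    extendByZero s y k = y ⟨k, hk⟩ := dif_pos hk

lemma extendByZero_apply_of_notMem (y : EuclideanSpace ℝ s) {k : ι} (hk : k ∉ s) :
    extendByZero s y k = 0 := dif_neg hk

lemma extendByZero_single (k : s) :
    extendByZero s (EuclideanSpace.single k 1) = EuclideanSpace.single (k : ι) 1 := by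
  ext m
  by_cases hm : m ∈ s
  · simp [extendByZero_apply_of_mem _ hm, Subtype.ext_iff]
  · have hmk : m ≠ k := fun h => hm (h ▸ k.2)
    simp [extendByZero_apply_of_notMem _ hm, hmk]

end extendByZero

lemma coe_proj (hu : ‖u‖ = 1) (x : EuclideanSpace ℝ (Fin n)) :
    (proj u x : EuclideanSpace ℝ (Fin n)) = x - inner ℝ u x • u := by
  rw [← Submodule.starProjection_unit_singleton ℝ hu x, ← Submodule.starProjection_orthogonal_val,
    Submodule.starProjection_apply]

lemma inner_proj_proj (hu : ‖u‖ = 1) (a b : EuclideanSpace ℝ (Fin n)) :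
    inner ℝ (proj u a) (proj u b) = inner ℝ a b - inner ℝ u a * inner ℝ u b := by
  rw [Submodule.inner_orthogonalProjectionOnto_eq_of_mem_left, coe_proj hu, inner_sub_left,
    inner_smul_left, conj_trivial]

lemma sum_sq_eq_one (hu : ‖u‖ = 1) : ∑ k, u k ^ 2 = 1 := by
  rw [← EuclideanSpace.real_norm_sq_eq, hu, one_pow]

/-- The Gram matrix of the projected coordinate vectors is the rank one perturbation `1 - v vᵀ` of
the identity, `v` being the restriction of `u` to `s`, so its determinant is `1 - ‖v‖²`. -/
lemma normDet_proj_comp_extendByZero (hu : ‖u‖ = 1) (s : Finset (Fin n)) :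
    ((proj u).toLinearMap ∘ₗ extendByZero s).normDet = √(∑ k ∈ sᶜ, u k ^ 2) := by
  set f := (proj u).toLinearMap ∘ₗ extendByZero s
  have happly : ∀ k : s, f (EuclideanSpace.single k 1) = proj u (EuclideanSpace.single k.1 1) :=
    fun k => congrArg (proj u) (extendByZero_single k)
  have hgram : Matrix.gram ℝ (fun k => f (EuclideanSpace.basisFun s ℝ k)) =
      1 + Matrix.replicateCol Unit (fun k : s => -u k) *
        Matrix.replicateRow Unit (fun k : s => u k) := by
    ext k l
    simp only [Matrix.gram_apply, EuclideanSpace.basisFun_apply, happly, inner_proj_proj hu,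
      EuclideanSpace.inner_single_right]
    rcases eq_or_ne k l with rfl | hkl
    · simp [Matrix.mul_apply, sub_eq_add_neg]
    · have hlk : l.1 ≠ k.1 := fun h => hkl (Subtype.ext h.symm)
      simp [Matrix.mul_apply, Matrix.one_apply_ne hkl, hlk, mul_comm]
  have hdet : f.normDet ^ 2 = 1 - ∑ k : s, u k ^ 2 := by
    have h := f.normDet_sq_eq_det_gram (EuclideanSpace.basisFun s ℝ)
    rw [hgram, Matrix.det_one_add_replicateCol_mul_replicateRow] at h
    simpa [dotProduct, pow_two, sub_eq_add_neg] using h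
  rw [← Real.sqrt_sq f.normDet_nonneg, hdet, Finset.sum_coe_sort s (fun k => u k ^ 2),
    ← sum_sq_eq_one hu, ← Finset.sum_compl_add_sum s, add_sub_cancel_right]

lemma euclideanHausdorffMeasure_proj_image (hu : ‖u‖ = 1) (s : Finset (Fin n))
    (a : EuclideanSpace ℝ (Fin n)) (t : Set (EuclideanSpace ℝ s)) :
    Measure.euclideanHausdorffMeasure s.card
      (proj u '' ((fun y => a + extendByZero s y) '' t)) =
      ENNReal.ofReal √(∑ k ∈ sᶜ, u k ^ 2) * volume t := by
  have htranslate : proj u '' ((fun y => a + extendByZero s y) '' t) =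
      (fun x => proj u a + x) '' (((proj u).toLinearMap ∘ₗ extendByZero s) '' t) := by
    simp only [image_image, map_add]
    rfl
  have hcard : s.card = Module.finrank ℝ (EuclideanSpace ℝ s) := by
    rw [finrank_euclideanSpace, Fintype.card_coe]
  rw [htranslate, (isometry_add_left _).euclideanHausdorffMeasure_image, hcard,
    LinearMap.euclideanHausdorffMeasure_image_eq_normDet_mul_volume,
    normDet_proj_comp_extendByZero hu]

/-- The parametrization of `face u i j` by the cube in the remaining coordinates. -/
def faceMap (u : EuclideanSpace ℝ (Fin n)) (i j : Fin n)
    (y : EuclideanSpace ℝ ({i, j}ᶜ : Finset (Fin n))) : EuclideanSpace ℝ (Fin n) :=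
  (EuclideanSpace.single i (side u i) - EuclideanSpace.single j (side u j)) +
    extendByZero {i, j}ᶜ y

lemma faceMap_apply_left {i j : Fin n} (hij : i ≠ j) (y) : faceMap u i j y i = side u i := by
  simp [faceMap, extendByZero_apply_of_notMem, hij]

lemma faceMap_apply_right {i j : Fin n} (hij : i ≠ j) (y) : faceMap u i j y j = -side u j := by
  simp [faceMap, extendByZero_apply_of_notMem, hij.symm]

lemma faceMap_apply_of_mem {i j k : Fin n} (y) (hk : k ∈ ({i, j}ᶜ : Finset (Fin n))) :
    faceMap u i j y k = y ⟨k, hk⟩ := by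
  have hne : k ≠ i ∧ k ≠ j := by simpa using hk
  simp [faceMap, extendByZero_apply_of_mem _ hk, hne.1, hne.2]

lemma face_eq_image {i j : Fin n} (hij : i ≠ j) : face u i j = faceMap u i j '' box _ := by
  have eq_or_mem : ∀ k, k = i ∨ k = j ∨ k ∈ ({i, j}ᶜ : Finset (Fin n)) := fun k => by
    simp only [Finset.mem_compl, Finset.mem_insert, Finset.mem_singleton]; tauto
  ext c
  constructor
  · rintro ⟨hc, hi, hj⟩
    refine ⟨WithLp.toLp 2 fun k => c k, fun k => hc k, PiLp.ext fun k => ?_⟩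
    rcases eq_or_mem k with rfl | rfl | hk
    · rw [faceMap_apply_left hij, hi]
    · rw [faceMap_apply_right hij, hj]
    · rw [faceMap_apply_of_mem _ hk]
  · rintro ⟨y, hy, rfl⟩
    refine ⟨fun k => ?_, faceMap_apply_left hij y, faceMap_apply_right hij y⟩
    rcases eq_or_mem k with rfl | rfl | hk
    · rw [faceMap_apply_left hij, abs_side]
    · rw [faceMap_apply_right hij, abs_neg, abs_side]
    · rw [faceMap_apply_of_mem _ hk]
      exact hy _

lemma euclideanHausdorffMeasure_proj_faceMap_image (hu : ‖u‖ = 1) {i j : Fin n} (hij : i ≠ j)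
    (t : Set (EuclideanSpace ℝ ({i, j}ᶜ : Finset (Fin n)))) :
    Measure.euclideanHausdorffMeasure (n - 2) (proj u '' (faceMap u i j '' t)) =
      ENNReal.ofReal √(u i ^ 2 + u j ^ 2) * volume t := by
  have hcard : n - 2 = ({i, j}ᶜ : Finset (Fin n)).card := by
    rw [Finset.card_compl, Finset.card_pair hij, Fintype.card_fin]
  have h := euclideanHausdorffMeasure_proj_image hu {i, j}ᶜ
    (EuclideanSpace.single i (side u i) - EuclideanSpace.single j (side u j)) t
  rwa [compl_compl, Finset.sum_pair hij, ← hcard] at h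

lemma aedisjoint_proj_face (hu : ‖u‖ = 1) {i j k l : Fin n} (hij : i ≠ j)
    (hne : (i, j) ≠ (k, l)) :
    AEDisjoint (Measure.euclideanHausdorffMeasure (n - 2))
      (proj u '' face u i j) (proj u '' face u k l) := by
  by_cases hzero : u i = 0 ∧ u j = 0
  · refine measure_mono_null inter_subset_left ?_
    rw [face_eq_image hij, euclideanHausdorffMeasure_proj_faceMap_image hu hij, hzero.1, hzero.2]
    simp
  · refine measure_mono_null (t := proj u '' (faceMap u i j '' {y | ∃ m, |y m| = 1 / 2})) ?_ ?_
    · rintro _ ⟨⟨c, hc, rfl⟩, c', hc', he⟩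
      obtain ⟨t, rfl⟩ := proj_eq_proj_iff.1 he.symm
      obtain ⟨y, -, rfl⟩ := (face_eq_image hij).subset hc
      refine mem_image_of_mem _ (mem_image_of_mem _ ?_)
      by_contra! hrel
      refine hne (eq_of_add_smul_mem_face hzero hc hc' fun m hm => ?_)
      by_contra hmij
      have hmem : m ∈ ({i, j}ᶜ : Finset (Fin n)) := by simpa using hmij
      exact hrel ⟨⟨m, hmem⟩, by rwa [faceMap_apply_of_mem _ hmem] at hm⟩
    · have hnull : volume {y : EuclideanSpace ℝ ({i, j}ᶜ : Finset (Fin n)) |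
          ∃ m, |y m| = 1 / 2} = 0 := by
        simpa only [ae_iff, not_forall, ne_eq, not_not] using
          ae_forall_abs_ne (ι := ({i, j}ᶜ : Finset (Fin n))) (1 / 2)
      rw [euclideanHausdorffMeasure_proj_faceMap_image hu hij, hnull, mul_zero]

theorem surfaceArea_eq_sum_offDiag (hu : ‖u‖ = 1) : surfaceArea u =
    ENNReal.ofReal (∑ p ∈ (Finset.univ : Finset (Fin n)).offDiag, √(u p.1 ^ 2 + u p.2 ^ 2)) := by
  have hu0 : u ≠ 0 := by rintro rfl; simp at hu
  rw [surfaceArea, frontier_shadow hu0, measure_biUnion_finset₀,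
    ENNReal.ofReal_sum_of_nonneg fun _ _ => Real.sqrt_nonneg _]
  · refine Finset.sum_congr rfl fun p hp => ?_
    have hij := (Finset.mem_offDiag.1 hp).2.2
    rw [face_eq_image hij, euclideanHausdorffMeasure_proj_faceMap_image hu hij, volume_box, mul_one]
  · exact fun p hp q _ hne => aedisjoint_proj_face hu (Finset.mem_offDiag.1 hp).2.2 hne
  · intro p _
    have hcompact := (isCompact_face u p.1 p.2).image (proj u).continuous
    exact hcompact.isClosed.measurableSet.nullMeasurableSet

theorem ar_eq_sum_offDiag (hu : ‖u‖ = 1) : ar u =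
    ∑ p ∈ (Finset.univ : Finset (Fin n)).offDiag, √(u p.1 ^ 2 + u p.2 ^ 2) := by
  rw [ar, surfaceArea_eq_sum_offDiag hu,
    ENNReal.toReal_ofReal (Finset.sum_nonneg fun _ _ => Real.sqrt_nonneg _)]

lemma sum_offDiag_eq_two_mul_sum_Ioi {ι : Type*} [Fintype ι] [LinearOrder ι]
    [LocallyFiniteOrderTop ι] [LocallyFiniteOrderBot ι] {f : ι → ι → ℝ}
    (hf : ∀ i j, f i j = f j i) :
    ∑ p ∈ (Finset.univ : Finset ι).offDiag, f p.1 p.2 = 2 * ∑ i, ∑ j ∈ Finset.Ioi i, f i j := by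
  rw [Finset.sum_finset_product _ Finset.univ (fun i => {i}ᶜ)
    (by simp [Finset.mem_offDiag, eq_comm]), Finset.mul_sum]
  rw [← Finset.sum_sum_Ioi_add_eq_sum_sum_off_diag]
  simp only [Finset.mul_sum, two_mul, hf]

theorem surfaceArea_eq (hu : ‖u‖ = 1) : surfaceArea u =
    ENNReal.ofReal (2 * ∑ i : Fin n, ∑ j ∈ Finset.Ioi i, √(u i ^ 2 + u j ^ 2)) := by
  rw [surfaceArea_eq_sum_offDiag hu, sum_offDiag_eq_two_mul_sum_Ioi
    (f := fun i j => √(u i ^ 2 + u j ^ 2)) fun i j => by rw [add_comm]]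

end SurfaceArea

section Homogeneous

variable {E : Type*} [NormedAddCommGroup E] [NormedSpace ℝ E] [FiniteDimensional ℝ E]
  [MeasurableSpace E] [BorelSpace E] [Nontrivial E] (μ : Measure E) [μ.IsAddHaarMeasure]

lemma integral_volumeIoiPow (n : ℕ) (g : ℝ → ℝ) :
    ∫ r : Ioi (0 : ℝ), g r ∂.volumeIoiPow n = ∫ r in Ioi (0 : ℝ), r ^ n * g r := by
  simp only [Measure.volumeIoiPow, ENNReal.ofReal]
  rw [integral_withDensity_eq_integral_smul (measurable_subtype_coe.pow_const _).real_toNNReal,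
    integral_subtype_comap measurableSet_Ioi fun r => Real.toNNReal (r ^ n) • g r]
  refine setIntegral_congr_fun measurableSet_Ioi fun r hr => ?_
  simp only [NNReal.smul_def, Real.coe_toNNReal _ (pow_nonneg hr.out.le _), smul_eq_mul]

lemma integral_homogeneous_mul_fun_norm {d : ℕ} {f : E → ℝ}
    (hf : ∀ r : ℝ, 0 < r → ∀ x, f (r • x) = r ^ d * f x) (g : ℝ → ℝ) :
    ∫ x, f x * g ‖x‖ ∂μ = (∫ x : Metric.sphere (0 : E) 1, f x ∂μ.toSphere) *
      ∫ r in Ioi (0 : ℝ), r ^ (Module.finrank ℝ E - 1 + d) * g r := by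
  calc ∫ x, f x * g ‖x‖ ∂μ
      = ∫ x : ({0}ᶜ : Set E), f x.1 * g ‖x.1‖ ∂(μ.comap (↑)) := by
        rw [integral_subtype_comap (measurableSet_singleton _).compl fun x => f x * g ‖x‖,
          restrict_compl_singleton]
    _ = ∫ p : Metric.sphere (0 : E) 1 × Ioi (0 : ℝ), f p.1 * (p.2.1 ^ d * g p.2.1)
          ∂(μ.toSphere.prod (.volumeIoiPow (Module.finrank ℝ E - 1))) := by
        rw [← μ.measurePreserving_homeomorphUnitSphereProd.integral_comp
          (Homeomorph.measurableEmbedding _)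
          (fun p : Metric.sphere (0 : E) 1 × Ioi (0 : ℝ) => f p.1 * (p.2.1 ^ d * g p.2.1))]
        refine integral_congr_ae (.of_forall fun x => ?_)
        have hx : 0 < ‖x.1‖ := norm_pos_iff.2 x.2
        simp only [homeomorphUnitSphereProd_apply_fst_coe, homeomorphUnitSphereProd_apply_snd_coe]
        rw [hf _ (inv_pos.2 hx), inv_pow]
        field_simp
    _ = (∫ x : Metric.sphere (0 : E) 1, f x ∂μ.toSphere) *
          ∫ r : Ioi (0 : ℝ), r.1 ^ d * g r ∂.volumeIoiPow (Module.finrank ℝ E - 1) :=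
        integral_prod_mul (fun x : Metric.sphere (0 : E) 1 => f x)
          fun r : Ioi (0 : ℝ) => r.1 ^ d * g r
    _ = _ := by
        rw [integral_volumeIoiPow _ fun r => r ^ d * g r]
        simp only [pow_add, mul_assoc]

lemma integral_Ioi_pow_mul_exp_neg_sq (k : ℕ) :
    ∫ r in Ioi (0 : ℝ), r ^ k * Real.exp (-r ^ 2) = Real.Gamma (((k : ℝ) + 1) / 2) / 2 := by
  have h := integral_rpow_mul_exp_neg_rpow (p := 2) (q := k) two_pos
    (neg_one_lt_zero.trans_le k.cast_nonneg)
  simp only [Real.rpow_natCast, Real.rpow_ofNat] at h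
  rw [h, one_div_mul_eq_div]

lemma integral_homogeneous_mul_exp_neg_norm_sq {d : ℕ} {f : E → ℝ}
    (hf : ∀ r : ℝ, 0 < r → ∀ x, f (r • x) = r ^ d * f x) :
    ∫ x, f x * Real.exp (-‖x‖ ^ 2) ∂μ = (∫ x : Metric.sphere (0 : E) 1, f x ∂μ.toSphere) *
      (Real.Gamma (((Module.finrank ℝ E : ℝ) + d) / 2) / 2) := by
  have hdim : 1 ≤ Module.finrank ℝ E := Module.finrank_pos
  rw [integral_homogeneous_mul_fun_norm μ hf fun r => Real.exp (-r ^ 2),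
    integral_Ioi_pow_mul_exp_neg_sq]
  congr 3
  push_cast [Nat.cast_sub hdim]
  ring

end Homogeneous

section Gaussian

open ProbabilityTheory

/-- The centred Gaussian measure on the line with density `x ↦ π ^ (-1/2) * exp (-x ^ 2)`. The
variance `1 / 2` makes the density of its powers a multiple of `exp (-‖x‖ ^ 2)`. -/
abbrev gauss : Measure ℝ := gaussianReal 0 (1 / 2)

/-- The Gaussian measure on `ι → ℝ` whose coordinates are independent with law `gauss`. -/
abbrev gaussPi (ι : Type*) [Fintype ι] : Measure (ι → ℝ) := Measure.pi fun _ => gauss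

variable {ι : Type*} [Fintype ι]

lemma pi_withDensity_ofReal {μ : Measure ℝ} [SigmaFinite μ] {g : ℝ → ℝ} (hg : Integrable g μ)
    (hg0 : ∀ x, 0 ≤ g x) :
    (Measure.pi fun _ : ι => μ.withDensity fun x => ENNReal.ofReal (g x)) =
      (Measure.pi fun _ => μ).withDensity fun x => ENNReal.ofReal (∏ i, g (x i)) := by
  have : IsFiniteMeasure (μ.withDensity fun x => ENNReal.ofReal (g x)) :=
    isFiniteMeasure_withDensity_ofReal hg.2
  refine Measure.pi_eq fun s hs => ?_
  rw [withDensity_apply _ (MeasurableSet.univ_pi hs), Measure.restrict_pi_pi,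
    ← ofReal_integral_eq_lintegral_ofReal, integral_fintype_prod_eq_prod (f := fun _ => g),
    ENNReal.ofReal_prod_of_nonneg fun i _ => integral_nonneg fun x => hg0 x]
  · refine Finset.prod_congr rfl fun i _ => ?_
    rw [withDensity_apply _ (hs i), ← ofReal_integral_eq_lintegral_ofReal hg.restrict]
    exact .of_forall hg0
  · exact Integrable.fintype_prod_dep fun i => hg.restrict
  · exact .of_forall fun x => Finset.prod_nonneg fun i _ => hg0 _

lemma gauss_eq_withDensity : gauss = (volume : Measure ℝ).withDensity
    fun x => ENNReal.ofReal ((√Real.pi)⁻¹ * Real.exp (-x ^ 2)) := by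
  have hvar : (2 : ℝ) * ((1 / 2 : NNReal) : ℝ) = 1 := by norm_num
  rw [gauss, gaussianReal_of_var_ne_zero _ (by norm_num)]
  congr with x
  rw [gaussianPDF, gaussianPDFReal, mul_right_comm, hvar, one_mul, div_one, sub_zero]

lemma gaussPi_eq_withDensity : gaussPi ι = (volume : Measure (ι → ℝ)).withDensity
    fun x => ENNReal.ofReal ((√Real.pi)⁻¹ ^ Fintype.card ι * Real.exp (-∑ i, x i ^ 2)) := by
  have hint : Integrable fun x : ℝ => (√Real.pi)⁻¹ * Real.exp (-x ^ 2) := by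
    simpa using (integrable_exp_neg_mul_sq one_pos).const_mul (√Real.pi)⁻¹
  rw [gaussPi, gauss_eq_withDensity, pi_withDensity_ofReal hint fun x => by positivity, ← volume_pi]
  simp only [Finset.prod_mul_distrib, ← Real.exp_sum, Finset.prod_const, Finset.card_univ,
    Finset.sum_neg_distrib]

lemma integral_gaussPi (f : (ι → ℝ) → ℝ) : ∫ x, f x ∂gaussPi ι =
    (√Real.pi)⁻¹ ^ Fintype.card ι * ∫ x, f x * Real.exp (-∑ i, x i ^ 2) := by
  rw [gaussPi_eq_withDensity, integral_withDensity_eq_integral_toReal_smul (by fun_prop)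
    (.of_forall fun _ => ENNReal.ofReal_lt_top), ← integral_const_mul]
  refine integral_congr_ae (.of_forall fun x => ?_)
  dsimp only
  rw [ENNReal.toReal_ofReal (by positivity), smul_eq_mul, mul_assoc, mul_comm (f x)]

lemma integral_mul_exp_neg_norm_sq (f : EuclideanSpace ℝ ι → ℝ) :
    ∫ x, f x * Real.exp (-‖x‖ ^ 2) =
      √Real.pi ^ Fintype.card ι * ∫ x, f (WithLp.toLp 2 x) ∂gaussPi ι := by
  rw [integral_gaussPi, ← mul_assoc, ← mul_pow, mul_inv_cancel₀ (by positivity), one_pow, one_mul,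
    ← (EuclideanSpace.volume_preserving_symm_measurableEquiv_toLp ι).integral_comp'
      (g := fun x => f (WithLp.toLp 2 x) * Real.exp (-∑ i, x i ^ 2))]
  simp only [EuclideanSpace.real_norm_sq_eq]
  rfl

lemma map_comp_gaussPi {κ : Type*} [Fintype κ] {e : κ → ι} (he : Function.Injective e) :
    (gaussPi ι).map (fun x i => x (e i)) = gaussPi κ := by
  have hindep : iIndepFun (fun i (x : ι → ℝ) => x i) (gaussPi ι) :=
    iIndepFun_pi (X := fun _ => id) fun _ => aemeasurable_id
  rw [(iIndepFun_iff_map_fun_eq_pi_map fun i =>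
    (measurable_pi_apply _).aemeasurable).1 (hindep.precomp he)]
  exact congrArg Measure.pi (funext fun i => (measurePreserving_eval _ (e i)).map_eq)

lemma integral_comp_gaussPi {κ : Type*} [Fintype κ] {e : κ → ι} (he : Function.Injective e)
    {f : (κ → ℝ) → ℝ} (hf : Continuous f) :
    ∫ x, f (fun i => x (e i)) ∂gaussPi ι = ∫ x, f x ∂gaussPi κ := by
  rw [← map_comp_gaussPi he, integral_map
    (measurable_pi_lambda _ fun i => measurable_pi_apply _).aemeasurable hf.aestronglyMeasurable]

end Gaussian

section SphereMean

variable {n : ℕ}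

lemma sphereMean_congr {f g : EuclideanSpace ℝ (Fin n) → ℝ} (h : ∀ x, ‖x‖ = 1 → f x = g x) :
    sphereMean n f = sphereMean n g :=
  integral_congr_ae (.of_forall fun x => h x (norm_eq_of_mem_sphere x))

lemma sphereMean_eq_inv_mul_integral_toSphere (f : EuclideanSpace ℝ (Fin n) → ℝ) :
    sphereMean n f = ((volume : Measure (EuclideanSpace ℝ (Fin n))).toSphere.real univ)⁻¹ *
      ∫ x : Metric.sphere (0 : EuclideanSpace ℝ (Fin n)) 1, f x
        ∂(volume : Measure (EuclideanSpace ℝ (Fin n))).toSphere := by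
  rw [sphereMean, uniformSphere, integral_smul_measure, ENNReal.toReal_inv, smul_eq_mul,
    measureReal_def]

lemma sphereMean_sum {κ : Type*} (s : Finset κ) {f : κ → EuclideanSpace ℝ (Fin n) → ℝ}
    (hf : ∀ i ∈ s, Continuous (f i)) :
    sphereMean n (fun x => ∑ i ∈ s, f i x) = ∑ i ∈ s, sphereMean n (f i) := by
  simp only [sphereMean_eq_inv_mul_integral_toSphere]
  rw [integral_finsetSum, Finset.mul_sum]
  exact fun i hi => ((hf i hi).comp continuous_subtype_val).integrable_of_hasCompactSupport
    (HasCompactSupport.of_compactSpace _)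

variable [NeZero n]

lemma Gamma_half_add_pos (d : ℕ) : 0 < Real.Gamma (((n : ℝ) + d) / 2) := by
  have hn : (0 : ℝ) < n := Nat.cast_pos.2 (NeZero.pos n)
  exact Real.Gamma_pos_of_pos (by positivity)

lemma integral_toSphere_mul_Gamma {d : ℕ} {f : EuclideanSpace ℝ (Fin n) → ℝ}
    (hf : ∀ r : ℝ, 0 < r → ∀ x, f (r • x) = r ^ d * f x) :
    (∫ x : Metric.sphere (0 : EuclideanSpace ℝ (Fin n)) 1, f x
        ∂(volume : Measure (EuclideanSpace ℝ (Fin n))).toSphere) *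
      (Real.Gamma (((n : ℝ) + d) / 2) / 2) =
      √Real.pi ^ n * ∫ x, f (WithLp.toLp 2 x) ∂gaussPi (Fin n) := by
  have h := integral_homogeneous_mul_exp_neg_norm_sq volume hf
  rwa [finrank_euclideanSpace_fin, integral_mul_exp_neg_norm_sq, Fintype.card_fin, eq_comm] at h

/-- The Gaussian measure is rotation invariant, so that the direction of a Gaussian vector is
uniformly distributed and independent of its norm; the quotient of Gamma values is the reciprocal of
the mean of the `d`-th power of the norm. -/
theorem sphereMean_of_homogeneous {d : ℕ} {f : EuclideanSpace ℝ (Fin n) → ℝ}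
    (hf : ∀ r : ℝ, 0 < r → ∀ x, f (r • x) = r ^ d * f x) :
    sphereMean n f = (∫ x, f (WithLp.toLp 2 x) ∂gaussPi (Fin n)) *
      (Real.Gamma ((n : ℝ) / 2) / Real.Gamma (((n : ℝ) + d) / 2)) := by
  have hf_integral := integral_toSphere_mul_Gamma hf
  have hmass : (volume : Measure (EuclideanSpace ℝ (Fin n))).toSphere.real univ *
      (Real.Gamma ((n : ℝ) / 2) / 2) = √Real.pi ^ n := by
    simpa using integral_toSphere_mul_Gamma (n := n) (d := 0) (f := fun _ => 1) (by simp)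
  have hpi : 0 < √Real.pi ^ n := by positivity
  have hmass_ne : (volume : Measure (EuclideanSpace ℝ (Fin n))).toSphere.real univ ≠ 0 :=
    left_ne_zero_of_mul (hmass.trans_ne hpi.ne')
  have hGamma := Gamma_half_add_pos (n := n) d
  rw [sphereMean_eq_inv_mul_integral_toSphere]
  rw [← hmass] at hf_integral
  field_simp at hf_integral ⊢
  linarith

lemma integral_norm_pow_gaussPi (d : ℕ) :
    ∫ x, ‖WithLp.toLp 2 x‖ ^ d ∂gaussPi (Fin n) =
      Real.Gamma (((n : ℝ) + d) / 2) / Real.Gamma ((n : ℝ) / 2) := by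
  have hGamma := Gamma_half_add_pos (n := n) d
  have hGamma0 : 0 < Real.Gamma ((n : ℝ) / 2) := by simpa using Gamma_half_add_pos (n := n) 0
  have hone : sphereMean n (fun _ => 1) = 1 := by
    rw [sphereMean_of_homogeneous (d := 0) (by simp), Nat.cast_zero, add_zero,
      div_self hGamma0.ne', integral_const, probReal_univ, one_smul, mul_one]
  have h := sphereMean_of_homogeneous (n := n) (d := d) (f := fun x => ‖x‖ ^ d) fun r hr x => by
    rw [norm_smul, Real.norm_of_nonneg hr.le, mul_pow]
  rw [sphereMean_congr (g := fun _ => 1) (fun x hx => by rw [hx, one_pow]), hone] at h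
  field_simp at h ⊢
  exact h.symm

end SphereMean

section Moments

open ProbabilityTheory

section PairMean

variable {ι : Type*} [Fintype ι] {i j k l : ι}

/-- The Gaussian mean of the product of two of the summands of the surface area. -/
def pairMean (i j k l : ι) : ℝ :=
  ∫ x, √(x i ^ 2 + x j ^ 2) * √(x k ^ 2 + x l ^ 2) ∂gaussPi ι

/-- The value of `pairMean` for two pairs with one common index. -/
def sharedPairMean : ℝ := pairMean (0 : Fin 3) 1 0 2

lemma pairMean_swap_left (i j k l : ι) : pairMean i j k l = pairMean j i k l :=
  integral_congr_ae (.of_forall fun x => by dsimp only; rw [add_comm (x i ^ 2)])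

lemma pairMean_swap_right (i j k l : ι) : pairMean i j k l = pairMean i j l k :=
  integral_congr_ae (.of_forall fun x => by dsimp only; rw [add_comm (x k ^ 2)])

lemma integral_sqrt_sq_add_sq_pow_gaussPi (hij : i ≠ j) (d : ℕ) :
    ∫ x, √(x i ^ 2 + x j ^ 2) ^ d ∂gaussPi ι = Real.Gamma ((2 + d) / 2) := by
  have hnorm (x : Fin 2 → ℝ) : √(x 0 ^ 2 + x 1 ^ 2) = ‖WithLp.toLp 2 x‖ := by
    rw [EuclideanSpace.norm_eq, Fin.sum_univ_two]
    simp only [Real.norm_eq_abs, sq_abs]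
  have hinj : Function.Injective ![i, j] := by
    simp [Function.Injective, Fin.forall_fin_succ, hij, hij.symm]
  calc ∫ x, √(x i ^ 2 + x j ^ 2) ^ d ∂gaussPi ι
      = ∫ x, √(x 0 ^ 2 + x 1 ^ 2) ^ d ∂gaussPi (Fin 2) :=
        integral_comp_gaussPi hinj (f := fun x => √(x 0 ^ 2 + x 1 ^ 2) ^ d) (by fun_prop)
    _ = Real.Gamma ((2 + d) / 2) := by
        simp only [hnorm]
        rw [integral_norm_pow_gaussPi, Nat.cast_two, div_self two_ne_zero, Real.Gamma_one, div_one]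

lemma integral_sqrt_sq_add_sq_gaussPi (hij : i ≠ j) :
    ∫ x, √(x i ^ 2 + x j ^ 2) ∂gaussPi ι = √Real.pi / 2 := by
  have hGamma : Real.Gamma (1 / 2 + 1) = √Real.pi / 2 := by
    rw [Real.Gamma_add_one (by norm_num), Real.Gamma_one_half_eq, one_div_mul_eq_div]
  have h := integral_sqrt_sq_add_sq_pow_gaussPi hij 1
  simp only [pow_one, Nat.cast_one] at h
  rw [h, ← hGamma]
  norm_num

lemma pairMean_self (hij : i ≠ j) : pairMean i j i j = 1 := by
  have h := integral_sqrt_sq_add_sq_pow_gaussPi hij 2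
  have hGamma : Real.Gamma ((2 + (2 : ℕ)) / 2) = 1 := by norm_num [Real.Gamma_two]
  simpa only [pairMean, ← sq, hGamma] using h

lemma pairMean_shared (hij : i ≠ j) (hik : i ≠ k) (hjk : j ≠ k) :
    pairMean i j i k = sharedPairMean := by
  have hinj : Function.Injective ![i, j, k] := by
    simp [Function.Injective, Fin.forall_fin_succ, hij, hij.symm, hik, hik.symm, hjk, hjk.symm]
  exact integral_comp_gaussPi hinj
    (f := fun x => √(x 0 ^ 2 + x 1 ^ 2) * √(x 0 ^ 2 + x 2 ^ 2)) (by fun_prop)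

lemma pairMean_disjoint (hij : i ≠ j) (hik : i ≠ k) (hil : i ≠ l) (hjk : j ≠ k) (hjl : j ≠ l)
    (hkl : k ≠ l) : pairMean i j k l = Real.pi / 4 := by
  have hindep : iIndepFun (fun i (x : ι → ℝ) => x i) (gaussPi ι) :=
    iIndepFun_pi (X := fun _ => id) fun _ => aemeasurable_id
  have hindep_pairs :
      IndepFun (fun x => √(x i ^ 2 + x j ^ 2)) (fun x => √(x k ^ 2 + x l ^ 2)) (gaussPi ι) :=
    (hindep.indepFun_prodMk_prodMk measurable_pi_apply i j k l hik hil hjk hjl).comp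
      (φ := fun p : ℝ × ℝ => √(p.1 ^ 2 + p.2 ^ 2)) (ψ := fun p : ℝ × ℝ => √(p.1 ^ 2 + p.2 ^ 2))
      (by fun_prop) (by fun_prop)
  rw [pairMean, hindep_pairs.integral_fun_mul_eq_mul_integral
      (by fun_prop : Continuous fun x : ι → ℝ => √(x i ^ 2 + x j ^ 2)).aestronglyMeasurable
      (by fun_prop : Continuous fun x : ι → ℝ => √(x k ^ 2 + x l ^ 2)).aestronglyMeasurable,
    integral_sqrt_sq_add_sq_gaussPi hij, integral_sqrt_sq_add_sq_gaussPi hkl, div_mul_div_comm,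
    Real.mul_self_sqrt Real.pi_pos.le]
  norm_num

lemma cast_card_offDiag {α : Type*} (s : Finset α) :
    (s.offDiag.card : ℝ) = s.card * (s.card - 1) := by
  classical
  rw [Finset.offDiag_card, Nat.cast_sub (Nat.le_mul_self _), Nat.cast_mul]
  ring

lemma sum_offDiag_eq_of_const_blocks [DecidableEq ι] (s : Finset ι) {f : ι × ι → ℝ} {a b c : ℝ}
    (hin : ∀ k ∈ s, ∀ l ∈ s, k ≠ l → f (k, l) = a)
    (hmixed : ∀ k ∈ s, ∀ l ∉ s, f (k, l) = b) (hmixed' : ∀ k ∉ s, ∀ l ∈ s, f (k, l) = b)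
    (hout : ∀ k ∉ s, ∀ l ∉ s, k ≠ l → f (k, l) = c) :
    ∑ q ∈ (Finset.univ : Finset ι).offDiag, f q =
      s.offDiag.card * a + 2 * (s.card * sᶜ.card) * b + sᶜ.offDiag.card * c := by
  have hdisj : Disjoint s sᶜ := disjoint_compl_right
  have hdisj_offDiag : Disjoint s.offDiag sᶜ.offDiag := by
    simp only [Finset.disjoint_left, Finset.mem_offDiag, Finset.mem_compl]; tauto
  have hdisj_mixed : Disjoint (s.offDiag ∪ sᶜ.offDiag) (s ×ˢ sᶜ) := by
    simp only [Finset.disjoint_left, Finset.mem_union, Finset.mem_offDiag, Finset.mem_product,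
      Finset.mem_compl]
    tauto
  have hdisj_mixed' : Disjoint (s.offDiag ∪ sᶜ.offDiag ∪ s ×ˢ sᶜ) (sᶜ ×ˢ s) := by
    simp only [Finset.disjoint_left, Finset.mem_union, Finset.mem_offDiag, Finset.mem_product,
      Finset.mem_compl]
    tauto
  rw [← Finset.union_compl s, Finset.offDiag_union hdisj, Finset.sum_union hdisj_mixed',
    Finset.sum_union hdisj_mixed, Finset.sum_union hdisj_offDiag,
    Finset.sum_eq_card_nsmul (s := s.offDiag) (b := a),
    Finset.sum_eq_card_nsmul (s := sᶜ.offDiag) (b := c),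
    Finset.sum_eq_card_nsmul (s := s ×ˢ sᶜ) (b := b),
    Finset.sum_eq_card_nsmul (s := sᶜ ×ˢ s) (b := b), Finset.card_product, Finset.card_product]
  · simp only [nsmul_eq_mul, Nat.cast_mul]; ring
  all_goals
    simp +contextual [hin, hmixed, hmixed', hout]

lemma sum_pairMean (hij : i ≠ j) :
    ∑ q ∈ (Finset.univ : Finset ι).offDiag, pairMean i j q.1 q.2 =
      2 + 4 * ((Fintype.card ι : ℝ) - 2) * sharedPairMean +
        ((Fintype.card ι : ℝ) - 2) * ((Fintype.card ι : ℝ) - 3) * (Real.pi / 4) := by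
  classical
  have hcompl : ∀ k, k ∉ ({i, j} : Finset ι) → i ≠ k ∧ j ≠ k := fun k hk => by
    simpa [eq_comm] using hk
  have hmixed : ∀ k ∈ ({i, j} : Finset ι), ∀ l ∉ ({i, j} : Finset ι),
      pairMean i j k l = sharedPairMean := fun k hk l hl => by
    obtain ⟨hil, hjl⟩ := hcompl l hl
    rcases Finset.mem_insert.1 hk with rfl | hk
    · exact pairMean_shared hij hil hjl
    · rw [Finset.mem_singleton.1 hk, pairMean_swap_left]
      exact pairMean_shared hij.symm hjl hil
  rw [sum_offDiag_eq_of_const_blocks {i, j} (f := fun q => pairMean i j q.1 q.2) (a := 1)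
    (b := sharedPairMean) (c := Real.pi / 4) ?_ hmixed
    (fun k hk l hl => (pairMean_swap_right i j k l).trans (hmixed l hl k hk))
    (fun k hk l hl hkl => pairMean_disjoint hij (hcompl k hk).1 (hcompl l hl).1
      (hcompl k hk).2 (hcompl l hl).2 hkl)]
  · have hcard : ((({i, j}ᶜ : Finset ι).card : ℕ) : ℝ) = (Fintype.card ι : ℝ) - 2 := by
      rw [Finset.card_compl, Finset.card_pair hij, Nat.cast_sub, Nat.cast_two]
      exact Finset.card_pair hij ▸ Finset.card_le_univ _
    rw [cast_card_offDiag, cast_card_offDiag, hcard, Finset.card_pair hij]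
    push_cast
    ring
  · simp only [Finset.forall_mem_insert, Finset.mem_singleton, forall_eq]
    exact ⟨⟨fun h => absurd rfl h, fun _ => pairMean_self hij⟩,
      fun _ => (pairMean_swap_right i j j i).trans (pairMean_self hij), fun h => absurd rfl h⟩

end PairMean

lemma sqrt_sq_add_sq_smul {r : ℝ} (hr : 0 < r) (a b : ℝ) :
    √((r * a) ^ 2 + (r * b) ^ 2) = r * √(a ^ 2 + b ^ 2) := by
  rw [mul_pow, mul_pow, ← mul_add, Real.sqrt_mul (by positivity), Real.sqrt_sq hr.le]

variable {n : ℕ}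

lemma sphereMean_sqrt_sq_add_sq [NeZero n] {i j : Fin n} (hij : i ≠ j) :
    sphereMean n (fun x => √(x i ^ 2 + x j ^ 2)) =
      √Real.pi / 2 * (Real.Gamma ((n : ℝ) / 2) / Real.Gamma (((n : ℝ) + 1) / 2)) := by
  rw [sphereMean_of_homogeneous (d := 1) (fun r hr x => by
    simp only [PiLp.smul_apply, smul_eq_mul, sqrt_sq_add_sq_smul hr, pow_one]),
    integral_sqrt_sq_add_sq_gaussPi hij, Nat.cast_one]

lemma sphereMean_mul_eq_pairMean [NeZero n] (i j k l : Fin n) :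
    sphereMean n (fun x => √(x i ^ 2 + x j ^ 2) * √(x k ^ 2 + x l ^ 2)) =
      pairMean i j k l * (2 / n) := by
  have hn : (0 : ℝ) < n := Nat.cast_pos.2 (NeZero.pos n)
  have hGamma : 0 < Real.Gamma ((n : ℝ) / 2) := Real.Gamma_pos_of_pos (by positivity)
  have hshift : ((n : ℝ) + (2 : ℕ)) / 2 = n / 2 + 1 := by push_cast; ring
  rw [sphereMean_of_homogeneous (d := 2) (fun r hr x => by
      simp only [PiLp.smul_apply, smul_eq_mul, sqrt_sq_add_sq_smul hr]; ring),
    hshift, Real.Gamma_add_one (by positivity), div_mul_cancel_right₀ hGamma.ne', inv_div]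
  rfl

theorem zeta_eq_eight_mul_sharedPairMean (hn : 3 ≤ n) : zeta n hn = 8 * sharedPairMean := by
  have : NeZero n := ⟨by omega⟩
  rw [zeta, sphereMean_mul_eq_pairMean, pairMean_shared (by simp) (by simp) (by simp)]
  field_simp
  ring

theorem sphereMean_ar [NeZero n] : sphereMean n ar = √Real.pi * ((n : ℝ) - 1) * n / 2 *
    (Real.Gamma ((n : ℝ) / 2) / Real.Gamma (((n : ℝ) + 1) / 2)) := by
  rw [sphereMean_congr fun x hx => ar_eq_sum_offDiag hx, sphereMean_sum _ fun p _ => by fun_prop,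
    Finset.sum_congr rfl fun p hp => sphereMean_sqrt_sq_add_sq (Finset.mem_offDiag.1 hp).2.2,
    Finset.sum_const, nsmul_eq_mul, cast_card_offDiag, Finset.card_univ, Fintype.card_fin]
  ring

theorem sphereMean_ar_sq (hn : 3 ≤ n) : sphereMean n (fun u => ar u ^ 2) =
    4 * ((n : ℝ) - 1) + ((n : ℝ) - 2) * ((n : ℝ) - 1) * zeta n hn
      + ((n : ℝ) - 3) * ((n : ℝ) - 2) * ((n : ℝ) - 1) / 2 * Real.pi := by
  have : NeZero n := ⟨by omega⟩
  have hexpand : sphereMean n (fun u => ar u ^ 2) =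
      ∑ p ∈ (Finset.univ : Finset (Fin n)).offDiag, ∑ q ∈ (Finset.univ : Finset (Fin n)).offDiag,
        pairMean p.1 p.2 q.1 q.2 * (2 / n) := by
    rw [sphereMean_congr fun x hx => by rw [ar_eq_sum_offDiag hx, sq, Finset.sum_mul_sum],
      sphereMean_sum _ fun p _ => by fun_prop]
    refine Finset.sum_congr rfl fun p _ => ?_
    rw [sphereMean_sum _ fun q _ => by fun_prop]
    exact Finset.sum_congr rfl fun q _ => sphereMean_mul_eq_pairMean _ _ _ _
  simp only [← Finset.sum_mul] at hexpand
  rw [hexpand, Finset.sum_congr rfl fun p hp => sum_pairMean (Finset.mem_offDiag.1 hp).2.2,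
    Finset.sum_const, nsmul_eq_mul, cast_card_offDiag, Finset.card_univ, Fintype.card_fin,
    zeta_eq_eight_mul_sharedPairMean]
  field_simp
  ring

end Moments

section Orthant

variable {ι : Type*} [Fintype ι]

lemma lintegral_eq_two_mul_setLIntegral_Ioi {g : ℝ → ENNReal} (hg : ∀ x, g (-x) = g x) :
    ∫⁻ x, g x = 2 * ∫⁻ x in Ioi (0 : ℝ), g x := by
  have hneg : ∫⁻ x in Iio (0 : ℝ), g x = ∫⁻ x in Ioi (0 : ℝ), g x := by
    rw [← (Measure.measurePreserving_neg (volume : Measure ℝ)).setLIntegral_comp_preimage_emb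
      (MeasurableEquiv.neg ℝ).measurableEmbedding g (Ioi 0)]
    simp only [hg, neg_preimage, neg_Ioi, neg_zero]
  rw [← lintegral_add_compl g (measurableSet_Ioi (a := (0 : ℝ))), compl_Ioi,
    setLIntegral_congr Iio_ae_eq_Iic.symm, hneg, two_mul]

lemma map_abs_gauss : gauss.map (fun x => |x|) = (volume.restrict (Ioi (0 : ℝ))).withDensity
    fun x => ENNReal.ofReal (2 / √Real.pi * Real.exp (-x ^ 2)) := by
  refine Measure.ext_of_lintegral _ fun g hg => ?_
  rw [lintegral_map hg (by fun_prop), gauss_eq_withDensity,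
    lintegral_withDensity_eq_lintegral_mul _ (by fun_prop) (by fun_prop),
    lintegral_eq_two_mul_setLIntegral_Ioi fun x => by simp only [Pi.mul_apply, neg_sq, abs_neg],
    lintegral_withDensity_eq_lintegral_mul _ (by fun_prop) hg,
    ← lintegral_const_mul' _ _ ENNReal.ofNat_ne_top]
  refine setLIntegral_congr_fun measurableSet_Ioi fun x hx => ?_
  simp only [Pi.mul_apply, abs_of_pos hx.out]
  rw [div_eq_mul_inv, mul_assoc (2 : ℝ), ENNReal.ofReal_mul zero_le_two, ENNReal.ofReal_ofNat,
    mul_assoc]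

lemma lintegral_gaussPi_of_even {F : (ι → ℝ) → ENNReal} (hF : Measurable F)
    (heven : ∀ x, F (fun i => |x i|) = F x) :
    ∫⁻ x, F x ∂gaussPi ι = ENNReal.ofReal ((2 / √Real.pi) ^ Fintype.card ι) *
      ∫⁻ x in univ.pi fun _ => Ioi 0, ENNReal.ofReal (Real.exp (-∑ i, x i ^ 2)) * F x := by
  have hint : Integrable (fun x : ℝ => 2 / √Real.pi * Real.exp (-x ^ 2))
      (volume.restrict (Ioi 0)) := by
    simpa using ((integrable_exp_neg_mul_sq one_pos).const_mul (2 / √Real.pi)).restrict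
  have hmap : (gaussPi ι).map (fun x i => |x i|) =
      (volume.restrict (univ.pi fun _ => Ioi 0)).withDensity fun x =>
        ENNReal.ofReal ((2 / √Real.pi) ^ Fintype.card ι * Real.exp (-∑ i, x i ^ 2)) := by
    rw [Measure.pi_map_pi (f := fun _ x => |x|) fun _ => by fun_prop, map_abs_gauss,
      pi_withDensity_ofReal hint fun x => by positivity, volume_pi, Measure.restrict_pi_pi]
    simp only [Finset.prod_mul_distrib, ← Real.exp_sum, Finset.prod_const, Finset.card_univ,
      Finset.sum_neg_distrib]
  rw [← lintegral_congr heven, ← lintegral_map hF (by fun_prop), hmap,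
    lintegral_withDensity_eq_lintegral_mul _ (by fun_prop) hF,
    ← lintegral_const_mul' _ _ ENNReal.ofReal_ne_top]
  refine lintegral_congr fun x => ?_
  rw [Pi.mul_apply, ENNReal.ofReal_mul (by positivity), mul_assoc]

lemma setLIntegral_univ_pi_fin_succ {n : ℕ} (s : Set ℝ) {F : (Fin (n + 1) → ℝ) → ENNReal}
    (hF : Measurable F) : ∫⁻ x in univ.pi fun _ => s, F x =
      ∫⁻ a in s, ∫⁻ x in univ.pi fun _ => s, F (Matrix.vecCons a x) := by
  have hcons := measurePreserving_piFinSuccAbove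
    (fun _ : Fin (n + 1) => volume.restrict s) 0
  simp only [volume_pi, Measure.restrict_pi_pi]
  rw [← (hcons.symm _).lintegral_comp hF, lintegral_prod _ (by fun_prop)]
  simp only [MeasurableEquiv.piFinSuccAbove_symm_apply, Fin.insertNthEquiv_zero]
  rfl

lemma setLIntegral_univ_pi_fin_four (s : Set ℝ) {F : (Fin 4 → ℝ) → ENNReal} (hF : Measurable F) :
    ∫⁻ x in univ.pi fun _ => s, F x =
      ∫⁻ a in s, ∫⁻ b in s, ∫⁻ c in s, ∫⁻ d in s, F ![a, b, c, d] := by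
  have hcons {n : ℕ} (a : ℝ) : Measurable fun x : Fin n → ℝ => Matrix.vecCons a x :=
    (by fun_prop : Continuous _).measurable
  have hFa (a : ℝ) := hF.comp (hcons a)
  have hFb (a b : ℝ) := (hFa a).comp (hcons b)
  refine (setLIntegral_univ_pi_fin_succ s hF).trans (lintegral_congr fun a => ?_)
  refine (setLIntegral_univ_pi_fin_succ s (hFa a)).trans (lintegral_congr fun b => ?_)
  refine (setLIntegral_univ_pi_fin_succ s (hFb a b)).trans (lintegral_congr fun c => ?_)
  refine (setLIntegral_univ_pi_fin_succ s ((hFb a b).comp (hcons c))).trans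
    (lintegral_congr fun d => ?_)
  rw [volume_pi, Measure.restrict_pi_pi, Measure.pi_of_empty _ ![], lintegral_dirac]
  rfl

end Orthant

section SphericalCoordinates

/-- The range of an angle in the first quadrant. -/
abbrev quarter : Set ℝ := Ioo 0 (Real.pi / 2)

lemma cos_pos_of_mem_quarter {θ : ℝ} (h : θ ∈ quarter) : 0 < Real.cos θ :=
  Real.cos_pos_of_mem_Ioo ⟨by linarith [h.1, Real.pi_pos], h.2⟩

lemma sin_pos_of_mem_quarter {θ : ℝ} (h : θ ∈ quarter) : 0 < Real.sin θ :=
  Real.sin_pos_of_mem_Ioo ⟨h.1, by linarith [h.2, Real.pi_pos]⟩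

lemma mem_quarter_iff {θ : ℝ} (h : θ ∈ Ioo (-Real.pi) Real.pi) :
    θ ∈ quarter ↔ 0 < Real.cos θ ∧ 0 < Real.sin θ := by
  refine ⟨fun hθ => ⟨cos_pos_of_mem_quarter hθ, sin_pos_of_mem_quarter hθ⟩, fun ⟨hcos, hsin⟩ => ?_⟩
  constructor
  · contrapose! hsin
    exact Real.sin_nonpos_of_nonpos_of_neg_pi_le hsin h.1.le
  · contrapose! hcos
    exact Real.cos_nonpos_of_pi_div_two_le_of_le hcos (by linarith [h.2, Real.pi_pos])

lemma polarCoord_target_inter_preimage_quadrant :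
    polarCoord.target ∩ polarCoord.symm ⁻¹' (Ioi 0 ×ˢ Ioi 0) = Ioi 0 ×ˢ quarter := by
  ext ⟨r, θ⟩
  simp only [polarCoord_target, mem_inter_iff, mem_prod, mem_preimage, polarCoord_symm_apply,
    mem_Ioi]
  constructor
  · rintro ⟨⟨hr, hθ⟩, hcos, hsin⟩
    exact ⟨hr, (mem_quarter_iff hθ).2
      ⟨pos_of_mul_pos_right hcos hr.le, pos_of_mul_pos_right hsin hr.le⟩⟩
  · rintro ⟨hr, hθ⟩
    have hpi := Real.pi_pos
    exact ⟨⟨hr, by linarith [hθ.1], by linarith [hθ.2]⟩, mul_pos hr (cos_pos_of_mem_quarter hθ),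
      mul_pos hr (sin_pos_of_mem_quarter hθ)⟩

lemma lintegral_quadrant {F : ℝ × ℝ → ENNReal} (hF : Measurable F) :
    ∫⁻ x in Ioi (0 : ℝ), ∫⁻ y in Ioi (0 : ℝ), F (x, y) =
      ∫⁻ θ in quarter, ∫⁻ r in Ioi (0 : ℝ),
        ENNReal.ofReal r * F (r * Real.cos θ, r * Real.sin θ) := by
  have hquadrant : MeasurableSet (Ioi (0 : ℝ) ×ˢ Ioi (0 : ℝ)) :=
    measurableSet_Ioi.prod measurableSet_Ioi
  have hpre : MeasurableSet (polarCoord.symm ⁻¹' (Ioi (0 : ℝ) ×ˢ Ioi (0 : ℝ))) :=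
    continuous_polarCoord_symm.measurable hquadrant
  calc ∫⁻ x in Ioi (0 : ℝ), ∫⁻ y in Ioi (0 : ℝ), F (x, y)
      = ∫⁻ p in Ioi (0 : ℝ) ×ˢ Ioi (0 : ℝ), F p := by
        rw [Measure.volume_eq_prod, setLIntegral_prod _ hF.aemeasurable]
    _ = ∫⁻ p in polarCoord.target ∩ polarCoord.symm ⁻¹' (Ioi 0 ×ˢ Ioi 0),
          ENNReal.ofReal p.1 • F (polarCoord.symm p) := by
        rw [← lintegral_indicator hquadrant, ← lintegral_comp_polarCoord_symm, inter_comm,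
          ← setLIntegral_indicator hpre]
        refine lintegral_congr fun p => ?_
        simp only [indicator, smul_ite, smul_zero, mem_preimage]
    _ = ∫⁻ θ in quarter, ∫⁻ r in Ioi (0 : ℝ),
          ENNReal.ofReal r * F (r * Real.cos θ, r * Real.sin θ) := by
        rw [polarCoord_target_inter_preimage_quadrant, Measure.volume_eq_prod,
          setLIntegral_prod_symm]
        · rfl
        · exact ((by fun_prop : Measurable fun p : ℝ × ℝ => ENNReal.ofReal p.1).mul
            (hF.comp continuous_polarCoord_symm.measurable)).aemeasurable

lemma lintegral_quadrant_swap {F : ℝ × ℝ → ENNReal} (hF : Measurable F) :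
    ∫⁻ x in Ioi (0 : ℝ), ∫⁻ y in Ioi (0 : ℝ), F (x, y) =
      ∫⁻ θ in quarter, ∫⁻ r in Ioi (0 : ℝ),
        ENNReal.ofReal r * F (r * Real.sin θ, r * Real.cos θ) := by
  rw [lintegral_lintegral_swap (f := fun x y => F (x, y)) hF.aemeasurable]
  exact lintegral_quadrant (hF.comp measurable_swap)

lemma lintegral_octant {F : ℝ × ℝ × ℝ → ENNReal} (hF : Measurable F) :
    ∫⁻ x in Ioi (0 : ℝ), ∫⁻ y in Ioi (0 : ℝ), ∫⁻ z in Ioi (0 : ℝ), F (x, y, z) =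
      ∫⁻ θ in quarter, ∫⁻ φ in quarter, ∫⁻ r in Ioi (0 : ℝ),
        ENNReal.ofReal r * (ENNReal.ofReal (r * Real.sin φ) *
          F (r * Real.sin φ * Real.cos θ, r * Real.sin φ * Real.sin θ, r * Real.cos φ)) := by
  rw [lintegral_quadrant (F := fun p => ∫⁻ z in Ioi (0 : ℝ), F (p.1, p.2, z))
    (Measurable.lintegral_prod_right (by fun_prop))]
  simp only [← lintegral_const_mul' _ _ ENNReal.ofReal_ne_top]
  refine lintegral_congr fun θ => lintegral_quadrant_swap (F := fun p =>
    ENNReal.ofReal p.1 * F (p.1 * Real.cos θ, p.1 * Real.sin θ, p.2)) (by fun_prop)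

/-- The point of the unit sphere of `ℝ⁴` with the given spherical coordinates. -/
def sphericalPoint (θ φ ψ : ℝ) : Fin 4 → ℝ :=
  ![Real.sin ψ * Real.sin φ * Real.cos θ, Real.sin ψ * Real.sin φ * Real.sin θ,
    Real.sin ψ * Real.cos φ, Real.cos ψ]

lemma sum_sphericalPoint_sq (θ φ ψ : ℝ) : ∑ i, sphericalPoint θ φ ψ i ^ 2 = 1 := by
  simp only [sphericalPoint, Fin.sum_univ_four, Matrix.cons_val]
  linear_combination (Real.sin ψ * Real.sin φ) ^ 2 * Real.sin_sq_add_cos_sq θ +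
    Real.sin ψ ^ 2 * Real.sin_sq_add_cos_sq φ + Real.sin_sq_add_cos_sq ψ

lemma setLIntegral_orthant {F : (Fin 4 → ℝ) → ENNReal} (hF : Measurable F) :
    ∫⁻ x in univ.pi fun _ => Ioi 0, F x =
      ∫⁻ θ in quarter, ∫⁻ φ in quarter, ∫⁻ ψ in quarter, ∫⁻ r in Ioi (0 : ℝ),
        ENNReal.ofReal (r ^ 3 * (Real.sin φ * Real.sin ψ ^ 2)) *
          F (r • sphericalPoint θ φ ψ) := by
  have hF' : Measurable fun p : ℝ × ℝ × ℝ × ℝ => F ![p.1, p.2.1, p.2.2.1, p.2.2.2] :=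
    hF.comp (by fun_prop : Continuous fun p : ℝ × ℝ × ℝ × ℝ =>
      ![p.1, p.2.1, p.2.2.1, p.2.2.2]).measurable
  rw [setLIntegral_univ_pi_fin_four _ hF, lintegral_octant
    (F := fun p => ∫⁻ w in Ioi (0 : ℝ), F ![p.1, p.2.1, p.2.2, w])
    (Measurable.lintegral_prod_right (hF'.comp (by fun_prop : Measurable
      fun q : (ℝ × ℝ × ℝ) × ℝ => (q.1.1, q.1.2.1, q.1.2.2, q.2))))]
  simp only [← lintegral_const_mul' _ _ ENNReal.ofReal_ne_top]
  refine lintegral_congr fun θ => lintegral_congr fun φ => ?_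
  refine (lintegral_quadrant_swap (F := fun p => ENNReal.ofReal p.1 *
    (ENNReal.ofReal (p.1 * Real.sin φ) * F ![p.1 * Real.sin φ * Real.cos θ,
      p.1 * Real.sin φ * Real.sin θ, p.1 * Real.cos φ, p.2])) ?_).trans ?_
  · exact (by fun_prop : Measurable fun p : ℝ × ℝ => ENNReal.ofReal p.1).mul ((by fun_prop :
      Measurable fun p : ℝ × ℝ => ENNReal.ofReal (p.1 * Real.sin φ)).mul (hF'.comp (by fun_prop :
        Measurable fun p : ℝ × ℝ => (p.1 * Real.sin φ * Real.cos θ, p.1 * Real.sin φ * Real.sin θ,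
          p.1 * Real.cos φ, p.2))))
  refine setLIntegral_congr_fun measurableSet_Ioo fun ψ hψ =>
    setLIntegral_congr_fun measurableSet_Ioi fun r hr => ?_
  have hsin_ψ := sin_pos_of_mem_quarter hψ
  have hr' := hr.out
  have hpoint : ![r * Real.sin ψ * Real.sin φ * Real.cos θ,
      r * Real.sin ψ * Real.sin φ * Real.sin θ, r * Real.sin ψ * Real.cos φ, r * Real.cos ψ] =
      r • sphericalPoint θ φ ψ := by
    simp only [sphericalPoint, Matrix.smul_cons, Matrix.smul_empty, smul_eq_mul, mul_assoc]
  simp only [← mul_assoc]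
  rw [hpoint, ← ENNReal.ofReal_mul hr'.le, ← ENNReal.ofReal_mul (by positivity)]
  congr 2
  ring

end SphericalCoordinates

section GaussianSphericalCoordinates

lemma lintegral_Ioi_pow_mul_exp_neg_sq (k : ℕ) :
    ∫⁻ r in Ioi (0 : ℝ), ENNReal.ofReal (r ^ k * Real.exp (-r ^ 2)) =
      ENNReal.ofReal (Real.Gamma (((k : ℝ) + 1) / 2) / 2) := by
  have hint := integrableOn_rpow_mul_exp_neg_rpow (p := 2) (s := k)
    (neg_one_lt_zero.trans_le k.cast_nonneg) two_pos
  simp only [Real.rpow_natCast, Real.rpow_ofNat] at hint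
  rw [← integral_Ioi_pow_mul_exp_neg_sq, ofReal_integral_eq_lintegral_ofReal hint]
  filter_upwards [ae_restrict_mem measurableSet_Ioi] with r hr
  exact mul_nonneg (pow_nonneg hr.out.le k) (Real.exp_pos _).le

variable {d : ℕ} {f : (Fin 4 → ℝ) → ℝ}

lemma setLIntegral_orthant_exp_mul (hf : Continuous f)
    (hhom : ∀ r : ℝ, 0 < r → ∀ x, f (r • x) = r ^ d * f x) :
    ∫⁻ x in univ.pi fun _ => Ioi 0,
        ENNReal.ofReal (Real.exp (-∑ i, x i ^ 2)) * ENNReal.ofReal (f x) =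
      ENNReal.ofReal (Real.Gamma ((4 + d) / 2) / 2) *
        ∫⁻ θ in quarter, ∫⁻ φ in quarter, ∫⁻ ψ in quarter, ENNReal.ofReal
          (Real.sin φ * Real.sin ψ ^ 2 * f (sphericalPoint θ φ ψ)) := by
  rw [setLIntegral_orthant (by fun_prop)]
  simp only [← lintegral_const_mul' _ _ ENNReal.ofReal_ne_top]
  refine lintegral_congr fun θ => setLIntegral_congr_fun measurableSet_Ioo fun φ hφ =>
    setLIntegral_congr_fun measurableSet_Ioo fun ψ hψ => ?_
  have hsin_φ := sin_pos_of_mem_quarter hφ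
  have hsin_ψ := sin_pos_of_mem_quarter hψ
  have hGamma : ((4 : ℝ) + d) / 2 = (((3 + d : ℕ) : ℝ) + 1) / 2 := by push_cast; ring
  rw [hGamma, ← lintegral_Ioi_pow_mul_exp_neg_sq,
    ← lintegral_mul_const' _ _ ENNReal.ofReal_ne_top]
  refine setLIntegral_congr_fun measurableSet_Ioi fun r hr => ?_
  have hr' := hr.out
  have hnorm : ∑ i, (r • sphericalPoint θ φ ψ) i ^ 2 = r ^ 2 := by
    simp only [Pi.smul_apply, smul_eq_mul, mul_pow, ← Finset.mul_sum, sum_sphericalPoint_sq,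
      mul_one]
  rw [hnorm, hhom r hr', ← ENNReal.ofReal_mul (Real.exp_pos _).le,
    ← ENNReal.ofReal_mul (by positivity), ← ENNReal.ofReal_mul (by positivity)]
  congr 1
  ring

lemma continuous_integral_quarter {X : Type*} [TopologicalSpace X] {g : X → ℝ → ℝ}
    (hg : Continuous fun p : X × ℝ => g p.1 p.2) :
    Continuous fun a => ∫ x in (0 : ℝ)..Real.pi / 2, g a x :=
  intervalIntegral.continuous_parametric_intervalIntegral_of_continuous' hg _ _

lemma integral_quarter_nonneg {g : ℝ → ℝ} (hg0 : ∀ x ∈ quarter, 0 ≤ g x) :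
    0 ≤ ∫ x in (0 : ℝ)..Real.pi / 2, g x := by
  rw [intervalIntegral.integral_of_le (by positivity), integral_Ioc_eq_integral_Ioo]
  exact setIntegral_nonneg measurableSet_Ioo hg0

lemma ofReal_integral_quarter {g : ℝ → ℝ} (hg : Continuous g) (hg0 : ∀ x ∈ quarter, 0 ≤ g x) :
    ENNReal.ofReal (∫ x in (0 : ℝ)..Real.pi / 2, g x) = ∫⁻ x in quarter, ENNReal.ofReal (g x) := by
  rw [intervalIntegral.integral_of_le (by positivity), integral_Ioc_eq_integral_Ioo,
    ofReal_integral_eq_lintegral_ofReal (hg.integrableOn_Icc.mono_set Ioo_subset_Icc_self)]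
  filter_upwards [ae_restrict_mem measurableSet_Ioo] with x hx using hg0 x hx

lemma ofReal_integral_quarter_two {g : ℝ → ℝ → ℝ} (hg : Continuous fun p : ℝ × ℝ => g p.1 p.2)
    (hg0 : ∀ x ∈ quarter, ∀ y ∈ quarter, 0 ≤ g x y) :
    ENNReal.ofReal (∫ x in (0 : ℝ)..Real.pi / 2, ∫ y in (0 : ℝ)..Real.pi / 2, g x y) =
      ∫⁻ x in quarter, ∫⁻ y in quarter, ENNReal.ofReal (g x y) := by
  rw [ofReal_integral_quarter (continuous_integral_quarter hg) fun x hx =>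
    integral_quarter_nonneg (hg0 x hx)]
  exact setLIntegral_congr_fun measurableSet_Ioo fun x hx => ofReal_integral_quarter
    (hg.comp (by fun_prop : Continuous fun y : ℝ => (x, y))) (hg0 x hx)

lemma ofReal_integral_quarter_three {g : ℝ → ℝ → ℝ → ℝ}
    (hg : Continuous fun p : (ℝ × ℝ) × ℝ => g p.1.1 p.1.2 p.2)
    (hg0 : ∀ x ∈ quarter, ∀ y ∈ quarter, ∀ z ∈ quarter, 0 ≤ g x y z) :
    ENNReal.ofReal (∫ x in (0 : ℝ)..Real.pi / 2, ∫ y in (0 : ℝ)..Real.pi / 2,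
      ∫ z in (0 : ℝ)..Real.pi / 2, g x y z) =
      ∫⁻ x in quarter, ∫⁻ y in quarter, ∫⁻ z in quarter, ENNReal.ofReal (g x y z) := by
  have hcont := continuous_integral_quarter (g := fun (p : ℝ × ℝ) z => g p.1 p.2 z) hg
  rw [ofReal_integral_quarter (continuous_integral_quarter hcont) fun x hx =>
    integral_quarter_nonneg fun y hy => integral_quarter_nonneg (hg0 x hx y hy)]
  exact setLIntegral_congr_fun measurableSet_Ioo fun x hx => ofReal_integral_quarter_two
    (hg.comp (by fun_prop : Continuous fun p : ℝ × ℝ => ((x, p.1), p.2))) (hg0 x hx)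

theorem integral_gaussPi_four_of_homogeneous (hf : Continuous f) (hf0 : ∀ x, 0 ≤ f x)
    (heven : ∀ x, f (fun i => |x i|) = f x)
    (hhom : ∀ r : ℝ, 0 < r → ∀ x, f (r • x) = r ^ d * f x) :
    ∫ x, f x ∂gaussPi (Fin 4) = 8 * Real.Gamma ((4 + d) / 2) / Real.pi ^ 2 *
      ∫ θ in (0 : ℝ)..Real.pi / 2, ∫ φ in (0 : ℝ)..Real.pi / 2, ∫ ψ in (0 : ℝ)..Real.pi / 2,
        Real.sin φ * Real.sin ψ ^ 2 * f (sphericalPoint θ φ ψ) := by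
  have hpoint : Continuous fun p : (ℝ × ℝ) × ℝ => sphericalPoint p.1.1 p.1.2 p.2 := by
    unfold sphericalPoint
    fun_prop
  have hnonneg : ∀ θ ∈ quarter, ∀ φ ∈ quarter, ∀ ψ ∈ quarter,
      0 ≤ Real.sin φ * Real.sin ψ ^ 2 * f (sphericalPoint θ φ ψ) := fun θ _ φ hφ ψ _ =>
    mul_nonneg (mul_nonneg (sin_pos_of_mem_quarter hφ).le (sq_nonneg _)) (hf0 _)
  rw [integral_eq_lintegral_of_nonneg_ae (.of_forall hf0) hf.aestronglyMeasurable,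
    lintegral_gaussPi_of_even (by fun_prop) fun x => by rw [heven],
    setLIntegral_orthant_exp_mul hf hhom, ← ofReal_integral_quarter_three (by fun_prop) hnonneg,
    ENNReal.toReal_mul, ENNReal.toReal_mul, ENNReal.toReal_ofReal (by positivity),
    ENNReal.toReal_ofReal (by positivity), ENNReal.toReal_ofReal (integral_quarter_nonneg
      fun θ hθ => integral_quarter_nonneg fun φ hφ => integral_quarter_nonneg (hnonneg θ hθ φ hφ)),
    Fintype.card_fin, ← mul_assoc, div_pow, show √Real.pi ^ 4 = (√Real.pi ^ 2) ^ 2 by ring,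
    Real.sq_sqrt Real.pi_pos.le]
  ring

theorem pairMean_eq_integral (i j k l : Fin 4) :
    pairMean i j k l = 16 / Real.pi ^ 2 *
      ∫ θ in (0 : ℝ)..Real.pi / 2, ∫ φ in (0 : ℝ)..Real.pi / 2, ∫ ψ in (0 : ℝ)..Real.pi / 2,
        Real.sin φ * Real.sin ψ ^ 2 *
          (√(sphericalPoint θ φ ψ i ^ 2 + sphericalPoint θ φ ψ j ^ 2) *
            √(sphericalPoint θ φ ψ k ^ 2 + sphericalPoint θ φ ψ l ^ 2)) := by
  have hGamma : 8 * Real.Gamma ((4 + (2 : ℕ)) / 2) = 16 := by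
    rw [show ((4 : ℝ) + (2 : ℕ)) / 2 = (2 : ℕ) + 1 by norm_num, Real.Gamma_nat_eq_factorial]
    norm_num
  rw [pairMean, integral_gaussPi_four_of_homogeneous (d := 2) (by fun_prop)
    (fun x => by positivity) (fun x => by simp only [sq_abs]) ?_, hGamma]
  intro r hr x
  simp only [Pi.smul_apply, smul_eq_mul, sqrt_sq_add_sq_smul hr]
  ring

end GaussianSphericalCoordinates

section TripleIntegrals

lemma integral_quarter_congr {f g : ℝ → ℝ} (h : ∀ x ∈ quarter, f x = g x) :
    ∫ x in (0 : ℝ)..Real.pi / 2, f x = ∫ x in (0 : ℝ)..Real.pi / 2, g x := by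
  simp only [intervalIntegral.integral_of_le Real.pi_div_two_pos.le, integral_Ioc_eq_integral_Ioo]
  exact setIntegral_congr_fun measurableSet_Ioo h

lemma sphericalPoint_zero_sq_add_one_sq (θ φ ψ : ℝ) :
    sphericalPoint θ φ ψ 0 ^ 2 + sphericalPoint θ φ ψ 1 ^ 2 = (Real.sin ψ * Real.sin φ) ^ 2 := by
  simp only [sphericalPoint, Matrix.cons_val]
  linear_combination (Real.sin ψ * Real.sin φ) ^ 2 * Real.sin_sq_add_cos_sq θ

lemma tripleIntegral_eq_pairMean (k l : Fin 4) :
    (∫ θ in (0 : ℝ)..Real.pi / 2, ∫ φ in (0 : ℝ)..Real.pi / 2, ∫ ψ in (0 : ℝ)..Real.pi / 2,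
      Real.sin φ * Real.sin ψ * √(sphericalPoint θ φ ψ k ^ 2 + sphericalPoint θ φ ψ l ^ 2)
        * (1 / (2 * Real.pi ^ 2)) * Real.sin φ * Real.sin ψ ^ 2) = pairMean 0 1 k l / 32 := by
  calc _ = ∫ θ in (0 : ℝ)..Real.pi / 2, ∫ φ in (0 : ℝ)..Real.pi / 2, ∫ ψ in (0 : ℝ)..Real.pi / 2,
        1 / (2 * Real.pi ^ 2) * (Real.sin φ * Real.sin ψ ^ 2 *
          (√(sphericalPoint θ φ ψ 0 ^ 2 + sphericalPoint θ φ ψ 1 ^ 2) *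
            √(sphericalPoint θ φ ψ k ^ 2 + sphericalPoint θ φ ψ l ^ 2))) := by
        refine integral_quarter_congr fun θ _ => integral_quarter_congr fun φ hφ =>
          integral_quarter_congr fun ψ hψ => ?_
        have hsin : 0 < Real.sin ψ * Real.sin φ :=
          mul_pos (sin_pos_of_mem_quarter hψ) (sin_pos_of_mem_quarter hφ)
        rw [sphericalPoint_zero_sq_add_one_sq, Real.sqrt_sq hsin.le]
        ring
    _ = pairMean 0 1 k l / 32 := by
        simp only [intervalIntegral.integral_const_mul]
        rw [pairMean_eq_integral]
        ring

theorem tripleIntegral_disjoint :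
    (∫ _θ in (0 : ℝ)..Real.pi / 2, ∫ φ in (0 : ℝ)..Real.pi / 2, ∫ ψ in (0 : ℝ)..Real.pi / 2,
      Real.sin φ * Real.sin ψ * √(Real.cos φ ^ 2 * Real.sin ψ ^ 2 + Real.cos ψ ^ 2)
        * (1 / (2 * Real.pi ^ 2)) * Real.sin φ * Real.sin ψ ^ 2) = Real.pi / 128 := by
  have h := tripleIntegral_eq_pairMean 2 3
  simp only [sphericalPoint, Matrix.cons_val, mul_pow, mul_comm (Real.sin _ ^ 2) (Real.cos _ ^ 2)]
    at h
  rw [h, pairMean_disjoint (by decide) (by decide) (by decide) (by decide) (by decide) (by decide)]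
  ring

theorem tripleIntegral_shared :
    (∫ θ in (0 : ℝ)..Real.pi / 2, ∫ φ in (0 : ℝ)..Real.pi / 2, ∫ ψ in (0 : ℝ)..Real.pi / 2,
      Real.sin φ * Real.sin ψ
        * √(Real.sin θ ^ 2 * Real.sin φ ^ 2 * Real.sin ψ ^ 2 + Real.cos ψ ^ 2)
        * (1 / (2 * Real.pi ^ 2)) * Real.sin φ * Real.sin ψ ^ 2) = sharedPairMean / 32 := by
  have hcoord (θ φ ψ : ℝ) : Real.sin θ ^ 2 * Real.sin φ ^ 2 * Real.sin ψ ^ 2 + Real.cos ψ ^ 2 =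
      sphericalPoint θ φ ψ 1 ^ 2 + sphericalPoint θ φ ψ 3 ^ 2 := by
    simp only [sphericalPoint, Matrix.cons_val]
    ring
  simp only [hcoord]
  rw [tripleIntegral_eq_pairMean, pairMean_swap_left,
    pairMean_shared (by decide) (by decide) (by decide)]

/-- The double integral in terms of which `ζ₄` is compared with the Gaussian mean. -/
def angleIntegral : ℝ :=
  ∫ θ in (0 : ℝ)..Real.pi / 2, ∫ φ in (0 : ℝ)..Real.pi / 2,
    Real.sin φ ^ 2 * √(1 - Real.sin φ ^ 2 * Real.sin θ ^ 2)

lemma integral_sin_pow_four : ∫ ψ in (0 : ℝ)..Real.pi / 2, Real.sin ψ ^ 4 = 3 * Real.pi / 16 := by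
  rw [integral_sin_pow, integral_sin_sq, Real.cos_pi_div_two, Real.sin_zero]
  ring

theorem sharedPairMean_eq : sharedPairMean = 3 / Real.pi * angleIntegral := by
  have hcoord {θ φ ψ : ℝ} (hψ : ψ ∈ quarter) :
      √(sphericalPoint θ φ ψ 0 ^ 2 + sphericalPoint θ φ ψ 2 ^ 2) =
        Real.sin ψ * √(1 - Real.sin φ ^ 2 * Real.sin θ ^ 2) := by
    have hsq : sphericalPoint θ φ ψ 0 ^ 2 + sphericalPoint θ φ ψ 2 ^ 2 =
        Real.sin ψ ^ 2 * (1 - Real.sin φ ^ 2 * Real.sin θ ^ 2) := by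
      simp only [sphericalPoint, Matrix.cons_val]
      linear_combination Real.sin ψ ^ 2 * Real.sin_sq_add_cos_sq φ +
        Real.sin ψ ^ 2 * Real.sin φ ^ 2 * Real.sin_sq_add_cos_sq θ
    rw [hsq, Real.sqrt_mul (sq_nonneg _), Real.sqrt_sq (sin_pos_of_mem_quarter hψ).le]
  have hmean : sharedPairMean / 32 =
      1 / (2 * Real.pi ^ 2) * (3 * Real.pi / 16 * angleIntegral) := by
    rw [← pairMean_shared (i := (0 : Fin 4)) (j := 1) (k := 2) (by decide) (by decide) (by decide),
      ← tripleIntegral_eq_pairMean, ← integral_sin_pow_four, angleIntegral]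
    simp only [← intervalIntegral.integral_const_mul, ← intervalIntegral.integral_mul_const]
    refine integral_quarter_congr fun θ _ => integral_quarter_congr fun φ _ =>
      integral_quarter_congr fun ψ hψ => ?_
    rw [hcoord hψ]
    ring
  field_simp at hmean ⊢
  linear_combination hmean / 32

end TripleIntegrals

section EllipticIntegrals

lemma one_sub_mul_sin_sq_pos {m : ℝ} (hm : m < 1) (θ : ℝ) : 0 < 1 - m * Real.sin θ ^ 2 := by
  rcases le_or_gt m 0 with hm0 | hm0
  · linarith [mul_nonpos_of_nonpos_of_nonneg hm0 (sq_nonneg (Real.sin θ))]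
  · linarith [mul_le_of_le_one_right hm0.le (Real.sin_sq_le_one θ)]

lemma sqrt_one_sub_mul_sin_sq_pos {m : ℝ} (hm : m < 1) (θ : ℝ) : 0 < √(1 - m * Real.sin θ ^ 2) :=
  Real.sqrt_pos.2 (one_sub_mul_sin_sq_pos hm θ)

lemma ellipticK_nonneg (m : ℝ) : 0 ≤ ellipticK m :=
  integral_quarter_nonneg fun _ _ => by positivity

lemma continuous_ellipticK_comp {X : Type*} [TopologicalSpace X] {g : X → ℝ} (hg : Continuous g)
    (hg1 : ∀ x, g x < 1) : Continuous fun x => ellipticK (g x) :=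
  continuous_integral_quarter (g := fun x θ => 1 / √(1 - g x * Real.sin θ ^ 2)) <|
    continuous_const.div (by fun_prop) fun p => (sqrt_one_sub_mul_sin_sq_pos (hg1 p.1) p.2).ne'

lemma ofReal_ellipticK {m : ℝ} (hm : m < 1) : ENNReal.ofReal (ellipticK m) =
    ∫⁻ θ in quarter, ENNReal.ofReal (1 / √(1 - m * Real.sin θ ^ 2)) :=
  ofReal_integral_quarter (continuous_const.div (by fun_prop) fun θ =>
    (sqrt_one_sub_mul_sin_sq_pos hm θ).ne') fun _ _ => by positivity

end EllipticIntegrals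

section Substitutions

lemma setLIntegral_eq_of_bijOn {f f' : ℝ → ℝ} {s t : Set ℝ} (hs : MeasurableSet s)
    (hf' : ∀ x ∈ s, HasDerivAt f (f' x) x) (hbij : BijOn f s t) (g : ℝ → ENNReal) :
    ∫⁻ y in t, g y = ∫⁻ x in s, ENNReal.ofReal |f' x| * g (f x) := by
  rw [← hbij.image_eq]
  exact lintegral_image_eq_lintegral_abs_deriv_mul hs (fun x hx => (hf' x hx).hasDerivWithinAt)
    hbij.injOn g

lemma bijOn_arctan : BijOn Real.arctan (Ioi 0) quarter :=
  InvOn.bijOn (f' := Real.tan) ⟨fun x _ => Real.tan_arctan x, fun x hx =>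
    Real.arctan_tan (by linarith [hx.1, Real.pi_pos]) hx.2⟩
    (fun x hx => ⟨Real.arctan_pos.2 hx, Real.arctan_lt_pi_div_two x⟩)
    (fun _ hx => Real.tan_pos_of_pos_of_lt_pi_div_two hx.1 hx.2)

lemma bijOn_mul_left {k : ℝ} (hk : 0 < k) : BijOn (fun x => k * x) (Ioi 0) (Ioi 0) :=
  InvOn.bijOn (f' := fun x => k⁻¹ * x)
    ⟨fun x _ => inv_mul_cancel_left₀ hk.ne' x, fun x _ => mul_inv_cancel_left₀ hk.ne' x⟩
    (fun _ hx => mul_pos hk hx) (fun _ hx => mul_pos (inv_pos.2 hk) hx)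

lemma bijOn_exp : BijOn Real.exp univ (Ioi 0) :=
  InvOn.bijOn (f' := Real.log) ⟨fun x _ => Real.log_exp x, fun _ hx => Real.exp_log hx⟩
    (fun x _ => Real.exp_pos x) (fun _ _ => mem_univ _)

lemma bijOn_sinh : BijOn Real.sinh (Ioi 0) (Ioi 0) :=
  InvOn.bijOn (f' := Real.arsinh)
    ⟨fun x _ => Real.arsinh_sinh x, fun x _ => Real.sinh_arsinh x⟩
    (fun _ hx => Real.sinh_pos_iff.2 hx) (fun _ hx => Real.arsinh_pos_iff.2 hx)

lemma bijOn_pi_div_two_sub : BijOn (fun θ => Real.pi / 2 - θ) quarter quarter :=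
  InvOn.bijOn (f' := fun θ => Real.pi / 2 - θ)
    ⟨fun _ _ => sub_sub_cancel _ _, fun _ _ => sub_sub_cancel _ _⟩
    (fun _ hθ => ⟨sub_pos.2 hθ.2, sub_lt_self _ hθ.1⟩)
    (fun _ hθ => ⟨sub_pos.2 hθ.2, sub_lt_self _ hθ.1⟩)

lemma lintegral_quarter_eq_arctan_mul {k : ℝ} (hk : 0 < k) (g : ℝ → ENNReal) :
    ∫⁻ θ in quarter, g θ =
      ∫⁻ x in Ioi (0 : ℝ), ENNReal.ofReal (k / (1 + (k * x) ^ 2)) * g (Real.arctan (k * x)) := by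
  rw [setLIntegral_eq_of_bijOn measurableSet_Ioi
    (fun x _ => ((hasDerivAt_id' x).const_mul k).arctan) (bijOn_arctan.comp (bijOn_mul_left hk))]
  refine lintegral_congr fun x => ?_
  rw [abs_of_pos (by positivity), mul_one, one_div_mul_eq_div]

lemma lintegral_quarter_eq_arctan (g : ℝ → ENNReal) :
    ∫⁻ θ in quarter, g θ =
      ∫⁻ x in Ioi (0 : ℝ), ENNReal.ofReal (1 / (1 + x ^ 2)) * g (Real.arctan x) := by
  simpa only [one_mul] using lintegral_quarter_eq_arctan_mul one_pos g

lemma lintegral_quarter_eq_arctan_mul_exp {k : ℝ} (hk : 0 < k) (g : ℝ → ENNReal) :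
    ∫⁻ θ in quarter, g θ = ∫⁻ s, ENNReal.ofReal (k * Real.exp s / (1 + (k * Real.exp s) ^ 2)) *
      g (Real.arctan (k * Real.exp s)) := by
  rw [setLIntegral_eq_of_bijOn MeasurableSet.univ
    (fun s _ => ((Real.hasDerivAt_exp s).const_mul k).arctan)
    (bijOn_arctan.comp ((bijOn_mul_left hk).comp bijOn_exp)), setLIntegral_univ]
  refine lintegral_congr fun s => ?_
  rw [abs_of_pos (by positivity), one_div_mul_eq_div]

lemma lintegral_quarter_eq_arctan_sinh (g : ℝ → ENNReal) :
    ∫⁻ θ in quarter, g θ = ∫⁻ s in Ioi (0 : ℝ), ENNReal.ofReal (1 / Real.cosh s) *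
      g (Real.pi / 2 - Real.arctan (Real.sinh s)) := by
  rw [setLIntegral_eq_of_bijOn measurableSet_Ioi
    (fun s _ => (Real.hasDerivAt_sinh s).arctan.const_sub (Real.pi / 2))
    (bijOn_pi_div_two_sub.comp (bijOn_arctan.comp bijOn_sinh))]
  refine lintegral_congr fun s => ?_
  rw [abs_neg, ← Real.cosh_sq', abs_of_pos (by positivity)]
  congr 2
  field_simp

end Substitutions

section Landen

lemma add_mul_cos_pos {A R : ℝ} (hA : 0 < A) (h : A ^ 2 = 1 + R ^ 2) (x : ℝ) :
    0 < A + R * Real.cos x := by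
  have hRA : |R| < A := abs_lt_of_sq_lt_sq (by linarith) hA.le
  have hcos : |R * Real.cos x| ≤ |R| := by
    rw [abs_mul]
    exact mul_le_of_le_one_right (abs_nonneg R) (Real.abs_cos_le_one x)
  linarith [neg_le_of_abs_le hcos]

lemma mul_one_div_sqrt_eq {a b c : ℝ} (ha : 0 < a) (hb : 0 ≤ b) (h : c = b / a ^ 2) :
    a * (1 / √b) = 1 / √c := by
  rw [h, Real.sqrt_div hb, Real.sqrt_sq ha.le, one_div_div, mul_one_div]

lemma lintegral_quarter_inv_sqrt_cos {A R : ℝ} (hA : 0 < A) (h : A ^ 2 = 1 + R ^ 2) :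
    ∫⁻ θ in quarter, ENNReal.ofReal (1 / √(A + R * Real.cos (2 * θ))) =
      ∫⁻ s, ENNReal.ofReal (1 / √(2 * (A + Real.cosh (2 * s)))) := by
  have hAR : 0 < A + R := by simpa using add_mul_cos_pos hA h 0
  set p := √(A + R)
  have hp_pos : 0 < p := Real.sqrt_pos.2 hAR
  have hp_sq : p ^ 2 = A + R := Real.sq_sqrt hAR.le
  rw [lintegral_quarter_eq_arctan_mul_exp hp_pos]
  refine lintegral_congr fun s => ?_
  have hcosh : 2 * Real.cosh (2 * s) = Real.exp s ^ 2 + (Real.exp s ^ 2)⁻¹ := by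
    rw [Real.cosh_eq, Real.exp_neg, two_mul s, Real.exp_add]
    ring
  have hp_conj : (A - R) * p ^ 2 = 1 := by
    rw [hp_sq]
    linear_combination h
  have hcos : A + R * Real.cos (2 * Real.arctan (p * Real.exp s)) =
      (p ^ 2 + Real.exp s ^ 2) / (1 + (p * Real.exp s) ^ 2) := by
    rw [Real.cos_two_mul, Real.cos_sq_arctan]
    field_simp
    linear_combination Real.exp s ^ 2 * hp_conj - hp_sq
  rw [← ENNReal.ofReal_mul (by positivity), hcos,
    mul_one_div_sqrt_eq (by positivity) (by positivity)]
  rw [mul_add, hcosh]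
  have hp_inv : 2 * A * p ^ 2 = (p ^ 2) ^ 2 + 1 := by
    rw [hp_sq]
    linear_combination h
  field_simp
  linear_combination Real.exp s ^ 2 * hp_inv

lemma lintegral_quarter_inv_sqrt_sin {A : ℝ} (hA : 0 < A) :
    ∫⁻ θ in quarter, ENNReal.ofReal (1 / √(1 - (1 - A) / 2 * Real.sin θ ^ 2)) =
      ∫⁻ s, ENNReal.ofReal (1 / √(2 * (A + Real.cosh (2 * s)))) := by
  rw [lintegral_quarter_eq_arctan_sinh, lintegral_eq_two_mul_setLIntegral_Ioi fun s => by
    rw [mul_neg, Real.cosh_neg], ← lintegral_const_mul' _ _ ENNReal.ofNat_ne_top]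
  refine lintegral_congr fun s => ?_
  have hradicand : 1 - (1 - A) / 2 * Real.sin (Real.pi / 2 - Real.arctan (Real.sinh s)) ^ 2 =
      (A + Real.cosh (2 * s)) / (2 * Real.cosh s ^ 2) := by
    rw [Real.sin_pi_div_two_sub, Real.cos_sq_arctan, ← Real.cosh_sq', Real.cosh_two_mul,
      Real.sinh_sq]
    field_simp
    ring
  rw [hradicand, ← ENNReal.ofReal_mul (by positivity), ← ENNReal.ofReal_ofNat,
    ← ENNReal.ofReal_mul zero_le_two, mul_one_div_sqrt_eq (by positivity) (by positivity) rfl,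
    mul_one_div_sqrt_eq two_pos (by positivity) rfl]
  congr 3
  field_simp

theorem landen {A R : ℝ} (hA : 0 < A) (h : A ^ 2 = 1 + R ^ 2) :
    ∫ θ in (0 : ℝ)..Real.pi / 2, 1 / √(A + R * Real.cos (2 * θ)) = ellipticK ((1 - A) / 2) := by
  rw [← ENNReal.ofReal_eq_ofReal_iff (integral_quarter_nonneg fun _ _ => by positivity)
    (ellipticK_nonneg _), ofReal_ellipticK (by linarith), lintegral_quarter_inv_sqrt_sin hA,
    ← lintegral_quarter_inv_sqrt_cos hA h]
  exact ofReal_integral_quarter (continuous_const.div (by fun_prop) fun θ =>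
    (Real.sqrt_pos.2 (add_mul_cos_pos hA h _)).ne') fun _ _ => by positivity

lemma integral_comp_cos_two_pi {g : ℝ → ℝ} (hg : Continuous fun φ => g (Real.cos φ)) :
    ∫ φ in (0 : ℝ)..2 * Real.pi, g (Real.cos φ) =
      4 * ∫ θ in (0 : ℝ)..Real.pi / 2, g (Real.cos (2 * θ)) := by
  have hdouble : ∫ θ in (0 : ℝ)..Real.pi / 2, g (Real.cos (2 * θ)) =
      2⁻¹ * ∫ φ in (0 : ℝ)..Real.pi, g (Real.cos φ) := by
    rw [intervalIntegral.integral_comp_mul_left (fun φ => g (Real.cos φ)) two_ne_zero, mul_zero,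
      mul_div_cancel₀ _ two_ne_zero, smul_eq_mul]
  have hreflect : ∫ φ in Real.pi..2 * Real.pi, g (Real.cos φ) =
      ∫ φ in (0 : ℝ)..Real.pi, g (Real.cos φ) := by
    have h := intervalIntegral.integral_comp_sub_left (a := 0) (b := Real.pi)
      (fun φ => g (Real.cos φ)) (2 * Real.pi)
    simp only [Real.cos_two_pi_sub, sub_zero] at h
    rw [h, two_mul, add_sub_cancel_right]
  rw [← intervalIntegral.integral_add_adjacent_intervals (b := Real.pi)
    (hg.intervalIntegrable _ _) (hg.intervalIntegrable _ _), hreflect, hdouble]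
  ring

lemma exists_eq_mul_cos_sin (B C : ℝ) :
    ∃ χ : ℝ, B = √(B ^ 2 + C ^ 2) * Real.cos χ ∧ C = √(B ^ 2 + C ^ 2) * Real.sin χ := by
  have hnorm : ‖(⟨B, C⟩ : ℂ)‖ = √(B ^ 2 + C ^ 2) := by
    rw [Complex.norm_def, Complex.normSq_mk, ← sq, ← sq]
  rw [← hnorm]
  exact ⟨_, (Complex.norm_mul_cos_arg ⟨B, C⟩).symm, (Complex.norm_mul_sin_arg ⟨B, C⟩).symm⟩

lemma integral_comp_add_right_two_pi {g : ℝ → ℝ} (hg : Function.Periodic g (2 * Real.pi)) (χ : ℝ) :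
    ∫ φ in (0 : ℝ)..2 * Real.pi, g (φ + χ) = ∫ φ in (0 : ℝ)..2 * Real.pi, g φ := by
  rw [intervalIntegral.integral_comp_add_right, zero_add, add_comm,
    hg.intervalIntegral_add_eq χ 0, zero_add]

lemma integral_inv_sqrt_add_cos_add_sin {A B C : ℝ} (hA : 0 < A) (h : A ^ 2 = 1 + B ^ 2 + C ^ 2) :
    ∫ φ in (0 : ℝ)..2 * Real.pi, 1 / √(A + B * Real.cos φ + C * Real.sin φ) =
      4 * ellipticK ((1 - A) / 2) := by
  obtain ⟨χ, hB, hC⟩ := exists_eq_mul_cos_sin B C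
  set R := √(B ^ 2 + C ^ 2)
  have hR : A ^ 2 = 1 + R ^ 2 := by
    rw [Real.sq_sqrt (by positivity)]
    linarith
  have hphase (φ : ℝ) :
      A + B * Real.cos φ + C * Real.sin φ = A + R * Real.cos (φ + -χ) := by
    rw [← sub_eq_add_neg, Real.cos_sub]
    linear_combination Real.cos φ * hB + Real.sin φ * hC
  simp only [hphase]
  rw [integral_comp_add_right_two_pi (g := fun φ => 1 / √(A + R * Real.cos φ))
    (fun φ => by simp only [Real.cos_add_two_pi]), integral_comp_cos_two_pi
    (g := fun c => 1 / √(A + R * c)), landen hA hR]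
  exact continuous_const.div (by fun_prop)
    fun x => (Real.sqrt_pos.2 (add_mul_cos_pos hA hR x)).ne'

end Landen

section ProductFormula

lemma intervalIntegral_swap_of_continuous {f : ℝ → ℝ → ℝ}
    (hf : Continuous fun p : ℝ × ℝ => f p.1 p.2) (a b c d : ℝ) :
    ∫ x in a..b, ∫ y in c..d, f x y = ∫ y in c..d, ∫ x in a..b, f x y :=
  intervalIntegral_intervalIntegral_swap <|
    (hf.continuousOn.integrableOn_compact (isCompact_uIcc.prod isCompact_uIcc)).mono_set
      (prod_mono uIoc_subset_uIcc uIoc_subset_uIcc)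

/-- The radicand of the double integral representing `ellipticK m ^ 2`, where `z ^ 2 = 1 + w ^ 2`.
It factors for fixed `φ` by `exists_productRadicand_eq_mul`, and for fixed `α` it has the shape
required by `integral_inv_sqrt_add_cos_add_sin`. -/
def productRadicand (z w α φ : ℝ) : ℝ :=
  z ^ 2 + w ^ 2 * Real.cos α + z * w * (1 + Real.cos α) * Real.cos φ +
    -(w * Real.sin α) * Real.sin φ

variable {z w : ℝ}

lemma exists_productRadicand_eq_mul (hz : 0 < z) (h : z ^ 2 = 1 + w ^ 2) (φ : ℝ) :
    ∃ χ, ∀ α, productRadicand z w α φ = (z + w * Real.cos φ) * (z + w * Real.cos (α + χ)) := by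
  obtain ⟨χ, hcos, hsin⟩ := exists_eq_mul_cos_sin (w + z * Real.cos φ) (Real.sin φ)
  have hpyth := Real.sin_sq_add_cos_sq φ
  have hradius : √((w + z * Real.cos φ) ^ 2 + Real.sin φ ^ 2) = z + w * Real.cos φ := by
    rw [← Real.sqrt_sq (add_mul_cos_pos hz h φ).le]
    congr 1
    linear_combination (Real.cos φ ^ 2 - 1) * h + hpyth
  rw [hradius] at hcos hsin
  refine ⟨χ, fun α => ?_⟩
  rw [productRadicand, Real.cos_add]
  linear_combination w * Real.cos α * hcos - w * Real.sin α * hsin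

lemma productRadicand_pos (hz : 0 < z) (h : z ^ 2 = 1 + w ^ 2) (α φ : ℝ) :
    0 < productRadicand z w α φ := by
  obtain ⟨χ, hχ⟩ := exists_productRadicand_eq_mul hz h φ
  rw [hχ]
  exact mul_pos (add_mul_cos_pos hz h φ) (add_mul_cos_pos hz h _)

lemma integral_inv_sqrt_add_mul_cos (hz : 0 < z) (h : z ^ 2 = 1 + w ^ 2) :
    ∫ φ in (0 : ℝ)..2 * Real.pi, 1 / √(z + w * Real.cos φ) = 4 * ellipticK ((1 - z) / 2) := by
  simpa only [zero_mul, add_zero] using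
    integral_inv_sqrt_add_cos_add_sin (B := w) (C := 0) hz (by linarith)

lemma integral_inv_sqrt_productRadicand_right (h : z ^ 2 = 1 + w ^ 2) (α : ℝ) :
    ∫ φ in (0 : ℝ)..2 * Real.pi, 1 / √(productRadicand z w α φ) =
      4 * ellipticK (-(w ^ 2 * ((1 + Real.cos α) / 2))) := by
  have hpyth := Real.sin_sq_add_cos_sq α
  have hcos := mul_nonneg (sq_nonneg w) (neg_le_iff_add_nonneg.1 (Real.neg_one_le_cos α))
  simp only [productRadicand]
  rw [integral_inv_sqrt_add_cos_add_sin (by linarith)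
    (by linear_combination (z ^ 2 - w ^ 2 * Real.cos α ^ 2 + 1) * h - w ^ 2 * hpyth)]
  congr 2
  linear_combination -h / 2

lemma integral_inv_sqrt_productRadicand_left (hz : 0 < z) (h : z ^ 2 = 1 + w ^ 2) (φ : ℝ) :
    ∫ α in (0 : ℝ)..2 * Real.pi, 1 / √(productRadicand z w α φ) =
      1 / √(z + w * Real.cos φ) * (4 * ellipticK ((1 - z) / 2)) := by
  obtain ⟨χ, hχ⟩ := exists_productRadicand_eq_mul hz h φ
  simp only [hχ, Real.sqrt_mul (add_mul_cos_pos hz h φ).le, one_div, mul_inv]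
  rw [intervalIntegral.integral_const_mul,
    integral_comp_add_right_two_pi (g := fun α => (√(z + w * Real.cos α))⁻¹)
      (fun α => by simp only [Real.cos_add_two_pi])]
  simp only [← one_div, integral_inv_sqrt_add_mul_cos hz h]

lemma integral_inv_sqrt_productRadicand_swap (hz : 0 < z) (h : z ^ 2 = 1 + w ^ 2) :
    ∫ φ in (0 : ℝ)..2 * Real.pi, ∫ α in (0 : ℝ)..2 * Real.pi, 1 / √(productRadicand z w α φ) =
      ∫ α in (0 : ℝ)..2 * Real.pi, ∫ φ in (0 : ℝ)..2 * Real.pi, 1 / √(productRadicand z w α φ) := by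
  have hcont : Continuous fun p : ℝ × ℝ => 1 / √(productRadicand z w p.2 p.1) :=
    continuous_const.div (by unfold productRadicand; fun_prop) fun p =>
      (Real.sqrt_pos.2 (productRadicand_pos hz h p.2 p.1)).ne'
  exact intervalIntegral_swap_of_continuous (f := fun φ α => 1 / √(productRadicand z w α φ))
    hcont _ _ _ _

theorem ellipticK_sq {m : ℝ} (hm : m ≤ 0) : ellipticK m ^ 2 =
    ∫ α in (0 : ℝ)..Real.pi / 2, ellipticK (4 * m * (1 - m) * Real.cos α ^ 2) := by
  set z := 1 - 2 * m with hz_def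
  set w := √(-(4 * m * (1 - m)))
  have hw_sq : w ^ 2 = -(4 * m * (1 - m)) :=
    Real.sq_sqrt (neg_nonneg.2 (mul_nonpos_of_nonpos_of_nonneg (by linarith) (by linarith)))
  have hz : 0 < z := by linarith
  have h : z ^ 2 = 1 + w ^ 2 := by
    rw [hw_sq, hz_def]
    ring
  have hm_eq : (1 - z) / 2 = m := by
    rw [hz_def]
    ring
  have hmodulus (α : ℝ) : -(w ^ 2 * ((1 + Real.cos α) / 2)) < 1 := by
    linarith [mul_nonneg (sq_nonneg w) (neg_le_iff_add_nonneg.1 (Real.neg_one_le_cos α))]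
  have hcont : Continuous fun α : ℝ => ellipticK (-(w ^ 2 * ((1 + Real.cos α) / 2))) :=
    continuous_ellipticK_comp (by fun_prop) hmodulus
  have hswap := integral_inv_sqrt_productRadicand_swap hz h
  simp only [integral_inv_sqrt_productRadicand_left hz h,
    integral_inv_sqrt_productRadicand_right h, intervalIntegral.integral_mul_const,
    intervalIntegral.integral_const_mul, integral_inv_sqrt_add_mul_cos hz h, hm_eq] at hswap
  rw [integral_comp_cos_two_pi (g := fun c => ellipticK (-(w ^ 2 * ((1 + c) / 2)))) hcont] at hswap
  have hangle (θ : ℝ) : -(w ^ 2 * ((1 + Real.cos (2 * θ)) / 2)) =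
      4 * m * (1 - m) * Real.cos θ ^ 2 := by
    rw [Real.cos_two_mul, hw_sq]
    ring
  simp only [hangle] at hswap
  linarith

end ProductFormula

section RadicandIntegrals

lemma continuous_div_sqrt {X : Type*} [TopologicalSpace X] {f g : X → ℝ} (hf : Continuous f)
    (hg : Continuous g) (h : ∀ x, |f x| ≤ g x) : Continuous fun x => f x / √(g x) := by
  refine continuous_iff_continuousAt.2 fun x => ?_
  rcases ((abs_nonneg _).trans (h x)).eq_or_lt with hzero | hpos
  · have hlim : Tendsto (fun y => √(g y)) (𝓝 x) (𝓝 0) := by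
      simpa only [← hzero, Real.sqrt_zero] using hg.sqrt.tendsto x
    rw [ContinuousAt, ← hzero, Real.sqrt_zero, div_zero]
    refine squeeze_zero_norm (fun y => ?_) hlim
    rw [Real.norm_eq_abs, abs_div, abs_of_nonneg (Real.sqrt_nonneg _)]
    exact (div_le_div_of_nonneg_right (h y) (Real.sqrt_nonneg _)).trans_eq Real.div_sqrt
  · exact hf.continuousAt.div hg.sqrt.continuousAt (Real.sqrt_pos.2 hpos).ne'

/-- The radicand of the elliptic integrals of parameter `sin ξ ^ 2`, as a symmetric function of both
angles. -/
def radicand (ξ θ : ℝ) : ℝ := 1 - Real.sin ξ ^ 2 * Real.sin θ ^ 2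

lemma radicand_comm (ξ θ : ℝ) : radicand ξ θ = radicand θ ξ := by
  rw [radicand, radicand, mul_comm]

lemma continuous_radicand : Continuous fun p : ℝ × ℝ => radicand p.2 p.1 := by
  unfold radicand
  fun_prop

lemma one_sub_sin_sq_le_radicand (ξ θ : ℝ) : 1 - Real.sin ξ ^ 2 ≤ radicand ξ θ :=
  sub_le_sub_left (mul_le_of_le_one_right (sq_nonneg _) (Real.sin_sq_le_one θ)) 1

lemma radicand_nonneg (ξ θ : ℝ) : 0 ≤ radicand ξ θ :=
  (sub_nonneg.2 (Real.sin_sq_le_one ξ)).trans (one_sub_sin_sq_le_radicand ξ θ)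

lemma radicand_pos {ξ : ℝ} (hξ : ξ ∈ quarter) (θ : ℝ) : 0 < radicand ξ θ := by
  refine lt_of_lt_of_le ?_ (one_sub_sin_sq_le_radicand ξ θ)
  rw [← Real.cos_sq']
  exact pow_pos (cos_pos_of_mem_quarter hξ) 2

lemma hasDerivAt_sqrt_radicand {ξ θ : ℝ} (h : 0 < radicand ξ θ) :
    HasDerivAt (fun ξ => √(radicand ξ θ))
      (-(Real.sin ξ * Real.cos ξ * Real.sin θ ^ 2) / √(radicand ξ θ)) ξ := by
  have hradicand : HasDerivAt (fun ξ => radicand ξ θ)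
      (-(2 * Real.sin ξ ^ (2 - 1) * Real.cos ξ * Real.sin θ ^ 2)) ξ :=
    (((Real.hasDerivAt_sin ξ).fun_pow 2).mul_const (Real.sin θ ^ 2)).const_sub 1
  refine (hradicand.sqrt h.ne').congr_deriv ?_
  field_simp
  ring

/-- The integral of `N (sin ξ ^ 2) (sin θ ^ 2) / √(radicand ξ θ)` over the square of angles. -/
def radicandIntegral (N : ℝ → ℝ → ℝ) : ℝ :=
  ∫ θ in (0 : ℝ)..Real.pi / 2, ∫ ξ in (0 : ℝ)..Real.pi / 2,
    N (Real.sin ξ ^ 2) (Real.sin θ ^ 2) / √(radicand ξ θ)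

/-- Continuity of the integrand of `radicandIntegral N`, including at the zeros of the radicand,
where the division gives the value zero. -/
def IsAdmissible (N : ℝ → ℝ → ℝ) : Prop :=
  Continuous fun p : ℝ × ℝ => N (Real.sin p.2 ^ 2) (Real.sin p.1 ^ 2) / √(radicand p.2 p.1)

namespace IsAdmissible

variable {M N : ℝ → ℝ → ℝ}

lemma continuous_left (hN : IsAdmissible N) (θ : ℝ) :
    Continuous fun ξ => N (Real.sin ξ ^ 2) (Real.sin θ ^ 2) / √(radicand ξ θ) :=
  Continuous.comp (f := fun ξ : ℝ => (θ, ξ)) hN (by fun_prop)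

lemma continuous_integral (hN : IsAdmissible N) :
    Continuous fun θ => ∫ ξ in (0 : ℝ)..Real.pi / 2,
      N (Real.sin ξ ^ 2) (Real.sin θ ^ 2) / √(radicand ξ θ) :=
  continuous_integral_quarter
    (g := fun θ ξ => N (Real.sin ξ ^ 2) (Real.sin θ ^ 2) / √(radicand ξ θ)) hN

lemma swap (hN : IsAdmissible N) : IsAdmissible fun a b => N b a := by
  have hswap := Continuous.comp (f := Prod.swap) hN continuous_swap
  simp only [Function.comp_def, Prod.fst_swap, Prod.snd_swap, radicand_comm (Prod.fst _)] at hswap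
  exact hswap

lemma add (hM : IsAdmissible M) (hN : IsAdmissible N) : IsAdmissible fun a b => M a b + N a b := by
  simp only [IsAdmissible, add_div]
  exact Continuous.add hM hN

lemma continuous_mul (hM : Continuous fun p : ℝ × ℝ => M p.1 p.2) (hN : IsAdmissible N) :
    IsAdmissible fun a b => M a b * N a b := by
  simp only [IsAdmissible, mul_div_assoc]
  exact (hM.comp (g := fun p : ℝ × ℝ => M p.1 p.2)
    (f := fun p : ℝ × ℝ => (Real.sin p.2 ^ 2, Real.sin p.1 ^ 2)) (by fun_prop)).mul hN

end IsAdmissible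

lemma isAdmissible_one_sub : IsAdmissible fun a _ => 1 - a :=
  continuous_div_sqrt (by fun_prop) continuous_radicand fun p => by
    rw [abs_of_nonneg (sub_nonneg.2 (Real.sin_sq_le_one _))]
    exact one_sub_sin_sq_le_radicand _ _

lemma isAdmissible_one_sub_mul : IsAdmissible fun a b => 1 - a * b :=
  continuous_div_sqrt (by fun_prop) continuous_radicand fun p =>
    (abs_of_nonneg (radicand_nonneg _ _)).le

lemma isAdmissible_one_sub_pow (j : ℕ) : IsAdmissible fun a _ => (1 - a) ^ (j + 1) := by
  simp only [pow_succ]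
  exact isAdmissible_one_sub.continuous_mul (M := fun a _ => (1 - a) ^ j) (by fun_prop)

lemma radicandIntegral_add {M N : ℝ → ℝ → ℝ} (hM : IsAdmissible M) (hN : IsAdmissible N) :
    radicandIntegral (fun a b => M a b + N a b) = radicandIntegral M + radicandIntegral N := by
  simp only [radicandIntegral, add_div]
  rw [← intervalIntegral.integral_add (hM.continuous_integral.intervalIntegrable _ _)
    (hN.continuous_integral.intervalIntegrable _ _)]
  refine intervalIntegral.integral_congr fun θ _ => ?_
  exact intervalIntegral.integral_add ((hM.continuous_left θ).intervalIntegrable _ _)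
    ((hN.continuous_left θ).intervalIntegrable _ _)

lemma radicandIntegral_const_mul (c : ℝ) (N : ℝ → ℝ → ℝ) :
    radicandIntegral (fun a b => c * N a b) = c * radicandIntegral N := by
  simp only [radicandIntegral, mul_div_assoc, intervalIntegral.integral_const_mul]

lemma radicandIntegral_swap {N : ℝ → ℝ → ℝ} (hN : IsAdmissible N) :
    radicandIntegral (fun a b => N b a) = radicandIntegral N := by
  rw [radicandIntegral, radicandIntegral, intervalIntegral_swap_of_continuous
    (f := fun θ ξ => N (Real.sin θ ^ 2) (Real.sin ξ ^ 2) / √(radicand ξ θ)) hN.swap]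
  simp only [radicand_comm]

/-- The weight for which `exactWeight k (sin ξ ^ 2) (sin θ ^ 2) / √(radicand ξ θ)` is the
`ξ`-derivative of `sin ξ ^ (2 * k + 1) * cos ξ * √(radicand ξ θ)`. -/
def exactWeight (k : ℕ) (a b : ℝ) : ℝ :=
  a ^ k * ((2 * k + 1) * (1 - a) - a) * (1 - a * b) + -(a ^ (k + 1) * b) * (1 - a)

lemma hasDerivAt_sin_pow_mul_cos_mul_sqrt_radicand (k : ℕ) {ξ θ : ℝ} (h : 0 < radicand ξ θ) :
    HasDerivAt (fun ξ => Real.sin ξ ^ (2 * k + 1) * Real.cos ξ * √(radicand ξ θ))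
      (exactWeight k (Real.sin ξ ^ 2) (Real.sin θ ^ 2) / √(radicand ξ θ)) ξ := by
  refine ((((Real.hasDerivAt_sin ξ).fun_pow (2 * k + 1)).fun_mul (Real.hasDerivAt_cos ξ)).fun_mul
    (hasDerivAt_sqrt_radicand h)).congr_deriv ?_
  have hpyth := Real.cos_sq' ξ
  rw [eq_div_iff (Real.sqrt_pos.2 h).ne', add_mul, mul_assoc _ √_ √_, Real.mul_self_sqrt h.le,
    mul_assoc _ (_ / _) √_, div_mul_cancel₀ _ (Real.sqrt_pos.2 h).ne', exactWeight, radicand]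
  push_cast
  linear_combination (-(Real.sin ξ ^ (2 * k + 2) * Real.sin θ ^ 2) +
    (2 * k + 1) * Real.sin ξ ^ (2 * k) * (1 - Real.sin ξ ^ 2 * Real.sin θ ^ 2)) * hpyth

lemma isAdmissible_exactWeight (k : ℕ) : IsAdmissible (exactWeight k) :=
  (isAdmissible_one_sub_mul.continuous_mul
    (M := fun a _ => a ^ k * ((2 * k + 1) * (1 - a) - a)) (by fun_prop)).add
    (isAdmissible_one_sub.continuous_mul (M := fun a b => -(a ^ (k + 1) * b)) (by fun_prop))

lemma integral_quarter_exactWeight (k : ℕ) (θ : ℝ) : ∫ ξ in (0 : ℝ)..Real.pi / 2,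
    exactWeight k (Real.sin ξ ^ 2) (Real.sin θ ^ 2) / √(radicand ξ θ) = 0 := by
  have hcont : Continuous fun ξ => √(radicand ξ θ) := by
    unfold radicand
    fun_prop
  rw [intervalIntegral.integral_eq_sub_of_hasDerivAt_of_le Real.pi_div_two_pos.le
    (f := fun ξ => Real.sin ξ ^ (2 * k + 1) * Real.cos ξ * √(radicand ξ θ)) (by fun_prop)
    (fun ξ hξ => hasDerivAt_sin_pow_mul_cos_mul_sqrt_radicand k (radicand_pos hξ θ))
    (((isAdmissible_exactWeight k).continuous_left θ).intervalIntegrable _ _)]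
  simp

lemma radicandIntegral_mul_exactWeight (k : ℕ) (M : ℝ → ℝ) :
    radicandIntegral (fun a b => M b * exactWeight k a b) = 0 := by
  simp only [radicandIntegral, mul_div_assoc, intervalIntegral.integral_const_mul,
    integral_quarter_exactWeight, mul_zero, intervalIntegral.integral_zero]

lemma angleIntegral_eq_radicandIntegral :
    angleIntegral = radicandIntegral fun a b => a * (1 - a * b) := by
  simp only [angleIntegral, radicandIntegral, radicand, mul_div_assoc, Real.div_sqrt]

theorem angleIntegral_eq : angleIntegral =
    5 * radicandIntegral (fun a _ => (1 - a) ^ 1) -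
      6 * radicandIntegral (fun a _ => (1 - a) ^ 2) := by
  have hW := isAdmissible_exactWeight
  have h₁ := (isAdmissible_one_sub_pow 0).continuous_mul (M := fun _ _ => 5) (by fun_prop)
  have h₂ := (isAdmissible_one_sub_pow 1).continuous_mul (M := fun _ _ => -6) (by fun_prop)
  have hW₀ := (hW 0).continuous_mul (M := fun _ _ => 1) (by fun_prop)
  have hW₀' := (hW 0).continuous_mul (M := fun _ b => 8 * b - 10 * b ^ 2) (by fun_prop)
  have hW₁ := (hW 1).continuous_mul (M := fun _ b => 6 * b - 4) (by fun_prop)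
  calc angleIntegral
    _ = radicandIntegral fun a b => 5 * (1 - a) ^ (0 + 1) + -6 * (1 - a) ^ (1 + 1) +
          1 * exactWeight 0 a b + (8 * a - 10 * a ^ 2) * exactWeight 0 b a +
            (6 * b - 4) * exactWeight 1 a b := by
        rw [angleIntegral_eq_radicandIntegral]
        congr 1 with a b
        simp only [exactWeight]
        push_cast
        ring
    _ = _ := by
        rw [radicandIntegral_add (((h₁.add h₂).add hW₀).add hW₀'.swap) hW₁,
          radicandIntegral_add ((h₁.add h₂).add hW₀) hW₀'.swap,
          radicandIntegral_add (h₁.add h₂) hW₀, radicandIntegral_add h₁ h₂,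
          radicandIntegral_swap hW₀', radicandIntegral_mul_exactWeight 0 (fun _ => 1),
          radicandIntegral_mul_exactWeight 0 (fun b => 8 * b - 10 * b ^ 2),
          radicandIntegral_mul_exactWeight 1 (fun b => 6 * b - 4),
          radicandIntegral_const_mul, radicandIntegral_const_mul]
        ring

end RadicandIntegrals

section WeightedSquares

lemma lintegral_reverse_three {α β γ : Type*} [MeasurableSpace α] [MeasurableSpace β]
    [MeasurableSpace γ] {μ : Measure α} {ν : Measure β} {ρ : Measure γ} [SFinite μ] [SFinite ν]
    [SFinite ρ] {f : α → β → γ → ENNReal}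
    (hf : Measurable fun p : (α × β) × γ => f p.1.1 p.1.2 p.2) :
    ∫⁻ x, ∫⁻ y, ∫⁻ z, f x y z ∂ρ ∂ν ∂μ = ∫⁻ z, ∫⁻ y, ∫⁻ x, f x y z ∂μ ∂ν ∂ρ := by
  have hinner (y : β) : ∫⁻ x, ∫⁻ z, f x y z ∂ρ ∂μ = ∫⁻ z, ∫⁻ x, f x y z ∂μ ∂ρ :=
    lintegral_lintegral_swap
      (hf.comp (by fun_prop : Measurable fun p : α × γ => ((p.1, y), p.2))).aemeasurable
  have hmeas : Measurable fun p : β × γ => ∫⁻ x, f x p.1 p.2 ∂μ :=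
    (hf.comp (by fun_prop :
      Measurable fun p : (β × γ) × α => ((p.2, p.1.1), p.1.2))).lintegral_prod_right'
  rw [lintegral_lintegral_swap hf.lintegral_prod_right'.aemeasurable]
  simp only [hinner]
  exact lintegral_lintegral_swap hmeas.aemeasurable

lemma lintegral_quarter_comp_pi_div_two_sub (g : ℝ → ENNReal) :
    ∫⁻ θ in quarter, g (Real.pi / 2 - θ) = ∫⁻ θ in quarter, g θ := by
  rw [setLIntegral_eq_of_bijOn measurableSet_Ioo
    (fun θ _ => (hasDerivAt_id' θ).const_sub (Real.pi / 2)) bijOn_pi_div_two_sub g]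
  simp only [abs_neg, abs_one, ENNReal.ofReal_one, one_mul]

lemma ofReal_ellipticK_eq_cos {m : ℝ} (hm : m < 1) : ENNReal.ofReal (ellipticK m) =
    ∫⁻ θ in quarter, ENNReal.ofReal (1 / √(1 - m * Real.cos θ ^ 2)) := by
  rw [ofReal_ellipticK hm, ← lintegral_quarter_comp_pi_div_two_sub]
  simp only [Real.sin_pi_div_two_sub]

lemma ofReal_ellipticK_neg_sq {m : ℝ} (hm : 0 ≤ m) : ENNReal.ofReal (ellipticK (-m) ^ 2) =
    ∫⁻ α in quarter, ∫⁻ θ in quarter,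
      ENNReal.ofReal (1 / √(1 + 4 * m * (1 + m) * Real.cos α ^ 2 * Real.cos θ ^ 2)) := by
  have hmodulus (α : ℝ) : 4 * -m * (1 - -m) * Real.cos α ^ 2 < 1 := by
    linarith [show 0 ≤ 4 * m * (1 + m) * Real.cos α ^ 2 by positivity]
  rw [ellipticK_sq (neg_nonpos.2 hm), ofReal_integral_quarter
    (continuous_ellipticK_comp (by fun_prop) hmodulus) fun _ _ => ellipticK_nonneg _]
  refine lintegral_congr fun α => ?_
  rw [ofReal_ellipticK_eq_cos (hmodulus α)]
  refine lintegral_congr fun θ => ?_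
  congr 3
  ring

lemma bijOn_sqrt_one_add_sq_div {c : ℝ} (hc : 0 < c) :
    BijOn (fun y : ℝ => (√(1 + y ^ 2 / c) - 1) / 2) (Ioi 0) (Ioi 0) := by
  refine InvOn.bijOn (f' := fun m => √(c * ((1 + 2 * m) ^ 2 - 1))) ⟨fun y hy => ?_, fun m hm => ?_⟩
    (fun y hy => ?_) (fun m hm => ?_)
  · have hz : 1 + 2 * ((√(1 + y ^ 2 / c) - 1) / 2) = √(1 + y ^ 2 / c) := by ring
    simp only [hz]
    rw [Real.sq_sqrt (by positivity), add_sub_cancel_left, mul_div_cancel₀ _ hc.ne',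
      Real.sqrt_sq hy.out.le]
  · have hm' := hm.out
    have hnonneg : 0 ≤ (1 + 2 * m) ^ 2 - 1 := by nlinarith
    simp only
    rw [Real.sq_sqrt (by positivity), mul_div_cancel_left₀ _ hc.ne', add_sub_cancel,
      Real.sqrt_sq (by positivity), add_sub_cancel_left, mul_div_cancel_left₀ _ two_ne_zero]
  · have hy' := hy.out
    have hone : 1 < √(1 + y ^ 2 / c) := by
      rw [Real.lt_sqrt zero_le_one, one_pow]
      exact lt_add_of_pos_right 1 (by positivity)
    exact div_pos (sub_pos.2 hone) two_pos
  · have hm' := hm.out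
    exact Real.sqrt_pos.2 (mul_pos hc (by nlinarith))

lemma lintegral_Ioi_eq_sqrt_one_add_sq_div {c : ℝ} (hc : 0 < c) (g : ℝ → ENNReal) :
    ∫⁻ m in Ioi (0 : ℝ), g m = ∫⁻ y in Ioi (0 : ℝ),
      ENNReal.ofReal (y / (2 * c * √(1 + y ^ 2 / c))) * g ((√(1 + y ^ 2 / c) - 1) / 2) := by
  have hderiv (y : ℝ) : HasDerivAt (fun y : ℝ => (√(1 + y ^ 2 / c) - 1) / 2)
      (y / (2 * c * √(1 + y ^ 2 / c))) y := by
    have hpos : 0 < 1 + y ^ 2 / c := by positivity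
    refine (((((hasDerivAt_pow 2 y).div_const c).const_add 1).sqrt hpos.ne').sub_const 1
      |>.div_const 2).congr_deriv ?_
    field_simp
    norm_num
  rw [setLIntegral_eq_of_bijOn measurableSet_Ioi (fun y _ => hderiv y)
    (bijOn_sqrt_one_add_sq_div hc)]
  refine setLIntegral_congr_fun measurableSet_Ioi fun y hy => ?_
  have hy' := hy.out
  rw [abs_of_pos (by positivity)]

lemma lintegral_Ioi_weighted_inv_sqrt {c b : ℝ} (hc : 0 < c) (hb : 0 ≤ b) (j : ℕ) :
    ∫⁻ m in Ioi (0 : ℝ), ENNReal.ofReal (1 / √(1 + 4 * m * (1 + m) * c * b)) *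
      ENNReal.ofReal (1 / (1 + 2 * m) ^ (2 * j + 1)) =
    ∫⁻ y in Ioi (0 : ℝ), ENNReal.ofReal (y / 2 / √(1 + y ^ 2 * b)) *
      ENNReal.ofReal (c ^ j / (c + y ^ 2) ^ (j + 1)) := by
  rw [lintegral_Ioi_eq_sqrt_one_add_sq_div hc]
  refine setLIntegral_congr_fun measurableSet_Ioi fun y hy => ?_
  have hy' := hy.out
  set z := √(1 + y ^ 2 / c)
  have hz_pos : 0 < z := Real.sqrt_pos.2 (by positivity)
  have hz_sq : c * z ^ 2 = c + y ^ 2 := by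
    rw [Real.sq_sqrt (by positivity)]
    field_simp
  have hz : 1 + 2 * ((z - 1) / 2) = z := by ring
  have hradicand : 1 + 4 * ((z - 1) / 2) * (1 + (z - 1) / 2) * c * b = 1 + y ^ 2 * b := by
    linear_combination b * hz_sq
  rw [hz, hradicand, ← ENNReal.ofReal_mul (by positivity), ← ENNReal.ofReal_mul (by positivity),
    ← ENNReal.ofReal_mul (by positivity), ← hz_sq, mul_pow]
  congr 1
  field_simp
  ring

lemma lintegral_quarter_rational {y : ℝ} (hy : 0 < y) (j : ℕ) :
    ∫⁻ α in quarter, ENNReal.ofReal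
      ((Real.cos α ^ 2) ^ j / (Real.cos α ^ 2 + y ^ 2) ^ (j + 1)) =
      ENNReal.ofReal (√(1 + y ^ 2) / (y * (1 + y ^ 2) ^ (j + 1))) *
        ENNReal.ofReal (∫ α in (0 : ℝ)..Real.pi / 2, Real.cos α ^ (2 * j)) := by
  have hsqrt : √(1 + y ^ 2) ^ 2 = 1 + y ^ 2 := Real.sq_sqrt (by positivity)
  rw [lintegral_quarter_eq_arctan_mul (k := √(1 + y ^ 2) / y) (by positivity),
    ofReal_integral_quarter (by fun_prop) (fun α _ => by rw [pow_mul]; positivity),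
    lintegral_quarter_eq_arctan, ← lintegral_const_mul' _ _ ENNReal.ofReal_ne_top]
  refine lintegral_congr fun s => ?_
  set u := √(1 + y ^ 2) / y * s with hu
  have hu_sq : y ^ 2 * u ^ 2 = (1 + y ^ 2) * s ^ 2 := by
    rw [hu, mul_pow, div_pow, hsqrt]
    field_simp
  clear_value u
  have hsum : 1 / (1 + u ^ 2) + y ^ 2 = (1 + y ^ 2) * (1 + s ^ 2) / (1 + u ^ 2) := by
    field_simp
    linear_combination hu_sq
  rw [pow_mul, Real.cos_sq_arctan, Real.cos_sq_arctan, hsum, ← ENNReal.ofReal_mul (by positivity),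
    ← ENNReal.ofReal_mul (by positivity), ← ENNReal.ofReal_mul (by positivity)]
  congr 1
  simp only [div_pow, one_pow, mul_pow]
  field_simp
  ring

lemma radicand_arctan (y θ : ℝ) :
    radicand (Real.arctan y) θ = (1 + y ^ 2 * Real.cos θ ^ 2) / (1 + y ^ 2) := by
  rw [radicand, Real.sin_sq, Real.cos_sq_arctan, Real.cos_sq']
  field_simp
  ring

lemma lintegral_quarter_Ioi_weighted (j : ℕ) (θ : ℝ) :
    ∫⁻ α in quarter, ∫⁻ y in Ioi (0 : ℝ),
      ENNReal.ofReal (y / 2 / √(1 + y ^ 2 * Real.cos θ ^ 2)) *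
        ENNReal.ofReal ((Real.cos α ^ 2) ^ j / (Real.cos α ^ 2 + y ^ 2) ^ (j + 1)) =
    ENNReal.ofReal ((∫ α in (0 : ℝ)..Real.pi / 2, Real.cos α ^ (2 * j)) / 2) *
      ∫⁻ ξ in quarter, ENNReal.ofReal ((1 - Real.sin ξ ^ 2) ^ j / √(radicand ξ θ)) := by
  rw [lintegral_lintegral_swap (Measurable.aemeasurable (by fun_prop)), lintegral_quarter_eq_arctan,
    ← lintegral_const_mul' _ _ ENNReal.ofReal_ne_top]
  refine setLIntegral_congr_fun measurableSet_Ioi fun y hy => ?_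
  have hy' := hy.out
  rw [lintegral_const_mul' _ _ ENNReal.ofReal_ne_top, lintegral_quarter_rational hy',
    ← Real.cos_sq', Real.cos_sq_arctan, radicand_arctan, Real.sqrt_div (by positivity), ← mul_assoc,
    ← ENNReal.ofReal_mul (by positivity), ← ENNReal.ofReal_mul (by positivity),
    ← ENNReal.ofReal_mul (by positivity), ← ENNReal.ofReal_mul' (by positivity), div_pow, one_pow]
  congr 1
  field_simp
  ring

theorem lintegral_ellipticK_neg_sq_div_pow (j : ℕ) :
    ∫⁻ m in Ioi (0 : ℝ), ENNReal.ofReal (ellipticK (-m) ^ 2 / (1 + 2 * m) ^ (2 * j + 3)) =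
      ENNReal.ofReal ((∫ α in (0 : ℝ)..Real.pi / 2, Real.cos α ^ (2 * (j + 1))) / 2 *
        radicandIntegral fun a _ => (1 - a) ^ (j + 1)) := by
  have hintegrand {m : ℝ} (hm : m ∈ Ioi 0) :
      ENNReal.ofReal (ellipticK (-m) ^ 2 / (1 + 2 * m) ^ (2 * j + 3)) =
        ∫⁻ α in quarter, ∫⁻ θ in quarter,
          ENNReal.ofReal (1 / √(1 + 4 * m * (1 + m) * Real.cos α ^ 2 * Real.cos θ ^ 2)) *
            ENNReal.ofReal (1 / (1 + 2 * m) ^ (2 * (j + 1) + 1)) := by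
    simp only [lintegral_mul_const' _ _ ENNReal.ofReal_ne_top]
    rw [← ofReal_ellipticK_neg_sq hm.out.le, ← ENNReal.ofReal_mul (sq_nonneg _), mul_one_div]
    rfl
  have hmoment : 0 ≤ ∫ α in (0 : ℝ)..Real.pi / 2, Real.cos α ^ (2 * (j + 1)) :=
    integral_quarter_nonneg fun α _ => by rw [pow_mul]; positivity
  calc ∫⁻ m in Ioi (0 : ℝ), ENNReal.ofReal (ellipticK (-m) ^ 2 / (1 + 2 * m) ^ (2 * j + 3))
      = ∫⁻ θ in quarter, ∫⁻ α in quarter, ∫⁻ m in Ioi (0 : ℝ),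
          ENNReal.ofReal (1 / √(1 + 4 * m * (1 + m) * Real.cos α ^ 2 * Real.cos θ ^ 2)) *
            ENNReal.ofReal (1 / (1 + 2 * m) ^ (2 * (j + 1) + 1)) := by
        rw [setLIntegral_congr_fun measurableSet_Ioi fun m hm => hintegrand hm]
        exact lintegral_reverse_three (by fun_prop)
    _ = ∫⁻ θ in quarter, ∫⁻ α in quarter, ∫⁻ y in Ioi (0 : ℝ),
          ENNReal.ofReal (y / 2 / √(1 + y ^ 2 * Real.cos θ ^ 2)) * ENNReal.ofReal
            ((Real.cos α ^ 2) ^ (j + 1) / (Real.cos α ^ 2 + y ^ 2) ^ (j + 1 + 1)) :=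
        lintegral_congr fun θ => setLIntegral_congr_fun measurableSet_Ioo fun α hα =>
          lintegral_Ioi_weighted_inv_sqrt (pow_pos (cos_pos_of_mem_quarter hα) 2) (sq_nonneg _) _
    _ = ENNReal.ofReal ((∫ α in (0 : ℝ)..Real.pi / 2, Real.cos α ^ (2 * (j + 1))) / 2) *
          ∫⁻ θ in quarter, ∫⁻ ξ in quarter,
            ENNReal.ofReal ((1 - Real.sin ξ ^ 2) ^ (j + 1) / √(radicand ξ θ)) := by
        simp only [lintegral_quarter_Ioi_weighted]
        exact lintegral_const_mul' _ _ ENNReal.ofReal_ne_top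
    _ = _ := by
        rw [radicandIntegral, ENNReal.ofReal_mul (by positivity), ofReal_integral_quarter_two
          (g := fun θ ξ => (1 - Real.sin ξ ^ 2) ^ (j + 1) / √(radicand ξ θ))
          (isAdmissible_one_sub_pow j) fun θ _ ξ _ => ?_]
        have hcos : 0 ≤ 1 - Real.sin ξ ^ 2 := sub_nonneg.2 (Real.sin_sq_le_one ξ)
        positivity

end WeightedSquares

section EllipticDerivatives

lemma hasDerivAt_integral_of_continuousOn {F F' : ℝ → ℝ → ℝ} {s : Set ℝ} {x : ℝ} (hs : s ∈ 𝓝 x)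
    (hF : ∀ y ∈ s, Continuous (F y)) (hF' : ContinuousOn (fun p : ℝ × ℝ => F' p.1 p.2) (s ×ˢ univ))
    (hderiv : ∀ y ∈ s, ∀ t, HasDerivAt (fun y => F y t) (F' y t) y) (a b : ℝ) :
    HasDerivAt (fun y => ∫ t in a..b, F y t) (∫ t in a..b, F' x t) x := by
  obtain ⟨K, hK, hKs, hK_compact⟩ := local_compact_nhds hs
  obtain ⟨C, hC⟩ := (hK_compact.prod isCompact_uIcc).exists_bound_of_continuousOn
    (hF'.mono (prod_mono hKs (subset_univ (uIcc a b))))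
  have hF'x : Continuous (F' x) := continuousOn_univ.1 <|
    hF'.comp (f := fun t => (x, t)) (by fun_prop) fun t _ => ⟨mem_of_mem_nhds hs, mem_univ t⟩
  refine (intervalIntegral.hasDerivAt_integral_of_dominated_loc_of_deriv_le (μ := volume)
    (bound := fun _ => C) hK ?_ ((hF x (mem_of_mem_nhds hs)).intervalIntegrable a b)
    hF'x.aestronglyMeasurable (.of_forall fun t ht y hy => hC (y, t) ⟨hy, uIoc_subset_uIcc ht⟩)
    intervalIntegrable_const (.of_forall fun t _ y hy => hderiv y (hKs hy) t)).2
  filter_upwards [hs] with y hy using (hF y hy).aestronglyMeasurable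

/-- The integral of `(1 - m * sin θ ^ 2) ^ p` over a quarter period. This family contains
`ellipticE` (`p = 1 / 2`) and `ellipticK` (`p = -1 / 2`) and is closed under differentiation in the
parameter `m`. -/
def ellipticPower (p m : ℝ) : ℝ :=
  ∫ θ in (0 : ℝ)..Real.pi / 2, (1 - m * Real.sin θ ^ 2) ^ p

lemma ellipticE_eq_ellipticPower (m : ℝ) : ellipticE m = ellipticPower (1 / 2) m := by
  simp only [ellipticE, ellipticPower, Real.sqrt_eq_rpow]

lemma ellipticK_eq_ellipticPower {m : ℝ} (hm : m < 1) : ellipticK m = ellipticPower (-1 / 2) m := by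
  refine integral_quarter_congr fun θ _ => ?_
  rw [neg_div, Real.rpow_neg (one_sub_mul_sin_sq_pos hm θ).le, Real.sqrt_eq_rpow, one_div]

lemma continuous_one_sub_mul_sin_sq_rpow (p : ℝ) {m : ℝ} (hm : m < 1) :
    Continuous fun θ => (1 - m * Real.sin θ ^ 2) ^ p :=
  Continuous.rpow_const (by fun_prop) fun θ => .inl (one_sub_mul_sin_sq_pos hm θ).ne'

theorem hasDerivAt_ellipticPower (p : ℝ) {m : ℝ} (hm : m < 1) (hm0 : m ≠ 0) :
    HasDerivAt (ellipticPower p) (p * (ellipticPower p m - ellipticPower (p - 1) m) / m) m := by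
  have hderiv (y : ℝ) (hy : y < 1) (θ : ℝ) : HasDerivAt (fun m => (1 - m * Real.sin θ ^ 2) ^ p)
      (-(1 * Real.sin θ ^ 2) * p * (1 - y * Real.sin θ ^ 2) ^ (p - 1)) y :=
    (((hasDerivAt_id' y).mul_const _).const_sub 1).rpow_const
      (.inl (one_sub_mul_sin_sq_pos hy θ).ne')
  have hcont : ContinuousOn (fun q : ℝ × ℝ =>
      -(1 * Real.sin q.2 ^ 2) * p * (1 - q.1 * Real.sin q.2 ^ 2) ^ (p - 1)) (Iio 1 ×ˢ univ) :=
    ContinuousOn.mul (by fun_prop) <| ContinuousOn.rpow_const (by fun_prop) fun q hq =>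
      .inl (one_sub_mul_sin_sq_pos hq.1 q.2).ne'
  refine (hasDerivAt_integral_of_continuousOn (Iio_mem_nhds hm)
    (fun y hy => continuous_one_sub_mul_sin_sq_rpow p hy) hcont hderiv 0
    (Real.pi / 2)).congr_deriv ?_
  rw [ellipticPower, ellipticPower, ← intervalIntegral.integral_sub
    ((continuous_one_sub_mul_sin_sq_rpow p hm).intervalIntegrable _ _)
    ((continuous_one_sub_mul_sin_sq_rpow (p - 1) hm).intervalIntegrable _ _),
    ← intervalIntegral.integral_const_mul, ← intervalIntegral.integral_div]
  refine integral_quarter_congr fun θ _ => ?_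
  have hpow := Real.rpow_add_one (one_sub_mul_sin_sq_pos hm θ).ne' (p - 1)
  rw [sub_add_cancel] at hpow
  rw [hpow]
  field_simp
  ring

theorem ellipticPower_recurrence (p : ℝ) {m : ℝ} (hm : m < 1) :
    2 * (p + 1) * ellipticPower (p + 1) m + (2 * p + 1) * (m - 2) * ellipticPower p m +
      2 * p * (1 - m) * ellipticPower (p - 1) m = 0 := by
  have hcont (q : ℝ) := continuous_one_sub_mul_sin_sq_rpow q hm
  have hderiv (θ : ℝ) : HasDerivAt
      (fun θ => m * (Real.sin θ * Real.cos θ * (1 - m * Real.sin θ ^ 2) ^ p))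
      (2 * (p + 1) * (1 - m * Real.sin θ ^ 2) ^ (p + 1) +
        (2 * p + 1) * (m - 2) * (1 - m * Real.sin θ ^ 2) ^ p +
        2 * p * (1 - m) * (1 - m * Real.sin θ ^ 2) ^ (p - 1)) θ := by
    have hpos := one_sub_mul_sin_sq_pos hm θ
    have hradicand := (((Real.hasDerivAt_sin θ).fun_pow 2).const_mul m).const_sub 1
    refine ((((Real.hasDerivAt_sin θ).mul (Real.hasDerivAt_cos θ)).mul
      (hradicand.rpow_const (p := p) (.inl hpos.ne'))).const_mul m).congr_deriv ?_
    have hpow := Real.rpow_add_one hpos.ne' (p - 1)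
    rw [sub_add_cancel] at hpow
    rw [Real.rpow_add_one hpos.ne', hpow]
    simp only [Pi.mul_apply]
    linear_combination m * (1 - m * Real.sin θ ^ 2) ^ (p - 1) *
      (1 - m * Real.sin θ ^ 2 - 2 * m * p * Real.sin θ ^ 2) * Real.cos_sq' θ
  have hzero := intervalIntegral.integral_eq_sub_of_hasDerivAt (a := 0) (b := Real.pi / 2)
    (fun θ _ => hderiv θ) (Continuous.intervalIntegrable (by fun_prop) _ _)
  rw [intervalIntegral.integral_add, intervalIntegral.integral_add] at hzero
  · simpa [ellipticPower] using hzero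
  all_goals exact Continuous.intervalIntegrable (by fun_prop) _ _

lemma hasDerivAt_ellipticE {m : ℝ} (hm : m < 1) (hm0 : m ≠ 0) :
    HasDerivAt ellipticE ((ellipticE m - ellipticK m) / (2 * m)) m := by
  rw [funext ellipticE_eq_ellipticPower, ellipticK_eq_ellipticPower hm]
  refine (hasDerivAt_ellipticPower (1 / 2) hm hm0).congr_deriv ?_
  norm_num
  ring

lemma hasDerivAt_ellipticK {m : ℝ} (hm : m < 1) (hm0 : m ≠ 0) :
    HasDerivAt ellipticK ((ellipticE m - (1 - m) * ellipticK m) / (2 * m * (1 - m))) m := by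
  have hE : ellipticE m = (1 - m) * ellipticPower (-1 / 2 - 1) m := by
    have hrecurrence := ellipticPower_recurrence (-1 / 2) hm
    rw [show (-1 / 2 + 1 : ℝ) = 1 / 2 by norm_num, ← ellipticE_eq_ellipticPower] at hrecurrence
    linear_combination hrecurrence
  refine ((hasDerivAt_ellipticPower (-1 / 2) hm hm0).congr_of_eventuallyEq ?_).congr_deriv ?_
  · filter_upwards [Iio_mem_nhds hm] with y hy using ellipticK_eq_ellipticPower hy
  · rw [ellipticK_eq_ellipticPower hm, hE]
    have hm1 : 1 - m ≠ 0 := (sub_pos.2 hm).ne'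
    field_simp
    ring

end EllipticDerivatives

section EllipticBounds

lemma ellipticE_nonneg (m : ℝ) : 0 ≤ ellipticE m :=
  integral_quarter_nonneg fun _ _ => Real.sqrt_nonneg _

lemma integral_quarter_le {g : ℝ → ℝ} (hg : Continuous g) {C : ℝ} (h : ∀ x, g x ≤ C) :
    ∫ x in (0 : ℝ)..Real.pi / 2, g x ≤ Real.pi / 2 * C := by
  refine (intervalIntegral.integral_mono (by positivity) (hg.intervalIntegrable _ _)
    intervalIntegrable_const h).trans_eq ?_
  rw [intervalIntegral.integral_const, sub_zero, smul_eq_mul]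

lemma ellipticE_le {m : ℝ} (hm : m ≤ 0) : ellipticE m ≤ Real.pi / 2 * √(1 - m) :=
  integral_quarter_le (by fun_prop) fun θ => Real.sqrt_le_sqrt <| by
    nlinarith [Real.sin_sq_le_one θ]

lemma ellipticK_le {m : ℝ} (hm : m ≤ 0) : ellipticK m ≤ Real.pi / 2 := by
  have hone (θ : ℝ) : 1 ≤ √(1 - m * Real.sin θ ^ 2) :=
    Real.one_le_sqrt.2 (by linarith [mul_nonpos_of_nonpos_of_nonneg hm (sq_nonneg (Real.sin θ))])
  refine (integral_quarter_le (C := 1) ?_ fun θ => ?_).trans_eq (mul_one _)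
  · exact continuous_const.div (by fun_prop) fun θ => (zero_lt_one.trans_le (hone θ)).ne'
  · exact (div_le_one (zero_lt_one.trans_le (hone θ))).2 (hone θ)

lemma ellipticE_zero : ellipticE 0 = Real.pi / 2 := by simp [ellipticE]

lemma ellipticK_zero : ellipticK 0 = Real.pi / 2 := by simp [ellipticK]

lemma continuous_ellipticE : Continuous ellipticE :=
  continuous_integral_quarter (g := fun m θ => √(1 - m * Real.sin θ ^ 2)) (by fun_prop)

lemma continuous_ellipticE_neg_sq : Continuous fun t : ℝ => ellipticE (-t ^ 2) :=
  continuous_ellipticE.comp (by fun_prop)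

lemma continuous_ellipticK_neg_sq : Continuous fun t : ℝ => ellipticK (-t ^ 2) :=
  continuous_ellipticK_comp (by fun_prop) fun t => by linarith [sq_nonneg t]

lemma abs_quadraticForm_le {a b c x y B C : ℝ} (hx : |x| ≤ B) (hy : |y| ≤ B) (ha : |a| ≤ C)
    (hb : |b| ≤ C) (hc : |c| ≤ C) :
    |a * x ^ 2 + b * (x * y) + c * y ^ 2| ≤ 3 * C * B ^ 2 := by
  have hB : 0 ≤ B := (abs_nonneg x).trans hx
  have hC : 0 ≤ C := (abs_nonneg a).trans ha
  calc |a * x ^ 2 + b * (x * y) + c * y ^ 2|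
      ≤ |a * x ^ 2| + |b * (x * y)| + |c * y ^ 2| := abs_add_three _ _ _
    _ = |a| * |x| ^ 2 + |b| * (|x| * |y|) + |c| * |y| ^ 2 := by
        rw [abs_mul, abs_mul, abs_mul, abs_mul, abs_pow, abs_pow]
    _ ≤ C * B ^ 2 + C * (B * B) + C * B ^ 2 := by gcongr
    _ = 3 * C * B ^ 2 := by ring

lemma abs_quadraticForm_elliptic_le {a b c C : ℝ} (t : ℝ) (ha : |a| ≤ C) (hb : |b| ≤ C)
    (hc : |c| ≤ C) :
    |a * ellipticE (-t ^ 2) ^ 2 + b * (ellipticE (-t ^ 2) * ellipticK (-t ^ 2)) +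
      c * ellipticK (-t ^ 2) ^ 2| ≤ 3 * C * (Real.pi / 2) ^ 2 * (2 * t ^ 2 + 1) := by
  have ht : -t ^ 2 ≤ 0 := neg_nonpos.2 (sq_nonneg t)
  have hone : 1 ≤ √(1 - -t ^ 2) := Real.one_le_sqrt.2 (by linarith)
  have hE : |ellipticE (-t ^ 2)| ≤ Real.pi / 2 * √(1 - -t ^ 2) :=
    (abs_of_nonneg (ellipticE_nonneg _)).trans_le (ellipticE_le ht)
  have hK : |ellipticK (-t ^ 2)| ≤ Real.pi / 2 * √(1 - -t ^ 2) :=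
    (abs_of_nonneg (ellipticK_nonneg _)).trans_le <| (ellipticK_le ht).trans <|
      le_mul_of_one_le_right (by positivity) hone
  have hC : 0 ≤ C := (abs_nonneg a).trans ha
  refine (abs_quadraticForm_le hE hK ha hb hc).trans ?_
  rw [mul_pow, Real.sq_sqrt (by linarith), ← mul_assoc]
  gcongr
  linarith

lemma integrableOn_Ioi_of_abs_le_inv_one_add_sq {f : ℝ → ℝ} (hf : Continuous f) {C : ℝ}
    (h : ∀ t ∈ Ioi (0 : ℝ), |f t| ≤ C * (1 + t ^ 2)⁻¹) : IntegrableOn f (Ioi 0) := by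
  refine Integrable.mono' (integrable_inv_one_add_sq.integrableOn.const_mul C)
    hf.aestronglyMeasurable ?_
  filter_upwards [ae_restrict_mem measurableSet_Ioi] with t ht using h t ht

lemma div_sq_le_inv_one_add_sq (t : ℝ) : t / (2 * t ^ 2 + 1) ^ 2 ≤ (1 + t ^ 2)⁻¹ := by
  rw [div_le_iff₀ (by positivity), ← div_eq_inv_mul, le_div_iff₀ (by positivity)]
  nlinarith [sq_nonneg (t - 1), sq_nonneg (t ^ 2), sq_nonneg (t * (t - 1))]

theorem integrableOn_zetaFourIntegrand : IntegrableOn zetaFourIntegrand (Ioi 0) := by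
  have hE := continuous_ellipticE_neg_sq
  have hK := continuous_ellipticK_neg_sq
  refine integrableOn_Ioi_of_abs_le_inv_one_add_sq (C := 24 * (Real.pi / 2) ^ 2) ?_ fun t ht => ?_
  · unfold zetaFourIntegrand
    exact (Continuous.div (by fun_prop) (by fun_prop) fun t => by positivity).mul continuous_id
  have ht' := ht.out
  have hsq : 0 ≤ t ^ 2 := sq_nonneg t
  have hfourth : 0 ≤ t ^ 4 := by positivity
  have hform := abs_quadraticForm_elliptic_le (a := 8 * t ^ 4 + 8 * t ^ 2 - 1)
    (b := -2 * (4 * t ^ 4 + 3 * t ^ 2 - 1)) (c := 2 * t ^ 4 + t ^ 2 - 1)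
    (C := 8 * (2 * t ^ 2 + 1) ^ 2) t (abs_le.2 ⟨by linarith, by linarith⟩)
    (abs_le.2 ⟨by linarith, by linarith⟩) (abs_le.2 ⟨by linarith, by linarith⟩)
  have hfactor : zetaFourIntegrand t = ((8 * t ^ 4 + 8 * t ^ 2 - 1) * ellipticE (-t ^ 2) ^ 2 +
      -2 * (4 * t ^ 4 + 3 * t ^ 2 - 1) * (ellipticE (-t ^ 2) * ellipticK (-t ^ 2)) +
      (2 * t ^ 4 + t ^ 2 - 1) * ellipticK (-t ^ 2) ^ 2) * (t / (2 * t ^ 2 + 1) ^ 5) := by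
    unfold zetaFourIntegrand
    ring
  calc |zetaFourIntegrand t|
      ≤ 3 * (8 * (2 * t ^ 2 + 1) ^ 2) * (Real.pi / 2) ^ 2 * (2 * t ^ 2 + 1) *
          (t / (2 * t ^ 2 + 1) ^ 5) := by
        rw [hfactor, abs_mul, abs_of_pos (a := t / _) (by positivity)]
        gcongr
    _ = 24 * (Real.pi / 2) ^ 2 * (t / (2 * t ^ 2 + 1) ^ 2) := by
        field_simp
        norm_num
    _ ≤ 24 * (Real.pi / 2) ^ 2 * (1 + t ^ 2)⁻¹ := by
        gcongr
        exact div_sq_le_inv_one_add_sq t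

end EllipticBounds

section ZetaFour

lemma integrableOn_ellipticK_neg_sq_div_pow (k : ℕ) :
    IntegrableOn (fun t => ellipticK (-t ^ 2) ^ 2 / (2 * t ^ 2 + 1) ^ (k + 2) * t) (Ioi 0) := by
  have hK := continuous_ellipticK_neg_sq
  refine integrableOn_Ioi_of_abs_le_inv_one_add_sq (C := (Real.pi / 2) ^ 2) ?_ fun t ht => ?_
  · exact (Continuous.div (by fun_prop) (by fun_prop) fun t => by positivity).mul continuous_id
  have ht' := ht.out
  have hone : 1 ≤ 2 * t ^ 2 + 1 := le_add_of_nonneg_left (by positivity)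
  calc |ellipticK (-t ^ 2) ^ 2 / (2 * t ^ 2 + 1) ^ (k + 2) * t|
      = ellipticK (-t ^ 2) ^ 2 * (t / (2 * t ^ 2 + 1) ^ (k + 2)) := by
        rw [abs_of_nonneg (by positivity), div_mul_eq_mul_div, mul_div_assoc]
    _ ≤ (Real.pi / 2) ^ 2 * (t / (2 * t ^ 2 + 1) ^ 2) := by
        gcongr
        · exact ellipticK_nonneg _
        · exact ellipticK_le (neg_nonpos.2 (sq_nonneg t))
        · exact Nat.le_add_left 2 k
    _ ≤ (Real.pi / 2) ^ 2 * (1 + t ^ 2)⁻¹ := by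
        gcongr
        exact div_sq_le_inv_one_add_sq t

lemma bijOn_sq : BijOn (fun t : ℝ => t ^ 2) (Ioi 0) (Ioi 0) :=
  InvOn.bijOn (f' := Real.sqrt) ⟨fun _ ht => Real.sqrt_sq (le_of_lt ht),
    fun _ hm => Real.sq_sqrt (le_of_lt hm)⟩ (fun _ ht => pow_pos (mem_Ioi.1 ht) 2)
    (fun _ hm => Real.sqrt_pos.2 hm)

lemma lintegral_Ioi_eq_sq (g : ℝ → ENNReal) :
    ∫⁻ m in Ioi (0 : ℝ), g m = ∫⁻ t in Ioi (0 : ℝ), ENNReal.ofReal (2 * t) * g (t ^ 2) := by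
  have hderiv (t : ℝ) : HasDerivAt (fun t : ℝ => t ^ 2) (2 * t) t := by
    simpa using hasDerivAt_pow 2 t
  rw [setLIntegral_eq_of_bijOn measurableSet_Ioi (fun t _ => hderiv t) bijOn_sq]
  refine setLIntegral_congr_fun measurableSet_Ioi fun t ht => ?_
  have ht' := ht.out
  rw [abs_of_pos (by positivity)]

theorem integral_ellipticK_neg_sq_div_pow (j : ℕ) :
    ∫ t in Ioi (0 : ℝ), ellipticK (-t ^ 2) ^ 2 / (2 * t ^ 2 + 1) ^ (2 * j + 3) * t =
      (∫ α in (0 : ℝ)..Real.pi / 2, Real.cos α ^ (2 * (j + 1))) / 4 *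
        radicandIntegral fun a _ => (1 - a) ^ (j + 1) := by
  have hmoment := lintegral_ellipticK_neg_sq_div_pow j
  have hintegrand {t : ℝ} (ht : t ∈ Ioi 0) :
      ENNReal.ofReal (2 * t) *
          ENNReal.ofReal (ellipticK (-t ^ 2) ^ 2 / (1 + 2 * t ^ 2) ^ (2 * j + 3)) =
        ENNReal.ofReal (2 * (ellipticK (-t ^ 2) ^ 2 / (2 * t ^ 2 + 1) ^ (2 * j + 3) * t)) := by
    have ht' := ht.out
    rw [← ENNReal.ofReal_mul (by positivity), add_comm 1]
    congr 1
    ring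
  have hnonneg : ∀ t ∈ Ioi (0 : ℝ),
      0 ≤ ellipticK (-t ^ 2) ^ 2 / (2 * t ^ 2 + 1) ^ (2 * j + 3) * t := fun t ht => by
    have ht' := ht.out
    positivity
  have hcos : 0 ≤ ∫ α in (0 : ℝ)..Real.pi / 2, Real.cos α ^ (2 * (j + 1)) :=
    integral_quarter_nonneg fun α _ => by rw [pow_mul]; positivity
  have hradicand : 0 ≤ radicandIntegral fun a _ => (1 - a) ^ (j + 1) :=
    integral_quarter_nonneg fun _ _ => integral_quarter_nonneg fun ξ _ =>
      div_nonneg (pow_nonneg (sub_nonneg.2 (Real.sin_sq_le_one ξ)) _) (Real.sqrt_nonneg _)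
  rw [lintegral_Ioi_eq_sq, setLIntegral_congr_fun measurableSet_Ioi fun t ht => hintegrand ht,
    ← ofReal_integral_eq_lintegral_ofReal
      ((integrableOn_ellipticK_neg_sq_div_pow (2 * j + 1)).const_mul 2), integral_const_mul,
    ENNReal.ofReal_eq_ofReal_iff
      (mul_nonneg two_pos.le (setIntegral_nonneg measurableSet_Ioi hnonneg)) (by positivity)]
    at hmoment
  · linear_combination hmoment / 2
  · filter_upwards [ae_restrict_mem measurableSet_Ioi] with t ht
      using mul_nonneg two_pos.le (hnonneg t ht)

lemma integral_ellipticK_neg_sq_div_cube :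
    ∫ t in Ioi (0 : ℝ), ellipticK (-t ^ 2) ^ 2 / (2 * t ^ 2 + 1) ^ 3 * t =
      Real.pi / 16 * radicandIntegral fun a _ => (1 - a) ^ 1 := by
  rw [integral_ellipticK_neg_sq_div_pow 0, zero_add, mul_one, integral_cos_sq,
    Real.cos_pi_div_two, Real.sin_zero]
  ring

lemma integral_ellipticK_neg_sq_div_fifth :
    ∫ t in Ioi (0 : ℝ), ellipticK (-t ^ 2) ^ 2 / (2 * t ^ 2 + 1) ^ 5 * t =
      3 * Real.pi / 64 * radicandIntegral fun a _ => (1 - a) ^ 2 := by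
  rw [integral_ellipticK_neg_sq_div_pow 1, show 2 * (1 + 1) = 2 + 2 by rfl, integral_cos_pow,
    integral_cos_sq, Real.cos_pi_div_two, Real.sin_zero]
  push_cast
  ring

/-- Integrating `zetaFourIntegrand` by parts until only multiples of the square of `ellipticK`
remain produces this quadratic form in the two elliptic integrals as the boundary term. -/
def zetaFourPrimitive (t : ℝ) : ℝ :=
  (3 / 16 * (2 * t ^ 2 + 1)⁻¹ ^ 4 - 1 / 2 * (2 * t ^ 2 + 1)⁻¹ ^ 2) * ellipticE (-t ^ 2) ^ 2 +
    (-3 / 16 * (2 * t ^ 2 + 1)⁻¹ ^ 4 + 5 / 16 * (2 * t ^ 2 + 1)⁻¹ ^ 3 +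
      1 / 2 * (2 * t ^ 2 + 1)⁻¹ ^ 2) * (ellipticE (-t ^ 2) * ellipticK (-t ^ 2)) +
    (-1 / 2 * (2 * t ^ 2 + 1)⁻¹ ^ 4 - 5 / 32 * (2 * t ^ 2 + 1)⁻¹ ^ 3 +
      11 / 32 * (2 * t ^ 2 + 1)⁻¹ ^ 2) * ellipticK (-t ^ 2) ^ 2

/-- The multiples of the square of `ellipticK` left over from `zetaFourIntegrand` after subtracting
the derivative of `zetaFourPrimitive`. -/
def zetaFourRemainder (t : ℝ) : ℝ :=
  45 / 8 * (ellipticK (-t ^ 2) ^ 2 / (2 * t ^ 2 + 1) ^ 3 * t) -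
    9 * (ellipticK (-t ^ 2) ^ 2 / (2 * t ^ 2 + 1) ^ 5 * t)

lemma hasDerivAt_zetaFourPrimitive {t : ℝ} (ht : 0 < t) :
    HasDerivAt zetaFourPrimitive (zetaFourIntegrand t - zetaFourRemainder t) t := by
  have hsq : HasDerivAt (fun t : ℝ => t ^ 2) (2 * t) t := by simpa using hasDerivAt_pow 2 t
  have hneg : -t ^ 2 < 0 := neg_neg_of_pos (pow_pos ht 2)
  have hE : HasDerivAt (fun t : ℝ => ellipticE (-t ^ 2)) _ t :=
    HasDerivAt.comp (h₂ := ellipticE) (h := fun t => -t ^ 2) t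
      (hasDerivAt_ellipticE (hneg.trans one_pos) hneg.ne) hsq.fun_neg
  have hK : HasDerivAt (fun t : ℝ => ellipticK (-t ^ 2)) _ t :=
    HasDerivAt.comp (h₂ := ellipticK) (h := fun t => -t ^ 2) t
      (hasDerivAt_ellipticK (hneg.trans one_pos) hneg.ne) hsq.fun_neg
  have hw : HasDerivAt (fun t : ℝ => (2 * t ^ 2 + 1)⁻¹) _ t :=
    ((hsq.const_mul 2).add_const 1).inv (by positivity)
  have hEE := (((hw.fun_pow 4).const_mul (3 / 16)).sub ((hw.fun_pow 2).const_mul (1 / 2))).mul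
    (hE.fun_pow 2)
  have hEK := ((((hw.fun_pow 4).const_mul (-3 / 16)).add ((hw.fun_pow 3).const_mul (5 / 16))).add
    ((hw.fun_pow 2).const_mul (1 / 2))).mul (hE.mul hK)
  have hKK := ((((hw.fun_pow 4).const_mul (-1 / 2)).sub ((hw.fun_pow 3).const_mul (5 / 32))).add
    ((hw.fun_pow 2).const_mul (11 / 32))).mul (hK.fun_pow 2)
  refine HasDerivAt.congr_deriv (f := zetaFourPrimitive) ((hEE.add hEK).add hKK) ?_
  simp only [Pi.add_apply, Pi.sub_apply, Pi.mul_apply]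
  unfold zetaFourIntegrand zetaFourRemainder
  generalize ellipticE (-t ^ 2) = e
  generalize ellipticK (-t ^ 2) = k
  norm_num
  field_simp
  ring

lemma continuous_zetaFourPrimitive : Continuous zetaFourPrimitive := by
  have hE := continuous_ellipticE_neg_sq
  have hK := continuous_ellipticK_neg_sq
  have hw : Continuous fun t : ℝ => (2 * t ^ 2 + 1)⁻¹ :=
    Continuous.inv₀ (by fun_prop) fun t => by positivity
  unfold zetaFourPrimitive
  fun_prop

lemma zetaFourPrimitive_zero : zetaFourPrimitive 0 = 0 := by
  norm_num [zetaFourPrimitive, ellipticE_zero, ellipticK_zero]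
  ring

lemma abs_zetaFourPrimitive_le (t : ℝ) :
    |zetaFourPrimitive t| ≤ 6 * (Real.pi / 2) ^ 2 * (2 * t ^ 2 + 1)⁻¹ := by
  have hw : 6 * (Real.pi / 2) ^ 2 * (2 * t ^ 2 + 1)⁻¹ =
      3 * (2 * (2 * t ^ 2 + 1)⁻¹ ^ 2) * (Real.pi / 2) ^ 2 * (2 * t ^ 2 + 1) := by
    field_simp
    norm_num
  have hw_le : (2 * t ^ 2 + 1)⁻¹ ≤ 1 :=
    inv_le_one_of_one_le₀ (le_add_of_nonneg_left (by positivity))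
  have hw_pos : 0 < (2 * t ^ 2 + 1)⁻¹ := by positivity
  rw [hw]
  unfold zetaFourPrimitive
  generalize (2 * t ^ 2 + 1)⁻¹ = w at hw_pos hw_le
  have hsq : 0 < w ^ 2 := by positivity
  have hcube : 0 < w ^ 3 := by positivity
  have hfourth : 0 < w ^ 4 := by positivity
  have hcube_le : w ^ 3 ≤ w ^ 2 := pow_le_pow_of_le_one hw_pos.le hw_le (by norm_num)
  have hfourth_le : w ^ 4 ≤ w ^ 2 := pow_le_pow_of_le_one hw_pos.le hw_le (by norm_num)
  exact abs_quadraticForm_elliptic_le t (abs_le.2 ⟨by linarith, by linarith⟩)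
    (abs_le.2 ⟨by linarith, by linarith⟩) (abs_le.2 ⟨by linarith, by linarith⟩)

lemma tendsto_zetaFourPrimitive : Tendsto zetaFourPrimitive atTop (𝓝 0) := by
  have htop : Tendsto (fun t : ℝ => 2 * t ^ 2 + 1) atTop atTop :=
    tendsto_atTop_add_const_right _ _
      ((tendsto_pow_atTop two_ne_zero).const_mul_atTop two_pos)
  refine squeeze_zero_norm abs_zetaFourPrimitive_le ?_
  simpa using htop.inv_tendsto_atTop.const_mul (6 * (Real.pi / 2) ^ 2)

theorem integral_zetaFourIntegrand :
    ∫ t in Ioi (0 : ℝ), zetaFourIntegrand t = 9 * Real.pi / 128 * angleIntegral := by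
  have hcube := (integrableOn_ellipticK_neg_sq_div_pow 1).const_mul (45 / 8)
  have hfifth := (integrableOn_ellipticK_neg_sq_div_pow 3).const_mul 9
  have hremainder : IntegrableOn zetaFourRemainder (Ioi 0) := hcube.sub hfifth
  have hboundary := integral_Ioi_of_hasDerivAt_of_tendsto
    continuous_zetaFourPrimitive.continuousWithinAt
    (fun t ht => hasDerivAt_zetaFourPrimitive ht)
    (integrableOn_zetaFourIntegrand.sub hremainder) tendsto_zetaFourPrimitive
  rw [zetaFourPrimitive_zero, sub_zero, integral_sub integrableOn_zetaFourIntegrand hremainder,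
    sub_eq_zero] at hboundary
  rw [hboundary, angleIntegral_eq]
  unfold zetaFourRemainder
  rw [integral_sub hcube hfifth, integral_const_mul, integral_const_mul,
    integral_ellipticK_neg_sq_div_cube, integral_ellipticK_neg_sq_div_fifth]
  ring

theorem zetaFour_eq_eight_mul_sharedPairMean : zetaFour = 8 * sharedPairMean := by
  rw [zetaFour, integral_zetaFourIntegrand, sharedPairMean_eq]
  field_simp
  ring

end ZetaFour

section Extremes

variable {n : ℕ} {u : EuclideanSpace ℝ (Fin n)}

lemma sum_offDiag_sq_add_sq (hu : ‖u‖ = 1) :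
    ∑ p ∈ (Finset.univ : Finset (Fin n)).offDiag, (u p.1 ^ 2 + u p.2 ^ 2) = 2 * (n - 1) := by
  have hdiag : ∑ p ∈ (Finset.univ : Finset (Fin n)).diag, (u p.1 ^ 2 + u p.2 ^ 2) = 2 := by
    rw [Finset.sum_diag, Finset.sum_add_distrib, sum_sq_eq_one hu]
    norm_num
  have hall : ∑ p ∈ (Finset.univ : Finset (Fin n)) ×ˢ Finset.univ, (u p.1 ^ 2 + u p.2 ^ 2) =
      2 * n := by
    simp only [Finset.sum_product, Finset.sum_add_distrib, Finset.sum_const,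
      nsmul_eq_mul, ← Finset.mul_sum, sum_sq_eq_one hu, Finset.card_univ, Fintype.card_fin]
    ring
  rw [← Finset.diag_union_offDiag, Finset.sum_union (Finset.disjoint_diag_offDiag _), hdiag] at hall
  linarith

lemma sq_add_sq_le_one (hu : ‖u‖ = 1) {i j : Fin n} (hij : i ≠ j) : u i ^ 2 + u j ^ 2 ≤ 1 := by
  rw [← sum_sq_eq_one hu, ← Finset.sum_pair hij (f := fun k => u k ^ 2)]
  exact Finset.sum_le_sum_of_subset_of_nonneg (Finset.subset_univ _) fun k _ _ => sq_nonneg _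

lemma two_mul_sub_one_le_ar (hu : ‖u‖ = 1) : 2 * (n - 1) ≤ ar u := by
  rw [ar_eq_sum_offDiag hu, ← sum_offDiag_sq_add_sq hu]
  refine Finset.sum_le_sum fun p hp => Real.le_sqrt_of_sq_le ?_
  exact pow_le_of_le_one (by positivity)
    (sq_add_sq_le_one hu (Finset.mem_offDiag.1 hp).2.2) two_ne_zero

lemma ar_le_sub_one_mul_sqrt [NeZero n] (hu : ‖u‖ = 1) : ar u ≤ (n - 1) * √(2 * n) := by
  have hcauchy := sq_sum_le_card_mul_sum_sq (s := (Finset.univ : Finset (Fin n)).offDiag)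
    (f := fun p => √(u p.1 ^ 2 + u p.2 ^ 2))
  rw [← ar_eq_sum_offDiag hu, Finset.sum_congr rfl fun p _ => Real.sq_sqrt (by positivity),
    sum_offDiag_sq_add_sq hu, cast_card_offDiag, Finset.card_univ, Fintype.card_fin] at hcauchy
  have hn : (1 : ℝ) ≤ n := Nat.one_le_cast.2 NeZero.one_le
  refine (abs_le_of_sq_le_sq' ?_ (mul_nonneg (sub_nonneg.2 hn) (Real.sqrt_nonneg _))).2
  rw [mul_pow, Real.sq_sqrt (by positivity)]
  linarith

theorem isGreatest_ar (n : ℕ) [NeZero n] :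
    IsGreatest (ar '' Metric.sphere (0 : EuclideanSpace ℝ (Fin n)) 1) ((n - 1) * √(2 * n)) := by
  refine ⟨?_, forall_mem_image.2 fun u hu => ar_le_sub_one_mul_sqrt (mem_sphere_zero_iff_norm.1 hu)⟩
  have hn : (0 : ℝ) < n := Nat.cast_pos.2 (NeZero.pos n)
  let diagonal : EuclideanSpace ℝ (Fin n) := WithLp.toLp 2 fun _ => (√n)⁻¹
  have hcoord (i : Fin n) : diagonal i ^ 2 = (n : ℝ)⁻¹ := by
    rw [inv_pow, Real.sq_sqrt hn.le]
  have hnorm : ‖diagonal‖ = 1 := by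
    simp only [EuclideanSpace.norm_eq, Real.norm_eq_abs, sq_abs, hcoord, Finset.sum_const,
      Finset.card_univ, Fintype.card_fin, nsmul_eq_mul, mul_inv_cancel₀ hn.ne', Real.sqrt_one]
  refine ⟨diagonal, mem_sphere_zero_iff_norm.2 hnorm, ?_⟩
  have hsqrt : √((n : ℝ)⁻¹ + (n : ℝ)⁻¹) = √(2 * n) / n := by
    rw [show (n : ℝ)⁻¹ + (n : ℝ)⁻¹ = 2 * n / n ^ 2 by field_simp; norm_num,
      Real.sqrt_div (by positivity), Real.sqrt_sq hn.le]
  simp only [ar_eq_sum_offDiag hnorm, hcoord, hsqrt, Finset.sum_const, nsmul_eq_mul,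
    cast_card_offDiag, Finset.card_univ, Fintype.card_fin]
  field_simp

theorem isLeast_ar (n : ℕ) [NeZero n] :
    IsLeast (ar '' Metric.sphere (0 : EuclideanSpace ℝ (Fin n)) 1) (2 * (n - 1)) := by
  refine ⟨?_, forall_mem_image.2 fun u hu => two_mul_sub_one_le_ar (mem_sphere_zero_iff_norm.1 hu)⟩
  have hnorm : ‖EuclideanSpace.single (0 : Fin n) (1 : ℝ)‖ = 1 := by simp
  refine ⟨EuclideanSpace.single 0 1, mem_sphere_zero_iff_norm.2 hnorm, ?_⟩
  rw [ar_eq_sum_offDiag hnorm, ← sum_offDiag_sq_add_sq hnorm]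
  refine Finset.sum_congr rfl fun p hp => ?_
  have hne := (Finset.mem_offDiag.1 hp).2.2
  by_cases hfst : p.1 = 0
  · simp [hfst, hfst ▸ hne.symm]
  · by_cases hsnd : p.2 = 0 <;> simp [hfst, hsnd]

end Extremes

section DimensionFour

theorem zeta_four_eq : zeta 4 (by norm_num) = zetaFour := by
  rw [zeta_eq_eight_mul_sharedPairMean, zetaFour_eq_eight_mul_sharedPairMean]

theorem sphereMean_four_ar : sphereMean 4 ar = 8 := by
  have hthree : Real.Gamma (3 / 2) = √Real.pi / 2 := by
    rw [show (3 / 2 : ℝ) = 1 / 2 + 1 by norm_num, Real.Gamma_add_one (by norm_num),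
      Real.Gamma_one_half_eq]
    ring
  have hfive : Real.Gamma (((4 : ℕ) + 1) / 2) = 3 * √Real.pi / 4 := by
    rw [show (((4 : ℕ) : ℝ) + 1) / 2 = 3 / 2 + 1 by norm_num, Real.Gamma_add_one (by norm_num),
      hthree]
    ring
  have hfour : Real.Gamma ((4 : ℕ) / 2) = 1 := by
    rw [show ((4 : ℕ) : ℝ) / 2 = 2 by norm_num, Real.Gamma_two]
  rw [sphereMean_ar, hfour, hfive]
  field_simp
  norm_num

theorem sphereMean_four_ar_sq :
    sphereMean 4 (fun u => ar u ^ 2) = 12 + 6 * zetaFour + 3 * Real.pi := by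
  rw [sphereMean_ar_sq (by norm_num), zeta_four_eq]
  push_cast
  ring

theorem isGreatest_ar_four :
    IsGreatest (ar '' Metric.sphere (0 : EuclideanSpace ℝ (Fin 4)) 1) (6 * √2) := by
  have hmax : (6 * √2 : ℝ) = ((4 : ℕ) - 1) * √(2 * (4 : ℕ)) := by
    rw [show (2 * (4 : ℕ) : ℝ) = 2 ^ 2 * 2 by norm_num, Real.sqrt_mul (by positivity),
      Real.sqrt_sq two_pos.le]
    push_cast
    ring
  exact hmax ▸ isGreatest_ar 4

theorem isLeast_ar_four :
    IsLeast (ar '' Metric.sphere (0 : EuclideanSpace ℝ (Fin 4)) 1) 6 := by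
  have hmin : (6 : ℝ) = 2 * ((4 : ℕ) - 1) := by norm_num
  exact hmin ▸ isLeast_ar 4

end DimensionFour

end CubeShadow

end

theorem mainTheorem2 :
    -- the surface area of the projected unit `n`-cube, for every unit vector `u`
    (∀ n : ℕ, 2 ≤ n → ∀ u : EuclideanSpace ℝ (Fin n), ‖u‖ = 1 →
      CubeShadow.surfaceArea u =
        ENNReal.ofReal (2 * ∑ i : Fin n, ∑ j ∈ Finset.Ioi i, √(u i ^ 2 + u j ^ 2))) ∧
    -- the moments, the maximum and the minimum for the `4`-cube
    CubeShadow.sphereMean 4 CubeShadow.ar = 8 ∧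
    CubeShadow.sphereMean 4 (fun u => CubeShadow.ar u ^ 2)
      = 12 + 6 * CubeShadow.zetaFour + 3 * Real.pi ∧
    IsGreatest (CubeShadow.ar '' Metric.sphere (0 : EuclideanSpace ℝ (Fin 4)) 1) (6 * √2) ∧
    IsLeast (CubeShadow.ar '' Metric.sphere (0 : EuclideanSpace ℝ (Fin 4)) 1) 6 ∧
    -- the two triple integrals
    (∫ θ in (0 : ℝ)..Real.pi / 2, ∫ φ in (0 : ℝ)..Real.pi / 2, ∫ ψ in (0 : ℝ)..Real.pi / 2,
      Real.sin φ * Real.sin ψ * √(Real.cos φ ^ 2 * Real.sin ψ ^ 2 + Real.cos ψ ^ 2)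
        * (1 / (2 * Real.pi ^ 2)) * Real.sin φ * Real.sin ψ ^ 2) = Real.pi / 128 ∧
    (∫ θ in (0 : ℝ)..Real.pi / 2, ∫ φ in (0 : ℝ)..Real.pi / 2, ∫ ψ in (0 : ℝ)..Real.pi / 2,
      Real.sin φ * Real.sin ψ
        * √(Real.sin θ ^ 2 * Real.sin φ ^ 2 * Real.sin ψ ^ 2 + Real.cos ψ ^ 2)
        * (1 / (2 * Real.pi ^ 2)) * Real.sin φ * Real.sin ψ ^ 2) = CubeShadow.zetaFour / 256 ∧
    MeasureTheory.IntegrableOn CubeShadow.zetaFourIntegrand (Set.Ioi 0) ∧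
    -- the moments for the `n`-cube
    (∀ n : ℕ, 2 ≤ n →
      CubeShadow.sphereMean n CubeShadow.ar
        = √Real.pi * ((n : ℝ) - 1) * n / 2 * (Real.Gamma ((n : ℝ) / 2)
            / Real.Gamma (((n : ℝ) + 1) / 2))) ∧
    (∀ (n : ℕ) (hn : 3 ≤ n),
      CubeShadow.sphereMean n (fun u => CubeShadow.ar u ^ 2)
        = 4 * ((n : ℝ) - 1) + ((n : ℝ) - 2) * ((n : ℝ) - 1) * CubeShadow.zeta n hn
          + ((n : ℝ) - 3) * ((n : ℝ) - 2) * ((n : ℝ) - 1) / 2 * Real.pi) ∧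
    CubeShadow.zeta 4 (by norm_num) = CubeShadow.zetaFour := by
  refine ⟨fun n _ u hu => CubeShadow.surfaceArea_eq hu, CubeShadow.sphereMean_four_ar,
    CubeShadow.sphereMean_four_ar_sq, CubeShadow.isGreatest_ar_four, CubeShadow.isLeast_ar_four,
    CubeShadow.tripleIntegral_disjoint, ?_, CubeShadow.integrableOn_zetaFourIntegrand,
    fun n hn => ?_, fun n hn => CubeShadow.sphereMean_ar_sq hn, CubeShadow.zeta_four_eq⟩
  · rw [CubeShadow.tripleIntegral_shared, CubeShadow.zetaFour_eq_eight_mul_sharedPairMean]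
    ring
  · have : NeZero n := ⟨by omega⟩
    exact CubeShadow.sphereMean_ar
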